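/- Let $1\le m<N$ and $n\ge 1$, and write $X=(x,y)\in\mathbb R^m\times\mathbb R^{N-m}=\mathbb R^N$. For $i=1,\dots,n$ let $a_i=a_i(x,t)$, $x\in\mathbb R^m$, $t>0$, be such that $a_i\in L^\infty(\mathbb R^m\times[\alpha_-,\alpha_+])$ for all $\alpha_+>\alpha_->0$, $\inf_{x}a_i(x,t)>0$ for every $t>0$, and $t\mapsto a_i(x,t)$ is $C^1$ on $(0,\infty)$ for every $x$. Let $F=F(x,\xi^1,\dots,\xi^n)$ be such that, for every fixed $x\in\mathbb R^m$, $F(x,\cdot)$ is of class $C^2$ in each variable $\xi^i$ separately and is twice differentiable on $\mathbb R^n$; write $F_i=\partial_{\xi^i}F$, $F_{ij}=\partial_{\xi^j}\partial_{\xi^i}F$. For $x\in\mathbb R^m$ and $\eta\in\mathbb R^N\setminus\{0\}$ put $$\mathcal A^i(x,\eta)=a_i(x,|\eta|)\,I+\frac{\partial a_i}{\partial t}(x,|\eta|)\,\frac{\eta\otimes\eta}{|\eta|},$$ and $\mathcal A^i(x,0)=a_i(x,0)\,I$, where $a_i(x,0)\in\mathbb R$ is an arbitrary fixed value (with $a_i(x,|\eta|)\eta=0$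 at $\eta=0$). Let $(u^1,\dots,u^n)$ satisfy, for every $i$: $u^i\in C^1(\mathbb R^N)\cap C^2(\{\nabla u^i\ne0\})\cap L^\infty(\mathbb R^N)$ and $\nabla u^i\in L^\infty(\mathbb R^N,\mathbb R^N)\cap W^{1,2}_{loc}(\mathbb R^N,\mathbb R^N)$. Assume that, for every $\psi=(\psi^1,\dots,\psi^n)\in C_c^\infty(\mathbb R^N,\mathbb R^n)$, all integrals below converge and * (weak solution) $\int_{\mathbb R^N}\langle a_i(x,|\nabla u^i|)\nabla u^i,\nabla\psi^i\rangle\,dX=\int_{\mathbb R^N}F_i(x,u^1,\dots,u^n)\,\psi^i\,dX$ for $i=1,\dots,n$; * (stability) $\sum_{i}\int_{\mathbb R^N}\langle\mathcal A^i(x,\nabla u^i)\nabla\psi^i,\nabla\psi^i\rangle\,dX-\sum_{i,j}\int_{\mathbb R^N}F_{ij}(x,u^1,\dots,u^n)\,\psi^i\psi^j\,dX\ge0$. Assume moreover: * there are functions $\theta^i\in C^1(\mathbb R^N)$, $i=1,\dots,n$, each either everywhere positive or everywhere negative, with $F_{ij}(x,u^1(X),\dots,u^n(X))\,\theta^i(X)\,\theta^j(X)\ge0$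 for all $X\in\mathbb R^N$ and all $1\le i<j\le n$; * for every $i$ and every $R>0$, $X\mapsto\mathcal A^i(x,\nabla u^i(X))$ belongs to $L^\infty(\{\nabla u^i\ne0\}\cap B_R)$; * for every $i$, $\mathcal A^i(x,\nabla u^i(X))$ is positive definite for almost every $X$ with $\nabla u^i(X)\neq 0$; * there are $C_1,\dots,C_n\ge1$ such that the largest eigenvalue $\overline{\mathcal A}^i(X)$ of $\mathcal A^i(x,\nabla u^i(X))$ satisfies $\int_{B_R}\overline{\mathcal A}^i(X)\,|\nabla u^i(X)|^2\,dX\le C_iR^2$ for every $i$ and every $R\ge\max\{C_1,\dots,C_n\}$, where $B_R$ is the ball of radius $R$ centred at $0$. Then for each $i=1,\dots,n$ there exist $\bar u^i:\mathbb R^m\times\mathbb R\to\mathbb R$ and $\omega_i:\mathbb R^m\to\mathbb S^{N-m-1}$ such that $$u^i(x,y)=\bar u^i\big(x,\langle\omega_i(x),y\rangle\big)\qquad\text{for all }(x,y)\in\mathbb R^m\times\mathbb R^{N-m}.$$ Moreover, $\omega_i$ is constant on each connected component of $\{\nabla_yu^i\ne0\}$: if $(x,y)$ and $(x',y')$ lie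 in the same connected component of this subset of $\mathbb R^N$, then $\omega_i(x)=\omega_i(x')$. -/

import Mathlib

noncomputable section

namespace Fibered

open MeasureTheory Metric Set
open scoped ContDiff

/-- `ℝ^N = ℝ^m × ℝ^k` (so `k = N - m`) with the Euclidean norm and Lebesgue measure; the
coordinates `Sum.inl _` are those of `x`, the coordinates `Sum.inr _` those of `y`. -/
abbrev Space (m k : ℕ) := EuclideanSpace ℝ (Fin m ⊕ Fin k)

/-- The component `x` of `X = (x, y)`. -/
def xPart {m k : ℕ} (X : Space m k) : EuclideanSpace ℝ (Fin m) :=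
  WithLp.toLp 2 fun j => X (Sum.inl j)

/-- The component `y` of `X = (x, y)`. -/
def yPart {m k : ℕ} (X : Space m k) : EuclideanSpace ℝ (Fin k) :=
  WithLp.toLp 2 fun j => X (Sum.inr j)

/-- The partial gradient `∇_y u`. -/
def gradY {m k : ℕ} (u : Space m k → ℝ) (X : Space m k) : EuclideanSpace ℝ (Fin k) :=
  yPart (gradient u X)

/-- `φ ∈ C_c^∞(ℝ^N)`. -/
def IsTest {m k : ℕ} (φ : Space m k → ℝ) : Prop :=
  ContDiff ℝ ∞ φ ∧ HasCompactSupport φ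

/-- `f ∈ L²_loc(ℝ^N)`. -/
def MemL2Loc {m k : ℕ} (f : Space m k → ℝ) : Prop :=
  ∀ R : ℝ, MemLp f 2 (volume.restrict (ball 0 R))

/-- `f ∈ W^{1,2}_loc(ℝ^N)`: `f` and its weak partial derivatives are in `L²_loc`. -/
def MemW12Loc {m k : ℕ} (f : Space m k → ℝ) : Prop :=
  MemL2Loc f ∧ ∀ p : Fin m ⊕ Fin k, ∃ g : Space m k → ℝ, MemL2Loc g ∧
    ∀ φ : Space m k → ℝ, IsTest φ →
      (∫ X, f X * gradient φ X p) = -(∫ X, g X * φ X)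

/-- Standing assumptions on the coefficients `a_i(x,t)`, `t > 0`. -/
structure CoeffAssumptions {m n : ℕ} (a : Fin n → EuclideanSpace ℝ (Fin m) → ℝ → ℝ) : Prop where
  memLp_top : ∀ i, ∀ α β : ℝ, 0 < α → α < β →
    MemLp (fun p : EuclideanSpace ℝ (Fin m) × ℝ => a i p.1 p.2) ⊤
      (volume.restrict (univ ×ˢ Icc α β))
  inf_pos : ∀ i, ∀ t : ℝ, 0 < t → ∃ c : ℝ, 0 < c ∧ ∀ x, c ≤ a i x t
  contDiffOn : ∀ i x, ContDiffOn ℝ 1 (a i x) (Ioi 0)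

/-- Standing assumptions on `F(x, ξ¹, …, ξⁿ)`: for fixed `x` it is `C²` in each `ξ^i` separately
and twice (Fréchet) differentiable in `ξ`, so that the mixed derivatives `F_{ij}` exist. -/
structure NonlinAssumptions {m n : ℕ} (F : EuclideanSpace ℝ (Fin m) → (Fin n → ℝ) → ℝ) : Prop where
  contDiff_sep : ∀ x i ξ, ContDiff ℝ 2 fun t : ℝ => F x (Function.update ξ i t)
  differentiable : ∀ x, Differentiable ℝ (F x)
  differentiable_fderiv : ∀ x, Differentiable ℝ (fderiv ℝ (F x))

/-- `F_i = ∂F/∂ξ^i`. -/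
def F1 {m n : ℕ} (F : EuclideanSpace ℝ (Fin m) → (Fin n → ℝ) → ℝ) (i : Fin n)
    (x : EuclideanSpace ℝ (Fin m)) (ξ : Fin n → ℝ) : ℝ :=
  lineDeriv ℝ (F x) ξ (Pi.single i 1)

/-- `F_{ij} = ∂²F/∂ξ^i∂ξ^j`. -/
def F2 {m n : ℕ} (F : EuclideanSpace ℝ (Fin m) → (Fin n → ℝ) → ℝ) (i j : Fin n)
    (x : EuclideanSpace ℝ (Fin m)) (ξ : Fin n → ℝ) : ℝ :=
  lineDeriv ℝ (F1 F i x) ξ (Pi.single j 1)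

/-- The matrix `𝒜(x, η) = a(x,|η|) I + ∂_t a(x,|η|) η ⊗ η / |η|`. At `η = 0`, where this expression
has no meaning of its own, the value is `a(x,0) I`, and nothing is assumed about the number
`a(x,0)`: it is the limit value when `a` extends to `t = 0`, and may be put equal to `0`
otherwise. -/
def coeffMatrix {m k : ℕ} (a : EuclideanSpace ℝ (Fin m) → ℝ → ℝ)
    (x : EuclideanSpace ℝ (Fin m)) (η : Space m k) : Matrix (Fin m ⊕ Fin k) (Fin m ⊕ Fin k) ℝ :=
  Matrix.of fun p q =>
    a x ‖η‖ * (if p = q then 1 else 0) + deriv (a x) ‖η‖ * (η p * η q / ‖η‖)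

/-- The matrix field `X ↦ 𝒜(x, ∇u(X))`. -/
def coeffAt {m k : ℕ} (a : EuclideanSpace ℝ (Fin m) → ℝ → ℝ) (u : Space m k → ℝ)
    (X : Space m k) : Matrix (Fin m ⊕ Fin k) (Fin m ⊕ Fin k) ℝ :=
  coeffMatrix a (xPart X) (gradient u X)

/-- `⟨A v, v⟩`. -/
def quadForm {m k : ℕ} (A : Matrix (Fin m ⊕ Fin k) (Fin m ⊕ Fin k) ℝ) (v : Space m k) : ℝ :=
  ∑ p, ∑ q, A p q * v q * v p

/-- The largest (real) eigenvalue; only used for symmetric matrices. -/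
def maxEigenvalue {m k : ℕ} (A : Matrix (Fin m ⊕ Fin k) (Fin m ⊕ Fin k) ℝ) : ℝ :=
  sSup {μ : ℝ | Module.End.HasEigenvalue (Matrix.toLin' A) μ}

/-- `u ∈ C¹ ∩ C²({∇u ≠ 0}) ∩ L^∞` and `∇u ∈ L^∞ ∩ W^{1,2}_loc`. -/
structure SolutionRegularity {m k : ℕ} (u : Space m k → ℝ) : Prop where
  contDiff : ContDiff ℝ 1 u
  contDiffOn : ContDiffOn ℝ 2 u {X | gradient u X ≠ 0}
  bounded : ∃ M : ℝ, ∀ X, |u X| ≤ M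
  bounded_gradient : ∃ M : ℝ, ∀ X, ‖gradient u X‖ ≤ M
  memW12Loc_gradient : ∀ p, MemW12Loc fun X => gradient u X p

/-- Weak solutions in `ℝ^N` of `-div (a_i(x,|∇u^i|) ∇u^i) = F_i(x,u)`, `i = 1, …, n`; the integrals
are required to converge. -/
def IsWeakSolution {m k n : ℕ} (a : Fin n → EuclideanSpace ℝ (Fin m) → ℝ → ℝ)
    (F : EuclideanSpace ℝ (Fin m) → (Fin n → ℝ) → ℝ) (u : Fin n → Space m k → ℝ) : Prop :=
  ∀ ψ : Fin n → Space m k → ℝ, (∀ i, IsTest (ψ i)) → ∀ i,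
    Integrable (fun X =>
      inner ℝ (a i (xPart X) ‖gradient (u i) X‖ • gradient (u i) X) (gradient (ψ i) X)) ∧
    Integrable (fun X => F1 F i (xPart X) (fun l => u l X) * ψ i X) ∧
    (∫ X, inner ℝ (a i (xPart X) ‖gradient (u i) X‖ • gradient (u i) X) (gradient (ψ i) X)) =
      (∫ X, F1 F i (xPart X) (fun l => u l X) * ψ i X)

/-- Stability in `ℝ^N` (nonnegative second variation); the integrals are required to converge. -/
def IsStable {m k n : ℕ} (a : Fin n → EuclideanSpace ℝ (Fin m) → ℝ → ℝ)
    (F : EuclideanSpace ℝ (Fin m) → (Fin n → ℝ) → ℝ) (u : Fin n → Space m k → ℝ) : Prop :=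
  ∀ ψ : Fin n → Space m k → ℝ, (∀ i, IsTest (ψ i)) →
    (∀ i, Integrable fun X => quadForm (coeffAt (a i) (u i) X) (gradient (ψ i) X)) ∧
    (∀ i j, Integrable fun X => F2 F i j (xPart X) (fun l => u l X) * ψ i X * ψ j X) ∧
    0 ≤ (∑ i, ∫ X, quadForm (coeffAt (a i) (u i) X) (gradient (ψ i) X)) -
      (∑ i, ∑ j, ∫ X, F2 F i j (xPart X) (fun l => u l X) * ψ i X * ψ j X)

/-- `X ↦ 𝒜(x, ∇u(X))` belongs to `L^∞({∇u ≠ 0} ∩ B_R)` for every `R > 0`. -/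
def CoeffLocBounded {m k : ℕ} (a : EuclideanSpace ℝ (Fin m) → ℝ → ℝ) (u : Space m k → ℝ) : Prop :=
  ∀ R : ℝ, 0 < R → ∀ p q,
    MemLp (fun X => coeffAt a u X p q) ⊤ (volume.restrict ({X | gradient u X ≠ 0} ∩ ball 0 R))

end Fibered

end

noncomputable section

namespace Fibered

open MeasureTheory Metric Set Filter Topology
open scoped ContDiff Convolution

/-! Write `w_i = |∇_y u^i|`. Only the signs `σ_i` of the `θ^i` matter (`exists_signs`). Stability is
tested with `σ_i w_i φ`, and the equation linearized in `y_j` with `φ² ∂_{y_j}u^i`. After summing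
over `i` and `j` and subtracting, the `F_{ii}` terms cancel, while for `i ≠ l` there remains `F_{il}
(σ_i σ_l w_i w_l - ⟨∇_y u^i, ∇_y u^l⟩) φ²`, which is nonnegative by the sign condition and
Cauchy-Schwarz. The result is `geometric_poincare`: the sum of `∫ φ² deficit` is at most the sum of
`∫ w_i² ⟨𝒜^i ∇φ, ∇φ⟩`.

The deficit is a sum of squares for the form `𝒜^i` (`sum_bil_sub_eq`), hence nonnegative almost
everywhere. The right-hand side is controlled by the energy `𝒜̄ |∇u|²`, which grows at most like
`R²`; this is the critical growth for which logarithmic cutoffs (`exists_log_cutoff`) drive it to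
zero. Hence the deficit vanishes (`ae_deficit_eq_zero`), and positive definiteness together with
continuity yields `∇∂_{y_j}u = (∂_{y_j}u / w) ∇w` at every point of `{∇_y u ≠ 0}`
(`gradient_pd_eq_of_deficit`).

The rest is geometry. The identity says that the full gradient of `∇_y u / w` vanishes, so this
direction is constant on components, also when `x` varies (`direction_const`). By symmetry of the
Hessian, `∇_y u` is constant along the hyperplane of the fibre orthogonal to it
(`gradY_const_along`). Two such hyperplanes in one fibre meet unless their normals are parallel, so
all nonzero values of `∇_y u` on a fibre are parallel (`gradY_parallel`), and `u` depends on a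
single linear function of `y` there (`exists_profile`).

The analytic difficulty is that `w φ` need not be smooth where `∇_y u = 0`, and `𝒜` is controlled
only where `∇u ≠ 0`. Test functions are therefore enlarged in two steps: to `C¹` functions supported
in `{∇u ≠ 0}` by mollification, then by truncation near `{∇_y u = 0}` to functions of size `O(w)`
(`IsStable.nonneg_of_ySet`, `linearized_of_ySet`). -/

variable {m k n : ℕ}

/-! ### Gradients, partial derivatives and supports. -/

/-- The partial derivative `∂_p u`, as a component of the gradient. -/
abbrev pd (u : Space m k → ℝ) (p : Fin m ⊕ Fin k) : Space m k → ℝ := fun X => gradient u X p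

/-- The set `{∇u ≠ 0}`. -/
abbrev regSet (u : Space m k → ℝ) : Set (Space m k) := {X | gradient u X ≠ 0}

theorem inner_gradient (f : Space m k → ℝ) (X v : Space m k) :
    inner ℝ (gradient f X) v = fderiv ℝ f X v := by
  simp [gradient]

theorem gradient_apply (f : Space m k → ℝ) (X : Space m k) (p : Fin m ⊕ Fin k) :
    gradient f X p = fderiv ℝ f X (EuclideanSpace.single p 1) := by
  rw [← inner_gradient, EuclideanSpace.inner_single_right]
  simp

theorem fderiv_eq_sum (f : Space m k → ℝ) (X v : Space m k) :
    fderiv ℝ f X v = ∑ p, gradient f X p * v p := by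
  rw [← inner_gradient, PiLp.inner_apply]
  simp [mul_comm]

theorem continuousOn_gradient {f : Space m k → ℝ} {s : Set (Space m k)} (hs : IsOpen s)
    (hf : ContDiffOn ℝ 1 f s) : ContinuousOn (gradient f) s :=
  (InnerProductSpace.toDual ℝ _).symm.continuous.comp_continuousOn
    (hf.continuousOn_fderiv_of_isOpen hs le_rfl)

theorem continuous_gradient {f : Space m k → ℝ} (hf : ContDiff ℝ 1 f) :
    Continuous (gradient f) :=
  (InnerProductSpace.toDual ℝ _).symm.continuous.comp (hf.continuous_fderiv one_ne_zero)

theorem isOpen_regSet {u : Space m k → ℝ} (hu : ContDiff ℝ 1 u) : IsOpen (regSet u) :=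
  isOpen_ne_fun (continuous_gradient hu) continuous_const

theorem continuous_pd {u : Space m k → ℝ} (hu : ContDiff ℝ 1 u) (p : Fin m ⊕ Fin k) :
    Continuous (pd u p) :=
  (EuclideanSpace.proj p).continuous.comp (continuous_gradient hu)

theorem contDiffOn_pd {u : Space m k → ℝ} {s : Set (Space m k)} (hs : IsOpen s)
    (hu : ContDiffOn ℝ 2 u s) (p : Fin m ⊕ Fin k) : ContDiffOn ℝ 1 (pd u p) s := by
  have h : ContDiffOn ℝ 1 (fderiv ℝ u) s := hu.fderiv_of_isOpen hs (by norm_num)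
  have : pd u p = fun X => fderiv ℝ u X (EuclideanSpace.single p 1) := by
    ext X; exact gradient_apply u X p
  rw [this]
  exact h.clm_apply contDiffOn_const

theorem contDiff_pd {u : Space m k → ℝ} {r : ℕ∞} (hu : ContDiff ℝ ∞ u) (p : Fin m ⊕ Fin k) :
    ContDiff ℝ r (pd u p) := by
  have h : ContDiff ℝ r (fderiv ℝ u) := hu.fderiv_right (by exact_mod_cast le_top)
  have : pd u p = fun X => fderiv ℝ u X (EuclideanSpace.single p 1) := by
    ext X; exact gradient_apply u X p
  rw [this]
  exact h.clm_apply contDiff_const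

theorem gradient_pd_apply {u : Space m k → ℝ} {X : Space m k}
    (hu : DifferentiableAt ℝ (fderiv ℝ u) X) (p q : Fin m ⊕ Fin k) :
    gradient (pd u p) X q = fderiv ℝ (fderiv ℝ u) X (EuclideanSpace.single q 1)
      (EuclideanSpace.single p 1) := by
  have : pd u p = fun X => fderiv ℝ u X (EuclideanSpace.single p 1) := by
    ext X; exact gradient_apply u X p
  rw [gradient_apply, this, fderiv_clm_apply hu (by fun_prop)]
  simp

/-- The Hessian is symmetric at points where `u` is `C²`. -/
theorem gradient_pd_symm {u : Space m k → ℝ} {X : Space m k}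
    (hu : ContDiffAt ℝ 2 u X) (p q : Fin m ⊕ Fin k) :
    gradient (pd u p) X q = gradient (pd u q) X p := by
  have h : DifferentiableAt ℝ (fderiv ℝ u) X :=
    (hu.fderiv_right (m := 1) (by norm_num)).differentiableAt one_ne_zero
  rw [gradient_pd_apply h, gradient_pd_apply h]
  exact hu.isSymmSndFDerivAt (by simp) _ _

theorem SolutionRegularity.contDiffAt {u : Space m k → ℝ} (hu : SolutionRegularity u)
    {X : Space m k} (hX : X ∈ regSet u) : ContDiffAt ℝ 2 u X :=
  hu.contDiffOn.contDiffAt ((isOpen_regSet hu.contDiff).mem_nhds hX)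

theorem SolutionRegularity.contDiffOn_pd {u : Space m k → ℝ} (hu : SolutionRegularity u)
    (p : Fin m ⊕ Fin k) : ContDiffOn ℝ 1 (pd u p) (regSet u) :=
  Fibered.contDiffOn_pd (isOpen_regSet hu.contDiff) hu.contDiffOn p

theorem IsTest.contDiff_one {φ : Space m k → ℝ} (h : IsTest φ) : ContDiff ℝ 1 φ :=
  h.1.of_le (by exact_mod_cast le_top)

theorem gradient_eq_zero_of_notMem_tsupport {f : Space m k → ℝ} {X : Space m k}
    (h : X ∉ tsupport f) : gradient f X = 0 := by
  have : f =ᶠ[𝓝 X] fun _ => 0 := notMem_tsupport_iff_eventuallyEq.1 h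
  rw [this.gradient_eq, gradient_fun_const]

theorem tsupport_gradient_subset (f : Space m k → ℝ) : tsupport (gradient f) ⊆ tsupport f :=
  closure_minimal (fun _ hX => by_contra fun h => hX (gradient_eq_zero_of_notMem_tsupport h))
    (isClosed_tsupport f)

theorem tsupport_pd_subset (f : Space m k → ℝ) (p : Fin m ⊕ Fin k) :
    tsupport (pd f p) ⊆ tsupport f :=
  closure_minimal (fun X hX => by_contra fun h => hX (by
    simp [pd, gradient_eq_zero_of_notMem_tsupport h])) (isClosed_tsupport f)

theorem IsTest.pd {φ : Space m k → ℝ} (h : IsTest φ) (p : Fin m ⊕ Fin k) : IsTest (pd φ p) :=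
  ⟨contDiff_pd h.1 p, h.2.mono' (subset_closure.trans (tsupport_pd_subset φ p))⟩

/-! ### Square integrability of the Hessian on `{∇u ≠ 0}`. -/

theorem aestronglyMeasurable_indicator_of_continuousOn {G : Type*} [NormedAddCommGroup G]
    {s : Set (Space m k)} [SecondCountableTopology G]
    (hs : IsOpen s) {f : Space m k → G} (hf : ContinuousOn f s) {μ : Measure (Space m k)} :
    AEStronglyMeasurable (s.indicator f) μ := by
  rw [aestronglyMeasurable_indicator_iff hs.measurableSet]
  exact hf.aestronglyMeasurable hs.measurableSet

theorem MemL2Loc.locallyIntegrable {f : Space m k → ℝ} (hf : MemL2Loc f) :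
    LocallyIntegrable f := by
  intro X
  refine ⟨ball 0 (‖X‖ + 1), isOpen_ball.mem_nhds (by simp), ?_⟩
  have : IsFiniteMeasure (volume.restrict (ball (0 : Space m k) (‖X‖ + 1))) :=
    ⟨by simpa using measure_ball_lt_top⟩
  exact (hf _).integrable (by norm_num)

/-- On `{∇u ≠ 0}` the weak second derivatives are the classical ones, which are therefore
locally square integrable. -/
theorem SolutionRegularity.memLp_hessian {u : Space m k → ℝ} (hu : SolutionRegularity u)
    (p q : Fin m ⊕ Fin k) (R : ℝ) :
    MemLp ((regSet u).indicator fun X => gradient (pd u p) X q) 2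
      (volume.restrict (ball 0 R)) := by
  obtain ⟨-, h⟩ := hu.memW12Loc_gradient p
  obtain ⟨g, hg, hφ⟩ := h q
  have hU := isOpen_regSet hu.contDiff
  have hc : ContinuousOn (fun X => gradient (pd u p) X q) (regSet u) :=
    (EuclideanSpace.proj q).continuous.comp_continuousOn
      (continuousOn_gradient hU (hu.contDiffOn_pd p))
  have hli : LocallyIntegrableOn (fun X => gradient (pd u p) X q) (regSet u) :=
    hc.locallyIntegrableOn hU.measurableSet
  -- Against test functions supported in `{∇u ≠ 0}`, the classical and the weak derivative both
  -- integrate to `-∫ ∂_p u ∂_q φ`; the fundamental lemma of the calculus of variations on this open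
  -- set identifies them.
  have key : ∀ᵐ X : Space m k, X ∈ regSet u → gradient (pd u p) X q - g X = 0 := by
    refine hU.ae_eq_zero_of_integral_contDiff_smul_eq_zero
      (f := fun X => gradient (pd u p) X q - g X) (hli.sub
        (hg.locallyIntegrable.locallyIntegrableOn _)) ?_
    intro φ hφ1 hφ2 hφ3
    have htest : IsTest φ := ⟨hφ1, hφ2⟩
    have hcφ : Continuous φ := hφ1.continuous
    have i1 : Integrable (fun X => gradient (pd u p) X q * φ X) := by
      have h1 : IntegrableOn (fun X => gradient (pd u p) X q * φ X) (tsupport φ) :=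
        ((hc.mono hφ3).mul hcφ.continuousOn).integrableOn_compact hφ2
      refine (integrableOn_iff_integrable_of_support_subset ?_).1 h1
      exact (Function.support_mul_subset_right _ _).trans subset_closure
    have i2 : Integrable (fun X => pd u p X * pd φ q X) :=
      ((continuous_pd hu.contDiff p).mul (continuous_pd htest.contDiff_one q)).integrable_of_hasCompactSupport
        ((htest.pd q).2.mul_left)
    have i3 : Integrable (fun X => pd u p X * φ X) :=
      ((continuous_pd hu.contDiff p).mul hcφ).integrable_of_hasCompactSupport hφ2.mul_left
    have i4 : Integrable (fun X => g X * φ X) := by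
      simpa [mul_comm] using hg.locallyIntegrable.integrable_smul_left_of_hasCompactSupport hcφ hφ2
    have ibp : ∫ X, pd u p X * pd φ q X = -∫ X, gradient (pd u p) X q * φ X :=
      integral_bilinear_hasLineDerivAt_right_eq_neg_left_of_integrable
        (B := ContinuousLinearMap.mul ℝ ℝ) (v := EuclideanSpace.single q 1) i1 i2 i3
        (fun X hX => by
          rw [gradient_apply]
          have := ((hu.contDiffOn_pd p).contDiffAt (hU.mem_nhds (hφ3 hX))).differentiableAt
            one_ne_zero
          exact this.hasFDerivAt.hasLineDerivAt _)
        (fun X _ => by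
          simp only [Fibered.pd, gradient_apply]
          exact (hφ1.differentiable (by simp) X).hasFDerivAt.hasLineDerivAt _)
    have e1 := hφ φ htest
    have e2 : ∫ X, gradient (pd u p) X q * φ X = ∫ X, g X * φ X := by
      simp only [pd] at ibp; linarith
    calc ∫ X, φ X • (gradient (pd u p) X q - g X)
        = ∫ X, (gradient (pd u p) X q * φ X - g X * φ X) := by
          congr 1; ext X; simp only [smul_eq_mul]; ring
      _ = 0 := by rw [integral_sub i1 i4, e2, sub_self]
  refine MemLp.mono (hg R) (aestronglyMeasurable_indicator_of_continuousOn hU hc)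
    (ae_restrict_of_ae ?_)
  filter_upwards [key] with X hX
  by_cases hXU : X ∈ regSet u
  · rw [indicator_of_mem hXU, sub_eq_zero.1 (hX hXU)]
  · rw [indicator_of_notMem hXU]; simp

/-- The Hessian rows `∇∂_p u`, restricted to `{∇u ≠ 0} ∩ B_R`, are square integrable. -/
theorem SolutionRegularity.memLp_gradient_pd {u : Space m k → ℝ} (hu : SolutionRegularity u)
    (p : Fin m ⊕ Fin k) (R : ℝ) :
    MemLp ((regSet u ∩ ball 0 R).indicator (gradient (pd u p))) 2 := by
  have hU := isOpen_regSet hu.contDiff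
  have hm : AEStronglyMeasurable ((regSet u ∩ ball 0 R).indicator (gradient (pd u p))) :=
    aestronglyMeasurable_indicator_of_continuousOn (hU.inter isOpen_ball)
      ((continuousOn_gradient hU (hu.contDiffOn_pd p)).mono inter_subset_left)
  have hs : MemLp (fun X => ∑ q, ‖(ball (0 : Space m k) R).indicator
      ((regSet u).indicator fun X => gradient (pd u p) X q) X‖) 2 :=
    memLp_finsetSum _ fun q _ =>
      ((memLp_indicator_iff_restrict measurableSet_ball).2 (hu.memLp_hessian p q R)).norm
  refine hs.mono hm (Eventually.of_forall fun X => ?_)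
  by_cases hX : X ∈ regSet u ∩ ball 0 R
  · rw [indicator_of_mem hX]
    simp only [indicator_of_mem hX.1, indicator_of_mem hX.2]
    rw [Real.norm_of_nonneg (Finset.sum_nonneg fun _ _ => norm_nonneg _)]
    calc ‖gradient (pd u p) X‖ = ‖∑ q, gradient (pd u p) X q • (EuclideanSpace.basisFun _ ℝ q)‖ := by
          conv_lhs => rw [← (EuclideanSpace.basisFun _ ℝ).sum_repr (gradient (pd u p) X)]
          simp
      _ ≤ ∑ q, ‖gradient (pd u p) X q‖ := by
          refine (norm_sum_le _ _).trans (Finset.sum_le_sum fun q _ => ?_)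
          rw [norm_smul]; simp
  · rw [indicator_of_notMem hX]; simp

/-! ### The forms `⟨𝒜 v, w⟩`: algebra, integrability, passage to the limit. -/

section Bilinear

/-- The bilinear form `⟨A v, w⟩`. -/
def bil (A : Matrix (Fin m ⊕ Fin k) (Fin m ⊕ Fin k) ℝ) (v w : Space m k) : ℝ :=
  ∑ p, ∑ q, A p q * v q * w p

theorem quadForm_eq_bil (A : Matrix (Fin m ⊕ Fin k) (Fin m ⊕ Fin k) ℝ) (v : Space m k) :
    quadForm A v = bil A v v := rfl

section Algebra

variable (A : Matrix (Fin m ⊕ Fin k) (Fin m ⊕ Fin k) ℝ) (v v' w w' : Space m k) (c : ℝ)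

theorem bil_add_left : bil A (v + v') w = bil A v w + bil A v' w := by
  simp only [bil, ← Finset.sum_add_distrib, PiLp.add_apply]
  exact Finset.sum_congr rfl fun p _ => Finset.sum_congr rfl fun q _ => by ring

theorem bil_add_right : bil A v (w + w') = bil A v w + bil A v w' := by
  simp only [bil, ← Finset.sum_add_distrib, PiLp.add_apply]
  exact Finset.sum_congr rfl fun p _ => Finset.sum_congr rfl fun q _ => by ring

theorem bil_smul_left : bil A (c • v) w = c * bil A v w := by
  simp only [bil, Finset.mul_sum, PiLp.smul_apply, smul_eq_mul]
  exact Finset.sum_congr rfl fun p _ => Finset.sum_congr rfl fun q _ => by ring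

theorem bil_smul_right : bil A v (c • w) = c * bil A v w := by
  simp only [bil, Finset.mul_sum, PiLp.smul_apply, smul_eq_mul]
  exact Finset.sum_congr rfl fun p _ => Finset.sum_congr rfl fun q _ => by ring

theorem bil_zero_left : bil A 0 w = 0 := by simp [bil]

theorem bil_zero_right : bil A v 0 = 0 := by simp [bil]

theorem bil_sum_left {ι : Type*} (s : Finset ι) (f : ι → Space m k) :
    bil A (∑ j ∈ s, f j) w = ∑ j ∈ s, bil A (f j) w := by
  classical
  induction s using Finset.induction_on with
  | empty => simp [bil_zero_left]
  | insert a s ha ih => rw [Finset.sum_insert ha, Finset.sum_insert ha, bil_add_left, ih]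

theorem bil_comm (hA : ∀ p q, A p q = A q p) : bil A v w = bil A w v := by
  rw [bil, Finset.sum_comm, bil]
  exact Finset.sum_congr rfl fun p _ => Finset.sum_congr rfl fun q _ => by rw [hA q p]; ring

theorem coeffAt_symm (a : EuclideanSpace ℝ (Fin m) → ℝ → ℝ) (u : Space m k → ℝ) (X : Space m k)
    (p q : Fin m ⊕ Fin k) : coeffAt a u X p q = coeffAt a u X q p := by
  simp only [coeffAt, coeffMatrix, Matrix.of_apply, eq_comm (a := p), mul_comm (gradient u X p)]

theorem abs_bil_le : |bil A v w| ≤ (∑ p, ∑ q, |A p q|) * (‖v‖ * ‖w‖) := by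
  rw [bil, Finset.sum_mul]
  refine (Finset.abs_sum_le_sum_abs _ _).trans (Finset.sum_le_sum fun p _ => ?_)
  rw [Finset.sum_mul]
  refine (Finset.abs_sum_le_sum_abs _ _).trans (Finset.sum_le_sum fun q _ => ?_)
  rw [abs_mul, abs_mul, mul_assoc]
  have h1 : |v q| ≤ ‖v‖ := PiLp.norm_apply_le v q
  have h2 : |w p| ≤ ‖w‖ := PiLp.norm_apply_le w p
  gcongr

theorem continuous_bil : Continuous fun z : Space m k × Space m k => bil A z.1 z.2 := by
  unfold bil; fun_prop

end Algebra

variable {a : EuclideanSpace ℝ (Fin m) → ℝ → ℝ} {u : Space m k → ℝ}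

theorem CoeffLocBounded.exists_bound (h : CoeffLocBounded a u) (hU : IsOpen (regSet u)) (R : ℝ) :
    ∃ M : ℝ, 0 ≤ M ∧ ∀ᵐ X : Space m k, X ∈ regSet u ∩ ball 0 R →
      (∑ p, ∑ q, |coeffAt a u X p q|) ≤ M := by
  rcases le_or_gt R 0 with hR | hR
  · exact ⟨0, le_rfl, Eventually.of_forall fun X hX => by simp [ball_eq_empty.2 hR] at hX⟩
  have hb : ∀ p q, ∃ M : ℝ, ∀ᵐ X : Space m k, X ∈ regSet u ∩ ball 0 R →
      |coeffAt a u X p q| ≤ M := by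
    intro p q
    have h2 := (h R hR p q).2
    rw [eLpNorm_exponent_top] at h2
    refine ⟨(eLpNormEssSup (fun X => coeffAt a u X p q)
      (volume.restrict (regSet u ∩ ball 0 R))).toReal, ?_⟩
    rw [← ae_restrict_iff' (hU.inter isOpen_ball).measurableSet]
    filter_upwards [ae_le_eLpNormEssSup (f := fun X => coeffAt a u X p q)
      (μ := volume.restrict (regSet u ∩ ball 0 R))] with X hX
    have := ENNReal.toReal_mono h2.ne hX
    simpa using this
  choose M hM using hb
  refine ⟨∑ p, ∑ q, |M p q|, Finset.sum_nonneg fun _ _ => Finset.sum_nonneg fun _ _ =>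
    abs_nonneg _, ?_⟩
  filter_upwards [ae_all_iff.2 fun p => ae_all_iff.2 fun q => hM p q] with X hX hXU
  exact Finset.sum_le_sum fun p _ => Finset.sum_le_sum fun q _ =>
    (hX p q hXU).trans (le_abs_self _)

theorem CoeffLocBounded.aestronglyMeasurable (h : CoeffLocBounded a u) (R : ℝ)
    (p q : Fin m ⊕ Fin k) : AEStronglyMeasurable (fun X => coeffAt a u X p q)
      (volume.restrict (regSet u ∩ ball 0 R)) := by
  rcases le_or_gt R 0 with hR | hR
  · simp [ball_eq_empty.2 hR]
  · exact (h R hR p q).1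

/-- Measurability of `𝒜` is known only on `{∇u ≠ 0} ∩ B_R`; the vanishing of `v` elsewhere makes the
values of `𝒜` there irrelevant. -/
theorem CoeffLocBounded.aestronglyMeasurable_bil (h : CoeffLocBounded a u)
    (hU : IsOpen (regSet u)) {R : ℝ} {v w : Space m k → Space m k}
    (hv : AEStronglyMeasurable v) (hw : AEStronglyMeasurable w)
    (h0 : ∀ X ∉ regSet u ∩ ball 0 R, v X = 0) :
    AEStronglyMeasurable fun X => bil (coeffAt a u X) (v X) (w X) := by
  have hme : MeasurableSet (regSet u ∩ ball 0 R) := (hU.inter isOpen_ball).measurableSet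
  have e : (fun X => bil (coeffAt a u X) (v X) (w X)) = (regSet u ∩ ball 0 R).indicator
      fun X => bil (coeffAt a u X) (v X) (w X) := by
    ext X
    by_cases hX : X ∈ regSet u ∩ ball 0 R
    · rw [indicator_of_mem hX]
    · rw [indicator_of_notMem hX, h0 X hX, bil_zero_left]
  rw [e, aestronglyMeasurable_indicator_iff hme]
  unfold bil
  refine Finset.aestronglyMeasurable_fun_sum _ fun p _ =>
    Finset.aestronglyMeasurable_fun_sum _ fun q _ => ((h.aestronglyMeasurable R p q).mul ?_).mul ?_
  · exact ((EuclideanSpace.proj (𝕜 := ℝ) q).continuous.comp_aestronglyMeasurable hv).restrict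
  · exact ((EuclideanSpace.proj (𝕜 := ℝ) p).continuous.comp_aestronglyMeasurable hw).restrict

/-- A product of two `L²` functions times the essential bound of `𝒜`; only `v` has to vanish where
that bound is unavailable. -/
theorem CoeffLocBounded.integrable_bil (h : CoeffLocBounded a u)
    (hU : IsOpen (regSet u)) {R : ℝ} {v w : Space m k → Space m k}
    (hv : MemLp v 2) (hw : MemLp w 2) (h0 : ∀ X ∉ regSet u ∩ ball 0 R, v X = 0) :
    Integrable fun X => bil (coeffAt a u X) (v X) (w X) := by
  obtain ⟨M, hM0, hM⟩ := h.exists_bound hU R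
  have hi : Integrable fun X => M * (‖v X‖ * ‖w X‖) :=
    (hv.norm.integrable_mul hw.norm).const_mul M
  refine hi.mono' (h.aestronglyMeasurable_bil hU hv.1 hw.1 h0) ?_
  filter_upwards [hM] with X hX
  by_cases hXU : X ∈ regSet u ∩ ball 0 R
  · exact (abs_bil_le _ _ _).trans (mul_le_mul_of_nonneg_right (hX hXU) (by positivity))
  · rw [h0 X hXU, bil_zero_left]; simp

/-- Dominated convergence for `∫ ⟨𝒜 v_j, w_j⟩`. -/
theorem CoeffLocBounded.tendsto_integral_bil (h : CoeffLocBounded a u)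
    (hU : IsOpen (regSet u)) {R : ℝ} {v w : ℕ → Space m k → Space m k}
    {v' w' : Space m k → Space m k} {G H : Space m k → ℝ}
    (hv : ∀ j, AEStronglyMeasurable (v j)) (hw : ∀ j, AEStronglyMeasurable (w j))
    (h0 : ∀ j, ∀ X ∉ regSet u ∩ ball 0 R, v j X = 0)
    (hG : MemLp G 2) (hH : MemLp H 2) (hvG : ∀ j X, ‖v j X‖ ≤ G X) (hwH : ∀ j X, ‖w j X‖ ≤ H X)
    (hv' : ∀ X, Tendsto (fun j => v j X) atTop (𝓝 (v' X)))
    (hw' : ∀ X, Tendsto (fun j => w j X) atTop (𝓝 (w' X))) :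
    Tendsto (fun j => ∫ X, bil (coeffAt a u X) (v j X) (w j X)) atTop
      (𝓝 (∫ X, bil (coeffAt a u X) (v' X) (w' X))) := by
  obtain ⟨M, hM0, hM⟩ := h.exists_bound hU R
  refine tendsto_integral_of_dominated_convergence (fun X => M * (G X * H X))
    (fun j => h.aestronglyMeasurable_bil hU (hv j) (hw j) (h0 j))
    ((hG.integrable_mul hH).const_mul M) (fun j => ?_) (Eventually.of_forall fun X => ?_)
  · filter_upwards [hM] with X hX
    have hGX := (norm_nonneg _).trans (hvG j X)
    have hHX := (norm_nonneg _).trans (hwH j X)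
    by_cases hXU : X ∈ regSet u ∩ ball 0 R
    · refine (abs_bil_le _ _ _).trans (mul_le_mul (hX hXU) ?_ (by positivity) hM0)
      exact mul_le_mul (hvG j X) (hwH j X) (norm_nonneg _) hGX
    · rw [h0 j X hXU, bil_zero_left, norm_zero]; positivity
  · have h1 := (continuous_bil (coeffAt a u X)).tendsto (v' X, w' X)
    have h2 := (hv' X).prodMk_nhds (hw' X)
    have h3 := h1.comp h2
    exact h3

/-- A bounded function vanishing off a ball, integrated against a locally integrable one. -/
theorem integrable_mul_of_integrableOn_ball {f ψ : Space m k → ℝ} {R M : ℝ}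
    (hf : IntegrableOn f (ball 0 R)) (hψ : AEStronglyMeasurable ψ) (hM : ∀ X, |ψ X| ≤ M)
    (h0 : ∀ X ∉ ball (0 : Space m k) R, ψ X = 0) : Integrable fun X => f X * ψ X := by
  have h1 : IntegrableOn (fun X => f X * ψ X) (ball 0 R) :=
    hf.mul_bdd (c := M) hψ.restrict (Eventually.of_forall hM)
  refine (integrableOn_iff_integrable_of_support_subset fun X hX => ?_).1 h1
  by_contra hXb
  exact hX (by simp [h0 X hXb])

theorem tendsto_integral_mul_of_integrableOn_ball {f : Space m k → ℝ} {ψ : ℕ → Space m k → ℝ}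
    {ψ' : Space m k → ℝ} {R M : ℝ}
    (hf : IntegrableOn f (ball 0 R)) (hψ : ∀ j, AEStronglyMeasurable (ψ j))
    (hM : ∀ j X, |ψ j X| ≤ M) (h0 : ∀ j, ∀ X ∉ ball (0 : Space m k) R, ψ j X = 0)
    (hψ' : ∀ X, Tendsto (fun j => ψ j X) atTop (𝓝 (ψ' X))) :
    Tendsto (fun j => ∫ X, f X * ψ j X) atTop (𝓝 (∫ X, f X * ψ' X)) := by
  have hi : Integrable fun X => (ball (0 : Space m k) R).indicator f X * M :=
    ((integrable_indicator_iff measurableSet_ball).2 hf).mul_const M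
  refine tendsto_integral_of_dominated_convergence _
    (fun j => (integrable_mul_of_integrableOn_ball hf (hψ j) (hM j) (h0 j)).1) hi.norm
    (fun j => Eventually.of_forall fun X => ?_)
    (Eventually.of_forall fun X => (hψ' X).const_mul _)
  by_cases hX : X ∈ ball (0 : Space m k) R
  · rw [indicator_of_mem hX, norm_mul, norm_mul]
    exact mul_le_mul_of_nonneg_left ((hM j X).trans (le_abs_self M)) (norm_nonneg _)
  · rw [h0 j X hX, mul_zero, norm_zero]; exact norm_nonneg _

end Bilinear

/-! ### Smooth approximation of `C¹` test functions. -/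

/-- Mollification in `C¹` of a compactly supported `C¹` function, with control of the supports. -/
theorem exists_smooth_approx {ψ : Space m k → ℝ} (hψ : ContDiff ℝ 1 ψ)
    (hc : HasCompactSupport ψ) {U : Set (Space m k)} (hU : IsOpen U) (hs : tsupport ψ ⊆ U) :
    ∃ (K : Set (Space m k)) (M : ℝ) (Ψ : ℕ → Space m k → ℝ), IsCompact K ∧ K ⊆ U ∧
      (∀ j, IsTest (Ψ j)) ∧ (∀ j, tsupport (Ψ j) ⊆ K) ∧ (∀ j X, |Ψ j X| ≤ M) ∧
      (∀ j X, ‖gradient (Ψ j) X‖ ≤ M) ∧ (∀ X, Tendsto (fun j => Ψ j X) atTop (𝓝 (ψ X))) ∧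
      ∀ X, Tendsto (fun j => gradient (Ψ j) X) atTop (𝓝 (gradient ψ X)) := by
  -- All mollifiers have radius at most `δ`, so one compact set `K`, the closed `δ`-thickening,
  -- contains all the supports and still lies in `U`.
  obtain ⟨δ, hδ, hδU⟩ := IsCompact.exists_cthickening_subset_open hc hU hs
  let φ : ℕ → ContDiffBump (0 : Space m k) := fun j =>
    { rIn := δ / (2 * (j + 1)), rOut := δ / (j + 1), rIn_pos := by positivity
      rIn_lt_rOut := by
        apply div_lt_div_of_pos_left hδ (by positivity)
        have : (0 : ℝ) < j + 1 := by positivity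
        linarith }
  have hr : Tendsto (fun j => (φ j).rOut) atTop (𝓝 0) :=
    tendsto_const_div_atTop_nhds_zero_nat δ |>.comp (tendsto_add_atTop_nat 1) |>.congr
      fun j => by simp [φ]
  have hrδ : ∀ j, (φ j).rOut ≤ δ := fun j => by
    apply div_le_self hδ.le; simp
  let Ψ : ℕ → Space m k → ℝ := fun j =>
    (φ j).normed volume ⋆[ContinuousLinearMap.lsmul ℝ ℝ, volume] ψ
  let Ψ' : ℕ → Space m k → (Space m k →L[ℝ] ℝ) := fun j =>
    (φ j).normed volume ⋆[ContinuousLinearMap.lsmul ℝ ℝ, volume] (fderiv ℝ ψ)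
  have hli : ∀ j, LocallyIntegrable ((φ j).normed (volume : Measure (Space m k))) := fun j =>
    (φ j).continuous_normed.locallyIntegrable
  have hder : ∀ j X, HasFDerivAt (Ψ j) (Ψ' j X) X := fun j X => by
    have := hc.hasFDerivAt_convolution_right (ContinuousLinearMap.lsmul ℝ ℝ) (hli j) hψ X
    have e : Ψ' j X = ((φ j).normed volume ⋆[ContinuousLinearMap.precompR (Space m k)
        (ContinuousLinearMap.lsmul ℝ ℝ), volume] fderiv ℝ ψ) X := by
      refine integral_congr_ae (Eventually.of_forall fun t => ?_)
      ext v
      simp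
    rw [e]
    exact this
  have hgrad : ∀ j X, gradient (Ψ j) X = (InnerProductSpace.toDual ℝ _).symm (Ψ' j X) := fun j X => by
    rw [gradient, (hder j X).fderiv]
  have hc' : HasCompactSupport (fderiv ℝ ψ) := hc.fderiv ℝ
  have hcont' := hψ.continuous_fderiv one_ne_zero
  obtain ⟨M₁, hM₁⟩ := hψ.continuous.bounded_above_of_compact_support hc
  obtain ⟨M₂, hM₂⟩ := hcont'.bounded_above_of_compact_support hc'
  have hsupp : ∀ j, tsupport (Ψ j) ⊆ cthickening δ (tsupport ψ) := fun j => by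
    refine closure_minimal ?_ isClosed_cthickening
    refine (support_convolution_subset _).trans ?_
    rw [(φ j).support_normed_eq]
    rintro _ ⟨a, ha, b, hb, rfl⟩
    refine mem_cthickening_of_dist_le _ b _ _ (subset_closure hb) ?_
    have : dist a 0 < (φ j).rOut := ha
    simp only [dist_zero_right] at this
    simp only [dist_add_self_left]
    exact this.le.trans (hrδ j)
  have hK : IsCompact (cthickening δ (tsupport ψ)) := IsCompact.cthickening hc
  -- The factor `3` is `2 + 1`: a mollified function differs from the original by at most its
  -- oscillation `2 M`, and the original is bounded by `M`.
  refine ⟨cthickening δ (tsupport ψ), max (3 * M₁) (3 * M₂), Ψ, hK, hδU,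
    fun j => ⟨?_, ?_⟩, hsupp, fun j X => ?_, fun j X => ?_, fun X => ?_, fun X => ?_⟩
  · exact (φ j).hasCompactSupport_normed.contDiff_convolution_left _ (φ j).contDiff_normed
      hψ.continuous.locallyIntegrable
  · exact HasCompactSupport.intro hK fun X hX =>
      image_eq_zero_of_notMem_tsupport fun h => hX (hsupp j h)
  · have h1 : dist (Ψ j X) (ψ X) ≤ 2 * M₁ :=
      ContDiffBump.dist_normed_convolution_le hψ.continuous.aestronglyMeasurable fun Y _ => by
        rw [dist_eq_norm]
        linarith [norm_sub_le (ψ Y) (ψ X), hM₁ X, hM₁ Y]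
    rw [dist_eq_norm] at h1
    have h2 := norm_sub_norm_le (Ψ j X) (ψ X)
    have h3 := hM₁ X
    rw [← Real.norm_eq_abs]
    exact le_max_of_le_left (by linarith)
  · have h1 : dist (Ψ' j X) (fderiv ℝ ψ X) ≤ 2 * M₂ :=
      ContDiffBump.dist_normed_convolution_le hcont'.aestronglyMeasurable fun Y _ => by
        rw [dist_eq_norm]
        linarith [norm_sub_le (fderiv ℝ ψ Y) (fderiv ℝ ψ X), hM₂ X, hM₂ Y]
    rw [dist_eq_norm] at h1
    have h2 := norm_sub_norm_le (Ψ' j X) (fderiv ℝ ψ X)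
    have h3 := hM₂ X
    rw [hgrad, LinearIsometryEquiv.norm_map]
    exact le_max_of_le_right (by linarith)
  · exact ContDiffBump.convolution_tendsto_right_of_continuous hr hψ.continuous X
  · simp only [hgrad]
    exact ((InnerProductSpace.toDual ℝ (Space m k)).symm.continuous.tendsto _).comp
      (ContDiffBump.convolution_tendsto_right_of_continuous hr hcont' X)

theorem exists_test_eq_one (R : ℝ) : ∃ φ : Space m k → ℝ, IsTest φ ∧ ∀ X ∈ ball 0 R, φ X = 1 := by
  let b : ContDiffBump (0 : Space m k) :=
    { rIn := |R| + 1, rOut := |R| + 2, rIn_pos := by positivity, rIn_lt_rOut := by linarith }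
  refine ⟨b, ⟨b.contDiff, b.hasCompactSupport⟩, fun X hX => b.one_of_mem_closedBall ?_⟩
  have : dist X 0 < R := hX
  have h2 : R ≤ |R| := le_abs_self R
  exact mem_closedBall.2 (by change dist X 0 ≤ |R| + 1; linarith)

/-! ### Stability with `C¹` test functions. -/

section Stability

variable {a : Fin n → EuclideanSpace ℝ (Fin m) → ℝ → ℝ}
  {F : EuclideanSpace ℝ (Fin m) → (Fin n → ℝ) → ℝ} {u : Fin n → Space m k → ℝ}

/-- No measurability or boundedness of `F_{ij}(x, u)` is assumed; local integrability comes from the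
convergence of the integrals in the stability condition, with every `ψ^i` equal to a bump that is
`1` on the ball. -/
theorem IsStable.integrableOn_F2 (h : IsStable a F u) (i j : Fin n) (R : ℝ) :
    IntegrableOn (fun X => F2 F i j (xPart X) fun l => u l X) (ball 0 R) := by
  obtain ⟨φ, hφ, h1⟩ := exists_test_eq_one (m := m) (k := k) R
  have := ((h (fun _ => φ) fun _ => hφ).2.1 i j).integrableOn (s := ball 0 R)
  refine this.congr_fun (fun X hX => ?_) measurableSet_ball
  simp [h1 X hX]

theorem exists_ball_of_compact {ι : Type*} [Finite ι] {K : ι → Set (Space m k)}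
    (hK : ∀ i, IsCompact (K i)) : ∃ R : ℝ, ∀ i, K i ⊆ ball 0 R := by
  obtain ⟨R, hR⟩ := (isCompact_iUnion hK).isBounded.subset_ball 0
  exact ⟨R, fun i => (subset_iUnion K i).trans hR⟩

theorem memLp_indicator_ball (R M : ℝ) (p : ENNReal) :
    MemLp ((ball (0 : Space m k) R).indicator fun _ => M) p :=
  memLp_indicator_const p measurableSet_ball M (Or.inr measure_ball_lt_top.ne)

/-- Stability may be tested with `C¹` functions supported in `{∇uⁱ ≠ 0}`. -/
theorem IsStable.nonneg_of_contDiff (h : IsStable a F u) (hu : ∀ i, ContDiff ℝ 1 (u i))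
    (hbdd : ∀ i, CoeffLocBounded (a i) (u i)) {ψ : Fin n → Space m k → ℝ}
    (hψ : ∀ i, ContDiff ℝ 1 (ψ i)) (hc : ∀ i, HasCompactSupport (ψ i))
    (hs : ∀ i, tsupport (ψ i) ⊆ regSet (u i)) :
    0 ≤ (∑ i, ∫ X, bil (coeffAt (a i) (u i) X) (gradient (ψ i) X) (gradient (ψ i) X)) -
      ∑ i, ∑ j, ∫ X, F2 F i j (xPart X) (fun l => u l X) * (ψ i X * ψ j X) := by
  choose K M Ψ hK hKU hT hΨK hΨM hΨ'M hlim hlim' using fun i =>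
    exists_smooth_approx (hψ i) (hc i) (isOpen_regSet (hu i)) (hs i)
  obtain ⟨R, hR⟩ := exists_ball_of_compact hK
  have hz : ∀ i j, ∀ X ∉ K i, Ψ i j X = 0 := fun i j X hX =>
    image_eq_zero_of_notMem_tsupport fun h => hX (hΨK i j h)
  have hz' : ∀ i j, ∀ X ∉ K i, gradient (Ψ i j) X = 0 := fun i j X hX =>
    gradient_eq_zero_of_notMem_tsupport fun h => hX (hΨK i j h)
  have hme : ∀ i j, AEStronglyMeasurable (gradient (Ψ i j)) := fun i j =>
    (continuous_gradient (hT i j).contDiff_one).aestronglyMeasurable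
  have hG : ∀ i j X, ‖gradient (Ψ i j) X‖ ≤ (ball (0 : Space m k) R).indicator (fun _ => M i) X := by
    intro i j X
    by_cases hX : X ∈ ball (0 : Space m k) R
    · rw [indicator_of_mem hX]; exact hΨ'M i j X
    · rw [indicator_of_notMem hX, hz' i j X fun h => hX (hR i h), norm_zero]
  have t1 : ∀ i, Tendsto (fun j => ∫ X, bil (coeffAt (a i) (u i) X) (gradient (Ψ i j) X)
      (gradient (Ψ i j) X)) atTop (𝓝 (∫ X, bil (coeffAt (a i) (u i) X) (gradient (ψ i) X)
      (gradient (ψ i) X))) := fun i =>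
    (hbdd i).tendsto_integral_bil (isOpen_regSet (hu i)) (R := R) (hme i) (hme i)
      (fun j X hX => hz' i j X fun h => hX ⟨hKU i h, hR i h⟩)
      (memLp_indicator_ball R (M i) 2) (memLp_indicator_ball R (M i) 2) (hG i) (hG i)
      (hlim' i) (hlim' i)
  have t2 : ∀ i l, Tendsto (fun j => ∫ X, F2 F i l (xPart X) (fun l => u l X) *
      (Ψ i j X * Ψ l j X)) atTop (𝓝 (∫ X, F2 F i l (xPart X) (fun l => u l X) *
      (ψ i X * ψ l X))) := fun i l =>
    tendsto_integral_mul_of_integrableOn_ball (h.integrableOn_F2 i l R) (M := M i * M l)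
      (fun j => ((hT i j).1.continuous.mul (hT l j).1.continuous).aestronglyMeasurable)
      (fun j X => by
        rw [abs_mul]
        exact mul_le_mul (hΨM i j X) (hΨM l j X) (abs_nonneg _) ((abs_nonneg _).trans (hΨM i j X)))
      (fun j X hX => by rw [hz i j X fun h => hX (hR i h), zero_mul])
      (fun X => (hlim i X).mul (hlim l X))
  refine ge_of_tendsto' ((tendsto_finsetSum _ fun i _ => t1 i).sub
    (tendsto_finsetSum _ fun i _ => tendsto_finsetSum _ fun l _ => t2 i l)) fun j => ?_
  have := (h (fun i => Ψ i j) fun i => hT i j).2.2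
  simpa only [quadForm_eq_bil, mul_assoc] using this

end Stability

/-! ### Differentiating the flux and the nonlinearity in `y`. -/

section Derivatives

theorem hasLineDerivAt_gradient {u : Space m k → ℝ} {X : Space m k} (hu : ContDiffAt ℝ 2 u X)
    (p : Fin m ⊕ Fin k) :
    HasLineDerivAt ℝ (gradient u) (gradient (pd u p) X) X (EuclideanSpace.single p 1) := by
  have hd : DifferentiableAt ℝ (fderiv ℝ u) X :=
    (hu.fderiv_right (m := 1) (by norm_num)).differentiableAt one_ne_zero
  have h1 : HasDerivAt (fun (t : ℝ) q => pd u q (X + t • EuclideanSpace.single p (1 : ℝ)))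
      (fun q => gradient (pd u p) X q) 0 := by
    rw [hasDerivAt_pi]
    intro q
    have hq : DifferentiableAt ℝ (pd u q) X := by
      have : pd u q = fun X => fderiv ℝ u X (EuclideanSpace.single q 1) := by
        ext X; exact gradient_apply u X q
      rw [this]
      exact hd.clm_apply (differentiableAt_const _)
    rw [gradient_pd_symm hu, gradient_apply]
    exact hq.hasFDerivAt.hasLineDerivAt _
  have h2 := (PiLp.continuousLinearEquiv 2 ℝ
    fun _ : Fin m ⊕ Fin k => ℝ).symm.hasFDerivAt.comp_hasDerivAt (0 : ℝ) h1
  exact h2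

/-- This is why no regularity of `a_i` and `F` in `x` is needed: derivatives of the equation are
taken only along `y`, where `x` is frozen. -/
theorem xPart_add_smul_single (X : Space m k) (t : ℝ) (j : Fin k) :
    xPart (X + t • EuclideanSpace.single (Sum.inr j) (1 : ℝ)) = xPart X := by
  ext i
  simp [xPart]

/-- `∂_{y_j} (a(x,|∇u|)∇u) = 𝒜(x,∇u) ∇∂_{y_j} u` where `∇u ≠ 0`. -/
theorem hasLineDerivAt_flux {a : EuclideanSpace ℝ (Fin m) → ℝ → ℝ}
    (ha : ∀ x, ContDiffOn ℝ 1 (a x) (Ioi 0)) {u : Space m k → ℝ} {X : Space m k}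
    (hu : ContDiffAt ℝ 2 u X) (hX : gradient u X ≠ 0) (j : Fin k) :
    HasLineDerivAt ℝ (fun X => a (xPart X) ‖gradient u X‖ • gradient u X)
      (WithLp.toLp 2 ((coeffAt a u X).mulVec fun p => gradient (pd u (Sum.inr j)) X p)) X
      (EuclideanSpace.single (Sum.inr j) 1) := by
  have h1 : HasDerivAt (fun t : ℝ => gradient u (X + t • EuclideanSpace.single (Sum.inr j) (1 : ℝ)))
      (gradient (pd u (Sum.inr j)) X) 0 := hasLineDerivAt_gradient hu (Sum.inr j)
  set γ := fun t : ℝ => gradient u (X + t • EuclideanSpace.single (Sum.inr j) (1 : ℝ)) with hγ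
  set d := gradient (pd u (Sum.inr j)) X with hd
  have h0 : γ 0 = gradient u X := by simp [hγ]
  have hn : ‖γ 0‖ ≠ 0 := by rw [h0]; exact norm_ne_zero_iff.2 hX
  have h2 : HasDerivAt (fun t => ‖γ t‖) (inner ℝ (γ 0) d / ‖γ 0‖) 0 := by
    have h3 := (h1.norm_sq).sqrt (by positivity)
    have h4 : (fun t => √(‖γ t‖ ^ 2)) = fun t => ‖γ t‖ := by
      ext t; exact Real.sqrt_sq (norm_nonneg _)
    rw [h4, Real.sqrt_sq (norm_nonneg _)] at h3
    convert! h3 using 1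
    field_simp
  have hax : HasDerivAt (a (xPart X)) (deriv (a (xPart X)) ‖γ 0‖) ‖γ 0‖ :=
    (((ha (xPart X)).contDiffAt (Ioi_mem_nhds (by positivity))).differentiableAt
      one_ne_zero).hasDerivAt
  have h5 := (hax.comp (0 : ℝ) h2).smul h1
  rw [HasLineDerivAt]
  convert! h5 using 1
  · ext t : 1
    simp only [xPart_add_smul_single, Function.comp, Pi.smul_apply', hγ]
  · ext q
    rw [h0]
    simp only [Matrix.mulVec, dotProduct, coeffAt, coeffMatrix, Matrix.of_apply, PiLp.add_apply,
      PiLp.smul_apply, smul_eq_mul, Function.comp]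
    simp only [add_mul, Finset.sum_add_distrib]
    have e1 : ∑ x, a (xPart X) ‖gradient u X‖ * (if q = x then 1 else 0) * d x
        = a (xPart X) ‖gradient u X‖ * d q := by simp
    rw [h0, e1, PiLp.inner_apply]
    congr 1
    simp only [RCLike.inner_apply, conj_trivial, Finset.sum_div, Finset.mul_sum, Finset.sum_mul]
    refine Finset.sum_congr rfl fun p _ => ?_
    ring

variable {F : EuclideanSpace ℝ (Fin m) → (Fin n → ℝ) → ℝ}

theorem NonlinAssumptions.F1_eq (hF : NonlinAssumptions F) (i : Fin n)
    (x : EuclideanSpace ℝ (Fin m)) :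
    F1 F i x = fun ξ => fderiv ℝ (F x) ξ (Pi.single i 1) := by
  ext ξ
  exact (hF.differentiable x ξ).lineDeriv_eq_fderiv

theorem NonlinAssumptions.differentiable_F1 (hF : NonlinAssumptions F) (i : Fin n)
    (x : EuclideanSpace ℝ (Fin m)) : Differentiable ℝ (F1 F i x) := by
  rw [hF.F1_eq]
  exact (hF.differentiable_fderiv x).clm_apply (differentiable_const _)

theorem NonlinAssumptions.F2_eq (hF : NonlinAssumptions F) (i j : Fin n)
    (x : EuclideanSpace ℝ (Fin m)) (ξ : Fin n → ℝ) :
    F2 F i j x ξ = fderiv ℝ (F1 F i x) ξ (Pi.single j 1) :=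
  (hF.differentiable_F1 i x ξ).lineDeriv_eq_fderiv

/-- Twice Fréchet differentiability already gives a symmetric second derivative, without its
continuity. -/
theorem NonlinAssumptions.F2_symm (hF : NonlinAssumptions F) (i j : Fin n)
    (x : EuclideanSpace ℝ (Fin m)) (ξ : Fin n → ℝ) : F2 F i j x ξ = F2 F j i x ξ := by
  have h : ∀ i j, F2 F i j x ξ = fderiv ℝ (fderiv ℝ (F x)) ξ (Pi.single j 1) (Pi.single i 1) := by
    intro i j
    rw [hF.F2_eq, hF.F1_eq, fderiv_clm_apply (hF.differentiable_fderiv x ξ) (by fun_prop)]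
    simp
  rw [h, h]
  exact second_derivative_symmetric (fun y => (hF.differentiable x y).hasFDerivAt)
    (hF.differentiable_fderiv x ξ).hasFDerivAt _ _

theorem NonlinAssumptions.hasLineDerivAt_F1 (hF : NonlinAssumptions F) {u : Fin n → Space m k → ℝ}
    (hu : ∀ i, ContDiff ℝ 1 (u i)) (i : Fin n) (j : Fin k) (X : Space m k) :
    HasLineDerivAt ℝ (fun X => F1 F i (xPart X) fun l => u l X)
      (∑ l, F2 F i l (xPart X) (fun l => u l X) * pd (u l) (Sum.inr j) X) X
      (EuclideanSpace.single (Sum.inr j) 1) := by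
  have h1 : HasDerivAt
      (fun (t : ℝ) (l : Fin n) => u l (X + t • EuclideanSpace.single (Sum.inr j) (1 : ℝ)))
      (fun l => pd (u l) (Sum.inr j) X) 0 := by
    rw [hasDerivAt_pi]
    intro l
    simp only [pd, gradient_apply]
    exact ((hu l).differentiable one_ne_zero X).hasFDerivAt.hasLineDerivAt _
  have h2 := (hF.differentiable_F1 i (xPart X)
    ((fun (t : ℝ) (l : Fin n) => u l (X + t • EuclideanSpace.single (Sum.inr j) (1 : ℝ)))
      0)).hasFDerivAt.comp_hasDerivAt (0 : ℝ) h1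
  rw [HasLineDerivAt]
  convert! h2 using 1
  · ext t
    simp only [xPart_add_smul_single, Function.comp]
  · simp only [zero_smul, add_zero]
    rw [← ContinuousLinearMap.coe_coe, LinearMap.pi_apply_eq_sum_univ]
    refine Finset.sum_congr rfl fun l _ => ?_
    rw [hF.F2_eq, smul_eq_mul, mul_comm]
    have e : (fun r => if l = r then (1 : ℝ) else 0) = Pi.single l 1 := by
      ext r
      simp [Pi.single_apply, eq_comm]
    rw [e, ContinuousLinearMap.coe_coe]

end Derivatives

/-! ### The linearized equation with smooth and with `C¹` test functions. -/

section Linearized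

variable {a : Fin n → EuclideanSpace ℝ (Fin m) → ℝ → ℝ}
  {F : EuclideanSpace ℝ (Fin m) → (Fin n → ℝ) → ℝ} {u : Fin n → Space m k → ℝ}

theorem inner_toLp_mulVec (A : Matrix (Fin m ⊕ Fin k) (Fin m ⊕ Fin k) ℝ) (v w : Space m k) :
    inner ℝ (WithLp.toLp 2 (A.mulVec fun p => v p) : Space m k) w = bil A v w := by
  rw [PiLp.inner_apply, bil]
  refine Finset.sum_congr rfl fun p _ => ?_
  simp only [RCLike.inner_apply, conj_trivial, Matrix.mulVec, dotProduct, Finset.mul_sum]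
  exact Finset.sum_congr rfl fun q _ => by ring

/-- `X ↦ ∇∂_p u(X)`, set to zero off `{∇u ≠ 0} ∩ B_R`. -/
abbrev hessCut (u : Space m k → ℝ) (p : Fin m ⊕ Fin k) (R : ℝ) : Space m k → Space m k :=
  (regSet u ∩ ball 0 R).indicator (gradient (pd u p))

theorem bil_hessCut {u : Space m k → ℝ} {p : Fin m ⊕ Fin k} {R : ℝ} {X w : Space m k}
    (A : Matrix (Fin m ⊕ Fin k) (Fin m ⊕ Fin k) ℝ)
    (h : X ∉ regSet u ∩ ball 0 R → w = 0) :
    bil A (hessCut u p R X) w = bil A (gradient (pd u p) X) w := by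
  by_cases hX : X ∈ regSet u ∩ ball 0 R
  · rw [hessCut, indicator_of_mem hX]
  · rw [h hX, bil_zero_right, bil_zero_right]

theorem exists_tsupport_subset_ball {f : Space m k → ℝ} (hf : HasCompactSupport f) :
    ∃ R, tsupport f ⊆ ball 0 R :=
  (IsCompact.isBounded hf).subset_ball 0

/-- The equation linearized in the direction `y_j`, tested with a smooth function supported in
`{∇uⁱ ≠ 0}`. -/
theorem linearized_of_isTest (ha : CoeffAssumptions a) (hF : NonlinAssumptions F)
    (hreg : ∀ i, SolutionRegularity (u i)) (hweak : IsWeakSolution a F u)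
    (hstable : IsStable a F u) (hbdd : ∀ i, CoeffLocBounded (a i) (u i)) (i : Fin n) (j : Fin k)
    {φ : Space m k → ℝ} (hφ : IsTest φ) (hs : tsupport φ ⊆ regSet (u i)) :
    ∫ X, bil (coeffAt (a i) (u i) X) (gradient (pd (u i) (Sum.inr j)) X) (gradient φ X) =
      ∑ l, ∫ X, F2 F i l (xPart X) (fun l => u l X) * (pd (u l) (Sum.inr j) X * φ X) := by
  obtain ⟨R, hR⟩ := exists_tsupport_subset_ball hφ.2
  have hU := isOpen_regSet (hreg i).contDiff
  -- Testing with `φ` only supplies the integrability of the undifferentiated products required for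
  -- integration by parts; the equation itself is used with `∂_{y_j} φ`.
  obtain ⟨w1, w2, -⟩ := hweak (fun _ => φ) (fun _ => hφ) i
  obtain ⟨w1', w2', w3⟩ := hweak (fun _ => pd φ (Sum.inr j)) (fun _ => hφ.pd _) i
  have hg : MemLp (gradient φ) 2 :=
    (continuous_gradient hφ.contDiff_one).memLp_of_hasCompactSupport
      (hφ.2.mono' (subset_closure.trans (tsupport_gradient_subset φ)))
  have hz : ∀ X, X ∉ regSet (u i) ∩ ball 0 R → gradient φ X = 0 := fun X hX =>
    gradient_eq_zero_of_notMem_tsupport fun h => hX ⟨hs h, hR h⟩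
  have i1 : Integrable fun X => bil (coeffAt (a i) (u i) X)
      (gradient (pd (u i) (Sum.inr j)) X) (gradient φ X) := by
    refine ((hbdd i).integrable_bil hU (R := R)
      ((hreg i).memLp_gradient_pd (Sum.inr j) R) hg
      (fun X hX => indicator_of_notMem hX _)).congr (Eventually.of_forall fun X => ?_)
    exact bil_hessCut _ (hz X)
  have i2 : ∀ l, Integrable fun X =>
      F2 F i l (xPart X) (fun l => u l X) * (pd (u l) (Sum.inr j) X * φ X) := fun l => by
    have hc : Continuous fun X => pd (u l) (Sum.inr j) X * φ X :=
      (continuous_pd (hreg l).contDiff _).mul hφ.1.continuous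
    obtain ⟨M, hM⟩ := hc.bounded_above_of_compact_support hφ.2.mul_left
    exact integrable_mul_of_integrableOn_ball (hstable.integrableOn_F2 i l R)
      hc.aestronglyMeasurable hM fun X hX => by
        rw [image_eq_zero_of_notMem_tsupport fun h => hX (hR h), mul_zero]
  have lhs : ∫ X, inner ℝ (a i (xPart X) ‖gradient (u i) X‖ • gradient (u i) X)
      (gradient (pd φ (Sum.inr j)) X) = -∫ X, bil (coeffAt (a i) (u i) X)
      (gradient (pd (u i) (Sum.inr j)) X) (gradient φ X) := by
    have := integral_bilinear_hasLineDerivAt_right_eq_neg_left_of_integrable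
      (μ := (volume : Measure (Space m k)))
      (B := innerSL ℝ) (v := EuclideanSpace.single (Sum.inr j) (1 : ℝ))
      (f := fun X => a i (xPart X) ‖gradient (u i) X‖ • gradient (u i) X)
      (f' := fun X => WithLp.toLp 2 ((coeffAt (a i) (u i) X).mulVec
        fun p => gradient (pd (u i) (Sum.inr j)) X p))
      (g := gradient φ) (g' := gradient (pd φ (Sum.inr j)))
      (i1.congr (Eventually.of_forall fun X => (inner_toLp_mulVec _ _ _).symm)) w1' w1
      (fun X hX => by
        have hX' : X ∈ regSet (u i) := hs (tsupport_gradient_subset φ hX)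
        exact hasLineDerivAt_flux (ha.contDiffOn i) ((hreg i).contDiffAt hX') hX' j)
      (fun X _ => hasLineDerivAt_gradient
        (contDiff_infty.1 hφ.1 2).contDiffAt _)
    exact this.trans (congrArg Neg.neg (integral_congr_ae
      (Eventually.of_forall fun X => inner_toLp_mulVec _ _ _)))
  have e : ∀ X, (∑ l, F2 F i l (xPart X) (fun l => u l X) * pd (u l) (Sum.inr j) X) * φ X =
      ∑ l, F2 F i l (xPart X) (fun l => u l X) * (pd (u l) (Sum.inr j) X * φ X) := fun X => by
    rw [Finset.sum_mul]; exact Finset.sum_congr rfl fun l _ => by ring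
  have rhs : ∫ X, F1 F i (xPart X) (fun l => u l X) * pd φ (Sum.inr j) X =
      -∑ l, ∫ X, F2 F i l (xPart X) (fun l => u l X) * (pd (u l) (Sum.inr j) X * φ X) := by
    have := integral_bilinear_hasLineDerivAt_right_eq_neg_left_of_integrable
      (μ := (volume : Measure (Space m k)))
      (B := ContinuousLinearMap.mul ℝ ℝ) (v := EuclideanSpace.single (Sum.inr j) (1 : ℝ))
      (f := fun X => F1 F i (xPart X) (fun l => u l X))
      (f' := fun X => ∑ l, F2 F i l (xPart X) (fun l => u l X) * pd (u l) (Sum.inr j) X)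
      (g := φ) (g' := pd φ (Sum.inr j))
      (by simp only [ContinuousLinearMap.mul_apply', e]
          exact integrable_finsetSum _ fun l _ => i2 l) w2' w2
      (fun X _ => hF.hasLineDerivAt_F1 (fun i => (hreg i).contDiff) i j X)
      (fun X _ => by
        simp only [Fibered.pd, gradient_apply]
        exact (hφ.1.differentiable (by simp) X).hasFDerivAt.hasLineDerivAt _)
    simp only [ContinuousLinearMap.mul_apply', e] at this
    rw [this, integral_finsetSum _ fun l _ => i2 l]
  rw [lhs, rhs] at w3
  exact neg_injective w3

/-- The equation linearized in the direction `y_j`, tested with a `C¹` function supported in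
`{∇uⁱ ≠ 0}`. -/
theorem linearized_of_contDiff (ha : CoeffAssumptions a) (hF : NonlinAssumptions F)
    (hreg : ∀ i, SolutionRegularity (u i)) (hweak : IsWeakSolution a F u)
    (hstable : IsStable a F u) (hbdd : ∀ i, CoeffLocBounded (a i) (u i)) (i : Fin n) (j : Fin k)
    {ψ : Space m k → ℝ} (hψ : ContDiff ℝ 1 ψ) (hc : HasCompactSupport ψ)
    (hs : tsupport ψ ⊆ regSet (u i)) :
    ∫ X, bil (coeffAt (a i) (u i) X) (gradient (pd (u i) (Sum.inr j)) X) (gradient ψ X) =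
      ∑ l, ∫ X, F2 F i l (xPart X) (fun l => u l X) * (pd (u l) (Sum.inr j) X * ψ X) := by
  have hU := isOpen_regSet (hreg i).contDiff
  obtain ⟨K, M, Ψ, hK, hKU, hT, hΨK, hΨM, hΨ'M, hlim, hlim'⟩ := exists_smooth_approx hψ hc hU hs
  obtain ⟨R, hR⟩ := hK.isBounded.subset_ball 0
  have hz : ∀ j, ∀ X ∉ K, Ψ j X = 0 := fun j X hX =>
    image_eq_zero_of_notMem_tsupport fun h => hX (hΨK j h)
  have hz' : ∀ j, ∀ X ∉ K, gradient (Ψ j) X = 0 := fun j X hX =>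
    gradient_eq_zero_of_notMem_tsupport fun h => hX (hΨK j h)
  have hz0 : ∀ X ∉ K, gradient ψ X = 0 := fun X hX =>
    tendsto_nhds_unique (hlim' X) (by simp [hz' _ X hX])
  have t1 : Tendsto (fun r => ∫ X, bil (coeffAt (a i) (u i) X)
      (gradient (pd (u i) (Sum.inr j)) X) (gradient (Ψ r) X)) atTop
      (𝓝 (∫ X, bil (coeffAt (a i) (u i) X) (gradient (pd (u i) (Sum.inr j)) X)
        (gradient ψ X))) := by
    have hmem := (hreg i).memLp_gradient_pd (Sum.inr j) R
    have := (hbdd i).tendsto_integral_bil hU (R := R) (v := fun _ => hessCut (u i) (Sum.inr j) R)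
      (w := fun r => gradient (Ψ r)) (w' := gradient ψ) (fun _ => hmem.1)
      (fun r => (continuous_gradient (hT r).contDiff_one).aestronglyMeasurable)
      (fun _ X hX => indicator_of_notMem hX _) hmem.norm (memLp_indicator_ball R M 2)
      (fun _ _ => le_rfl) (fun r X => by
        by_cases hX : X ∈ ball (0 : Space m k) R
        · rw [indicator_of_mem hX]; exact hΨ'M r X
        · rw [indicator_of_notMem hX, hz' r X fun h => hX (hR h), norm_zero])
      (fun _ => tendsto_const_nhds) hlim'
    have e : ∀ {w : Space m k → Space m k}, (∀ X ∉ K, w X = 0) →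
        ∫ X, bil (coeffAt (a i) (u i) X) (hessCut (u i) (Sum.inr j) R X) (w X) =
        ∫ X, bil (coeffAt (a i) (u i) X) (gradient (pd (u i) (Sum.inr j)) X) (w X) := by
      intro w hw
      exact integral_congr_ae (Eventually.of_forall fun X =>
        bil_hessCut _ fun hX => hw X fun h => hX ⟨hKU h, hR h⟩)
    rw [e hz0] at this
    exact this.congr fun r => e (hz' r)
  have t2 : ∀ l, Tendsto (fun r => ∫ X, F2 F i l (xPart X) (fun l => u l X) *
      (pd (u l) (Sum.inr j) X * Ψ r X)) atTop
      (𝓝 (∫ X, F2 F i l (xPart X) (fun l => u l X) * (pd (u l) (Sum.inr j) X * ψ X))) := by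
    intro l
    obtain ⟨B, hB⟩ := (hreg l).bounded_gradient
    refine tendsto_integral_mul_of_integrableOn_ball (hstable.integrableOn_F2 i l R) (M := B * M)
      (fun r => ((continuous_pd (hreg l).contDiff _).mul
        (hT r).1.continuous).aestronglyMeasurable) (fun r X => ?_) (fun r X hX => ?_)
      (fun X => (hlim X).const_mul _)
    · rw [abs_mul]
      have h1 : |pd (u l) (Sum.inr j) X| ≤ B := (PiLp.norm_apply_le _ _).trans (hB X)
      exact mul_le_mul h1 (hΨM r X) (abs_nonneg _) ((abs_nonneg _).trans h1)
    · rw [hz r X fun h => hX (hR h), mul_zero]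
  refine tendsto_nhds_unique t1 ((tendsto_finsetSum _ fun l _ => t2 l).congr fun r => ?_)
  exact (linearized_of_isTest ha hF hreg hweak hstable hbdd i j (hT r)
    ((hΨK r).trans hKU)).symm

end Linearized

/-! ### Product, chain and sum rules for gradients. -/

section GradientCalculus

variable {f g : Space m k → ℝ} {f' g' X : Space m k}

theorem _root_.HasGradientAt.mul_real (hf : HasGradientAt f f' X) (hg : HasGradientAt g g' X) :
    HasGradientAt (fun Y => f Y * g Y) (f X • g' + g X • f') X := by
  rw [hasGradientAt_iff_hasFDerivAt] at *
  have h := hf.mul hg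
  have e : InnerProductSpace.toDual ℝ (Space m k) (f X • g' + g X • f') =
    f X • InnerProductSpace.toDual ℝ (Space m k) g' +
      g X • InnerProductSpace.toDual ℝ (Space m k) f' := by simp
  rw [e]
  exact h

theorem _root_.HasGradientAt.scomp_real {ρ : ℝ → ℝ} {c : ℝ} (hρ : HasDerivAt ρ c (f X))
    (hf : HasGradientAt f f' X) : HasGradientAt (fun Y => ρ (f Y)) (c • f') X := by
  rw [hasGradientAt_iff_hasFDerivAt] at *
  have h := hρ.comp_hasFDerivAt X hf
  have e : InnerProductSpace.toDual ℝ (Space m k) (c • f') =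
    c • InnerProductSpace.toDual ℝ (Space m k) f' := by simp
  rw [e]
  exact h

theorem _root_.HasGradientAt.sum_real {ι : Type*} {s : Finset ι} {f : ι → Space m k → ℝ}
    {f' : ι → Space m k} (hf : ∀ j ∈ s, HasGradientAt (f j) (f' j) X) :
    HasGradientAt (fun Y => ∑ j ∈ s, f j Y) (∑ j ∈ s, f' j) X := by
  simp only [hasGradientAt_iff_hasFDerivAt] at *
  simpa using HasFDerivAt.fun_sum hf

end GradientCalculus

/-! ### One-dimensional cutoffs near zero. -/

section Cutoff

/-- A smooth cutoff of `(0, ∞)` away from `0`, equal to `1` on `[2 / (r + 1), ∞)`. -/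
def cutoff (r : ℕ) (s : ℝ) : ℝ := Real.smoothTransition ((r + 1) * s - 1)

theorem contDiff_cutoff (r : ℕ) : ContDiff ℝ 1 (cutoff r) :=
  Real.smoothTransition.contDiff.comp (by fun_prop)

theorem cutoff_eq_zero {r : ℕ} {s : ℝ} (h : s ≤ 1 / (r + 1)) : cutoff r s = 0 := by
  apply Real.smoothTransition.zero_of_nonpos
  rw [le_div_iff₀ (by positivity)] at h
  linarith

theorem cutoff_nonneg (r : ℕ) (s : ℝ) : 0 ≤ cutoff r s := Real.smoothTransition.nonneg _

theorem cutoff_le_one (r : ℕ) (s : ℝ) : cutoff r s ≤ 1 := Real.smoothTransition.le_one _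

theorem hasDerivAt_cutoff (r : ℕ) (s : ℝ) :
    HasDerivAt (cutoff r) (deriv (cutoff r) s) s :=
  ((contDiff_cutoff r).differentiable one_ne_zero s).hasDerivAt

theorem deriv_cutoff (r : ℕ) (s : ℝ) :
    deriv (cutoff r) s = (r + 1) * deriv Real.smoothTransition ((r + 1) * s - 1) := by
  have h1 : HasDerivAt Real.smoothTransition (deriv Real.smoothTransition ((r + 1) * s - 1))
      ((r + 1) * s - 1) :=
    ((Real.smoothTransition.contDiff (n := 1)).differentiable one_ne_zero _).hasDerivAt
  have h2 : HasDerivAt (fun s : ℝ => ((r : ℝ) + 1) * s - 1) (r + 1) s := by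
    simpa using ((hasDerivAt_id s).const_mul ((r : ℝ) + 1)).sub_const 1
  have := (h1.comp s h2).deriv
  rw [mul_comm]
  exact this

theorem deriv_smoothTransition_eq_zero {t : ℝ} (h : t < 0 ∨ 1 < t) :
    deriv Real.smoothTransition t = 0 := by
  rcases h with h | h
  · have : Real.smoothTransition =ᶠ[𝓝 t] fun _ => 0 := by
      filter_upwards [Iio_mem_nhds h] with s hs
      exact Real.smoothTransition.zero_of_nonpos (le_of_lt hs)
    rw [this.deriv_eq, deriv_const]
  · have : Real.smoothTransition =ᶠ[𝓝 t] fun _ => 1 := by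
      filter_upwards [Ioi_mem_nhds h] with s hs
      exact Real.smoothTransition.one_of_one_le (le_of_lt hs)
    rw [this.deriv_eq, deriv_const]

/-- Scale invariance: with `t = (r + 1) s - 1` the product is `(t + 1)` times the derivative of the
fixed transition at `t`, a continuous function supported in `[0, 1]`, so the bound does not depend
on `r`. -/
theorem exists_bound_mul_deriv_cutoff : ∃ B : ℝ, ∀ r s, |s * deriv (cutoff r) s| ≤ B := by
  have hc : Continuous fun t : ℝ => (t + 1) * deriv Real.smoothTransition t :=
    (continuous_id.add continuous_const).mul
      ((Real.smoothTransition.contDiff (n := 1)).continuous_deriv le_rfl)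
  have hs : HasCompactSupport fun t : ℝ => (t + 1) * deriv Real.smoothTransition t := by
    refine HasCompactSupport.intro (isCompact_Icc (a := (0 : ℝ)) (b := 1)) fun t ht => ?_
    rw [deriv_smoothTransition_eq_zero, mul_zero]
    rw [mem_Icc, not_and_or, not_le, not_le] at ht
    exact ht
  obtain ⟨B, hB⟩ := hc.bounded_above_of_compact_support hs
  refine ⟨B, fun r s => ?_⟩
  have := hB ((r + 1) * s - 1)
  rw [deriv_cutoff, ← Real.norm_eq_abs]
  rwa [show s * ((r + 1) * deriv Real.smoothTransition ((r + 1) * s - 1)) =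
    ((r + 1) * s - 1 + 1) * deriv Real.smoothTransition ((r + 1) * s - 1) by ring]

theorem eventually_cutoff {s : ℝ} (hs : 0 < s) :
    ∀ᶠ r : ℕ in atTop, cutoff r s = 1 ∧ deriv (cutoff r) s = 0 := by
  obtain ⟨r₀, hr₀⟩ := exists_nat_gt (2 / s)
  filter_upwards [eventually_ge_atTop r₀] with r hr
  have h1 : 2 < (r + 1) * s := by
    rw [div_lt_iff₀ hs] at hr₀
    have : (r₀ : ℝ) ≤ r := by exact_mod_cast hr
    nlinarith
  refine ⟨Real.smoothTransition.one_of_one_le (by linarith), ?_⟩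
  rw [deriv_cutoff, deriv_smoothTransition_eq_zero (Or.inr (by linarith)), mul_zero]

end Cutoff

/-! ### Calculus of `|∇_y u|` and truncation near its zero set. -/

section Truncation

variable {u : Space m k → ℝ}

/-- The set `{∇_y u ≠ 0}`. -/
abbrev ySet (u : Space m k → ℝ) : Set (Space m k) := {X | gradY u X ≠ 0}

/-- `∇|∇_y u|` on `{∇_y u ≠ 0}`, extended by zero. -/
def normGrad (u : Space m k → ℝ) (X : Space m k) : Space m k :=
  ∑ j, (pd u (Sum.inr j) X / ‖gradY u X‖) • gradient (pd u (Sum.inr j)) X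

theorem gradY_apply (u : Space m k → ℝ) (X : Space m k) (j : Fin k) :
    gradY u X j = pd u (Sum.inr j) X := rfl

theorem norm_gradY_sq (u : Space m k → ℝ) (X : Space m k) :
    ‖gradY u X‖ ^ 2 = ∑ j, pd u (Sum.inr j) X ^ 2 := by
  rw [EuclideanSpace.norm_sq_eq]
  simp [gradY_apply]

theorem abs_pd_le_norm_gradY (u : Space m k → ℝ) (X : Space m k) (j : Fin k) :
    |pd u (Sum.inr j) X| ≤ ‖gradY u X‖ := PiLp.norm_apply_le (gradY u X) j

theorem norm_gradY_le (u : Space m k → ℝ) (X : Space m k) : ‖gradY u X‖ ≤ ‖gradient u X‖ := by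
  refine le_of_sq_le_sq ?_ (norm_nonneg _)
  rw [norm_gradY_sq, EuclideanSpace.norm_sq_eq, Fintype.sum_sum_type]
  simp only [Real.norm_eq_abs, sq_abs]
  exact le_add_of_nonneg_left (Finset.sum_nonneg fun _ _ => sq_nonneg _)

theorem continuous_gradY (hu : ContDiff ℝ 1 u) : Continuous (gradY u) :=
  (PiLp.continuous_toLp 2 _).comp (continuous_pi fun j => continuous_pd hu (Sum.inr j))

theorem isOpen_ySet (hu : ContDiff ℝ 1 u) : IsOpen (ySet u) :=
  isOpen_ne_fun (continuous_gradY hu) continuous_const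

theorem ySet_subset_regSet (u : Space m k → ℝ) : ySet u ⊆ regSet u := fun X hX h => by
  apply hX
  ext j
  simp [gradY_apply, pd, h]

theorem pd_eq_zero_of_notMem_ySet {X : Space m k} (hX : X ∉ ySet u) (j : Fin k) :
    pd u (Sum.inr j) X = 0 := by
  have : gradY u X = 0 := not_not.1 hX
  rw [← gradY_apply, this]; rfl

theorem norm_gradY_eq_zero_of_notMem_ySet {X : Space m k} (hX : X ∉ ySet u) :
    ‖gradY u X‖ = 0 := norm_eq_zero.2 (not_not.1 hX)

theorem normGrad_eq_zero_of_notMem_ySet {X : Space m k} (hX : X ∉ ySet u) :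
    normGrad u X = 0 := by
  simp [normGrad, norm_gradY_eq_zero_of_notMem_ySet hX]

/-- Both sides are half the gradient of `|∇_y u|²` where `∇_y u ≠ 0`, and both vanish elsewhere.
Multiplying by the norm removes the division in `normGrad`. -/
theorem norm_smul_normGrad (u : Space m k → ℝ) (X : Space m k) :
    ‖gradY u X‖ • normGrad u X = ∑ j, pd u (Sum.inr j) X • gradient (pd u (Sum.inr j)) X := by
  by_cases hX : X ∈ ySet u
  · have : ‖gradY u X‖ ≠ 0 := norm_ne_zero_iff.2 hX
    rw [normGrad, Finset.smul_sum]
    refine Finset.sum_congr rfl fun j _ => ?_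
    rw [smul_smul, mul_div_cancel₀ _ this]
  · simp [normGrad_eq_zero_of_notMem_ySet hX, pd_eq_zero_of_notMem_ySet hX]

theorem norm_normGrad_le (u : Space m k → ℝ) (X : Space m k) :
    ‖normGrad u X‖ ≤ ∑ j, ‖gradient (pd u (Sum.inr j)) X‖ := by
  refine (norm_sum_le _ _).trans (Finset.sum_le_sum fun j _ => ?_)
  rw [norm_smul, norm_div, norm_norm]
  refine mul_le_of_le_one_left (norm_nonneg _) (div_le_one_of_le₀ ?_ (norm_nonneg _))
  exact abs_pd_le_norm_gradY u X j

theorem SolutionRegularity.contDiffAt_pd (hu : SolutionRegularity u)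
    {X : Space m k} (hX : X ∈ ySet u) (p : Fin m ⊕ Fin k) :
    ContDiffAt ℝ 1 (pd u p) X :=
  (hu.contDiffOn_pd p).contDiffAt
    ((isOpen_regSet hu.contDiff).mem_nhds (ySet_subset_regSet u hX))

theorem SolutionRegularity.hasGradientAt_pd (hu : SolutionRegularity u)
    {X : Space m k} (hX : X ∈ ySet u)
    (p : Fin m ⊕ Fin k) : HasGradientAt (pd u p) (gradient (pd u p) X) X :=
  ((hu.contDiffAt_pd hX p).differentiableAt one_ne_zero).hasGradientAt

theorem SolutionRegularity.hasGradientAt_norm_sq (hu : SolutionRegularity u)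
    {X : Space m k} (hX : X ∈ ySet u) :
    HasGradientAt (fun Y => ‖gradY u Y‖ ^ 2) ((2 * ‖gradY u X‖) • normGrad u X) X := by
  simp only [norm_gradY_sq]
  have h : ∀ j, HasGradientAt (fun Y => pd u (Sum.inr j) Y ^ 2)
      ((2 * pd u (Sum.inr j) X) • gradient (pd u (Sum.inr j)) X) X := fun j => by
    simpa using HasGradientAt.scomp_real (hasDerivAt_pow 2 (pd u (Sum.inr j) X))
      (hu.hasGradientAt_pd hX (Sum.inr j))
  convert! HasGradientAt.sum_real (s := Finset.univ) fun j _ => h j using 1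
  rw [mul_smul, norm_smul_normGrad, Finset.smul_sum]
  exact Finset.sum_congr rfl fun j _ => by rw [smul_smul]

theorem SolutionRegularity.contDiffAt_norm_sq (hu : SolutionRegularity u)
    {X : Space m k} (hX : X ∈ ySet u) :
    ContDiffAt ℝ 1 (fun Y => ‖gradY u Y‖ ^ 2) X := by
  simp only [norm_gradY_sq]
  exact ContDiffAt.sum fun j _ => (hu.contDiffAt_pd hX (Sum.inr j)).pow 2

theorem SolutionRegularity.contDiffAt_norm (hu : SolutionRegularity u)
    {X : Space m k} (hX : X ∈ ySet u) :
    ContDiffAt ℝ 1 (fun Y => ‖gradY u Y‖) X := by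
  have h := (hu.contDiffAt_norm_sq hX).sqrt (pow_ne_zero 2 (norm_ne_zero_iff.2 hX))
  simpa only [Real.sqrt_sq (norm_nonneg _)] using h

theorem SolutionRegularity.hasGradientAt_norm (hu : SolutionRegularity u)
    {X : Space m k} (hX : X ∈ ySet u) :
    HasGradientAt (fun Y => ‖gradY u Y‖) (normGrad u X) X := by
  have hn : ‖gradY u X‖ ≠ 0 := norm_ne_zero_iff.2 hX
  have h := HasGradientAt.scomp_real (Real.hasDerivAt_sqrt (pow_ne_zero 2 hn))
    (hu.hasGradientAt_norm_sq hX)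
  simp only [Real.sqrt_sq (norm_nonneg _), smul_smul] at h
  convert! h using 1
  rw [one_div, inv_mul_cancel₀ (by positivity), one_smul]

/-- By continuity `|∇_y u|² < ε` in a whole neighbourhood of a zero of `∇_y u`. Hence nothing is
required of `f` there, and the truncated function is supported in `{∇_y u ≠ 0}`. -/
theorem truncation_eventually_zero (hu : SolutionRegularity u)
    {f : Space m k → ℝ} {ρ : ℝ → ℝ} {ε : ℝ} (hε : 0 < ε)
    (h0 : ∀ s ≤ ε, ρ s = 0) {X : Space m k} (hX : X ∉ ySet u) :
    (fun Y => f Y * ρ (‖gradY u Y‖ ^ 2)) =ᶠ[𝓝 X] fun _ => 0 := by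
  have hc : Continuous fun Y => ‖gradY u Y‖ ^ 2 := (continuous_gradY hu.contDiff).norm.pow 2
  have : {Y | ‖gradY u Y‖ ^ 2 < ε} ∈ 𝓝 X :=
    (isOpen_lt hc continuous_const).mem_nhds (by
      simp [norm_gradY_eq_zero_of_notMem_ySet hX, hε])
  filter_upwards [this] with Y hY
  rw [h0 _ (le_of_lt hY), mul_zero]

theorem contDiff_truncation (hu : SolutionRegularity u)
    {f : Space m k → ℝ} {ρ : ℝ → ℝ} {ε : ℝ} (hε : 0 < ε)
    (h0 : ∀ s ≤ ε, ρ s = 0) (hρ : ContDiff ℝ 1 ρ) (hf : ∀ X ∈ ySet u, ContDiffAt ℝ 1 f X) :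
    ContDiff ℝ 1 fun Y => f Y * ρ (‖gradY u Y‖ ^ 2) := by
  rw [contDiff_iff_contDiffAt]
  intro X
  by_cases hX : X ∈ ySet u
  · exact (hf X hX).mul (hρ.contDiffAt.comp X (hu.contDiffAt_norm_sq hX))
  · exact contDiffAt_const.congr_of_eventuallyEq (truncation_eventually_zero hu hε h0 hX)

theorem tsupport_truncation_subset (hu : SolutionRegularity u)
    {f : Space m k → ℝ} {ρ : ℝ → ℝ} {ε : ℝ} (hε : 0 < ε)
    (h0 : ∀ s ≤ ε, ρ s = 0) : tsupport (fun Y => f Y * ρ (‖gradY u Y‖ ^ 2)) ⊆ ySet u := by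
  intro X hX
  by_contra h
  exact notMem_tsupport_iff_eventuallyEq.2 (truncation_eventually_zero hu hε h0 h) hX

theorem gradient_truncation (hu : SolutionRegularity u)
    {f : Space m k → ℝ} {ρ : ℝ → ℝ} {f' X : Space m k} {c : ℝ}
    (hX : X ∈ ySet u) (hf : HasGradientAt f f' X) (hρ : HasDerivAt ρ c (‖gradY u X‖ ^ 2)) :
    gradient (fun Y => f Y * ρ (‖gradY u Y‖ ^ 2)) X =
      ρ (‖gradY u X‖ ^ 2) • f' + (f X * c * (2 * ‖gradY u X‖)) • normGrad u X := by
  have h := hf.mul_real (HasGradientAt.scomp_real hρ (hu.hasGradientAt_norm_sq hX))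
  rw [h.gradient, smul_smul, smul_smul, add_comm, mul_assoc]

end Truncation

/-! ### Test functions of size `O(|∇_y u|)`. -/

section TruncatedTests

variable {u : Space m k → ℝ}

theorem SolutionRegularity.continuousOn_gradient_pd (hu : SolutionRegularity u)
    (p : Fin m ⊕ Fin k) : ContinuousOn (gradient (pd u p)) (ySet u) :=
  (continuousOn_gradient (isOpen_regSet hu.contDiff) (hu.contDiffOn_pd p)).mono
    (ySet_subset_regSet u)

theorem SolutionRegularity.continuousOn_normGrad (hu : SolutionRegularity u) :
    ContinuousOn (normGrad u) (ySet u) := by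
  refine continuousOn_finsetSum _ fun j _ => ContinuousOn.fun_smul ?_ (hu.continuousOn_gradient_pd _)
  exact (continuous_pd hu.contDiff _).continuousOn.div
    (continuous_gradY hu.contDiff).norm.continuousOn fun X hX => norm_ne_zero_iff.2 hX

/-- The gradients of both test functions in the Poincaré inequality have this form: a bounded term
from `∇φ` and a term controlled by the rows of the Hessian. -/
theorem SolutionRegularity.memLp_indicator (hu : SolutionRegularity u) {g : Space m k → Space m k}
    (hg : ContinuousOn g (ySet u)) {R b c : ℝ} (hb : ∀ X ∈ ySet u ∩ ball 0 R,
      ‖g X‖ ≤ b + c * ∑ j, ‖gradient (pd u (Sum.inr j)) X‖) :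
    MemLp ((ySet u ∩ ball 0 R).indicator g) 2 := by
  have h1 : MemLp (fun X => |(ball (0 : Space m k) R).indicator (fun _ => b) X| +
      |c| * ∑ j, ‖hessCut u (Sum.inr j) R X‖) 2 :=
    (memLp_indicator_ball R b 2).norm.add
      ((memLp_finsetSum _ fun j _ => (hu.memLp_gradient_pd (Sum.inr j) R).norm).const_mul |c|)
  refine h1.mono' (aestronglyMeasurable_indicator_of_continuousOn
    ((isOpen_ySet hu.contDiff).inter isOpen_ball) (hg.mono inter_subset_left))
    (Eventually.of_forall fun X => ?_)
  by_cases hX : X ∈ ySet u ∩ ball 0 R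
  · have hX' : X ∈ regSet u ∩ ball 0 R := ⟨ySet_subset_regSet u hX.1, hX.2⟩
    simp only [hessCut, indicator_of_mem hX, indicator_of_mem hX.2, indicator_of_mem hX']
    refine (hb X hX).trans (add_le_add (le_abs_self b) ?_)
    exact mul_le_mul_of_nonneg_right (le_abs_self c) (Finset.sum_nonneg fun _ _ => norm_nonneg _)
  · rw [indicator_of_notMem hX, norm_zero]
    positivity

theorem SolutionRegularity.memLp_normGrad (hu : SolutionRegularity u) (R : ℝ) :
    MemLp ((ySet u ∩ ball 0 R).indicator (normGrad u)) 2 :=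
  hu.memLp_indicator hu.continuousOn_normGrad (b := 0) (c := 1) fun X _ => by
    simpa using norm_normGrad_le u X

/-- The function `f`, cut off near `{∇_y u = 0}`. -/
abbrev trunc (u f : Space m k → ℝ) (r : ℕ) : Space m k → ℝ :=
  fun Y => f Y * cutoff r (‖gradY u Y‖ ^ 2)

section Trunc

variable {f : Space m k → ℝ} {f' : Space m k → Space m k} {R M : ℝ}

theorem contDiff_trunc (hu : SolutionRegularity u) (hf : ∀ X ∈ ySet u, ContDiffAt ℝ 1 f X)
    (r : ℕ) : ContDiff ℝ 1 (trunc u f r) :=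
  contDiff_truncation hu (ε := 1 / (r + 1)) (by positivity) (fun _ hs => cutoff_eq_zero hs)
    (contDiff_cutoff r) hf

theorem tsupport_trunc_subset_ySet (hu : SolutionRegularity u) (r : ℕ) :
    tsupport (trunc u f r) ⊆ ySet u :=
  tsupport_truncation_subset hu (ε := 1 / (r + 1)) (by positivity) fun _ hs => cutoff_eq_zero hs

theorem tsupport_trunc_subset (r : ℕ) : tsupport (trunc u f r) ⊆ tsupport f :=
  closure_mono (Function.support_mul_subset_left _ _)

theorem gradient_trunc_eq_zero (hu : SolutionRegularity u) (hR : tsupport f ⊆ ball 0 R) (r : ℕ)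
    {X : Space m k} (hX : X ∉ ySet u ∩ ball 0 R) : gradient (trunc u f r) X = 0 :=
  gradient_eq_zero_of_notMem_tsupport fun h =>
    hX ⟨tsupport_trunc_subset_ySet hu r h, hR (tsupport_trunc_subset r h)⟩

theorem abs_trunc_le (r : ℕ) (X : Space m k) : |trunc u f r X| ≤ |f X| := by
  rw [abs_mul]
  refine mul_le_of_le_one_right (abs_nonneg _) ?_
  rw [abs_of_nonneg (cutoff_nonneg _ _)]
  exact cutoff_le_one _ _

theorem tendsto_trunc (hM : ∀ X, |f X| ≤ M * ‖gradY u X‖) (X : Space m k) :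
    Tendsto (fun r => trunc u f r X) atTop (𝓝 (f X)) := by
  by_cases hX : X ∈ ySet u
  · refine tendsto_const_nhds.congr' ?_
    filter_upwards [eventually_cutoff (pow_pos (norm_pos_iff.2 hX) 2)] with r hr
    rw [trunc, hr.1, mul_one]
  · have h0 := hM X
    rw [norm_gradY_eq_zero_of_notMem_ySet hX, mul_zero] at h0
    simp [trunc, abs_nonpos_iff.1 h0]

theorem gradient_trunc (hu : SolutionRegularity u) {X : Space m k} (hX : X ∈ ySet u)
    (hf : HasGradientAt f (f' X) X) (r : ℕ) :
    gradient (trunc u f r) X = cutoff r (‖gradY u X‖ ^ 2) • f' X +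
      (f X * deriv (cutoff r) (‖gradY u X‖ ^ 2) * (2 * ‖gradY u X‖)) • normGrad u X :=
  gradient_truncation hu hX hf (hasDerivAt_cutoff r _)

/-- At a fixed point with `∇_y u ≠ 0` the cutoff is eventually `1` with zero derivative. Elsewhere
every truncated gradient is zero, so the limit is an indicator and no derivative of `f` on `{∇_y u =
0}` enters. -/
theorem tendsto_gradient_trunc (hu : SolutionRegularity u)
    (hf : ∀ X ∈ ySet u, HasGradientAt f (f' X) X) (hR : tsupport f ⊆ ball 0 R) (X : Space m k) :
    Tendsto (fun r => gradient (trunc u f r) X) atTop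
      (𝓝 ((ySet u ∩ ball 0 R).indicator f' X)) := by
  by_cases hX : X ∈ ySet u ∩ ball 0 R
  · rw [indicator_of_mem hX]
    refine tendsto_const_nhds.congr' ?_
    filter_upwards [eventually_cutoff (pow_pos (norm_pos_iff.2 hX.1) 2)] with r hr
    rw [gradient_trunc hu hX.1 (hf X hX.1), hr.1, hr.2]
    simp
  · rw [indicator_of_notMem hX]
    simp only [gradient_trunc_eq_zero hu hR _ hX]
    exact tendsto_const_nhds

/-- The dangerous term is `f` times the gradient of the cutoff. Since `|f| ≤ M |∇_y u|`, it is at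
most `2 M s |ρ'(s)|` times `|∇|∇_y u||`, with `s = |∇_y u|²` and `ρ` the cutoff, and `s ρ'(s)` is
bounded uniformly in `r`. -/
theorem exists_bound_gradient_trunc (hu : SolutionRegularity u)
    (hf : ∀ X ∈ ySet u, HasGradientAt f (f' X) X) (hR : tsupport f ⊆ ball 0 R)
    (hM0 : 0 ≤ M) (hM : ∀ X, |f X| ≤ M * ‖gradY u X‖)
    (hf' : MemLp ((ySet u ∩ ball 0 R).indicator f') 2) :
    ∃ G : Space m k → ℝ, MemLp G 2 ∧ ∀ r X, ‖gradient (trunc u f r) X‖ ≤ G X := by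
  obtain ⟨B, hB⟩ := exists_bound_mul_deriv_cutoff
  refine ⟨fun X => ‖(ySet u ∩ ball 0 R).indicator f' X‖ +
    2 * M * B * ‖(ySet u ∩ ball 0 R).indicator (normGrad u) X‖,
    hf'.norm.add ((hu.memLp_normGrad R).norm.const_mul _), fun r X => ?_⟩
  beta_reduce
  by_cases hX : X ∈ ySet u ∩ ball 0 R
  · rw [gradient_trunc hu hX.1 (hf X hX.1), indicator_of_mem hX, indicator_of_mem hX]
    refine (norm_add_le _ _).trans (add_le_add ?_ ?_)
    · rw [norm_smul, Real.norm_of_nonneg (cutoff_nonneg _ _)]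
      exact mul_le_of_le_one_left (norm_nonneg _) (cutoff_le_one _ _)
    · rw [norm_smul]
      refine mul_le_mul_of_nonneg_right ?_ (norm_nonneg _)
      have h1 := hB r (‖gradY u X‖ ^ 2)
      rw [Real.norm_eq_abs, abs_mul, abs_mul, abs_of_nonneg (by positivity : 0 ≤ 2 * ‖gradY u X‖)]
      rw [abs_mul, abs_of_nonneg (by positivity : 0 ≤ ‖gradY u X‖ ^ 2)] at h1
      calc |f X| * |deriv (cutoff r) (‖gradY u X‖ ^ 2)| * (2 * ‖gradY u X‖)
          ≤ M * ‖gradY u X‖ * |deriv (cutoff r) (‖gradY u X‖ ^ 2)| * (2 * ‖gradY u X‖) := by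
            gcongr; exact hM X
        _ = 2 * M * (‖gradY u X‖ ^ 2 * |deriv (cutoff r) (‖gradY u X‖ ^ 2)|) := by ring
        _ ≤ 2 * M * B := by gcongr
  · rw [gradient_trunc_eq_zero hu hR r hX, indicator_of_notMem hX, indicator_of_notMem hX]
    simp

end Trunc

section Limits

variable {a : Fin n → EuclideanSpace ℝ (Fin m) → ℝ → ℝ}
  {F : EuclideanSpace ℝ (Fin m) → (Fin n → ℝ) → ℝ} {u : Fin n → Space m k → ℝ}

/-- Stability may be tested with functions vanishing on `{∇_y uⁱ = 0}` that are `C¹` elsewhere. -/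
theorem IsStable.nonneg_of_ySet (hreg : ∀ i, SolutionRegularity (u i))
    (hstable : IsStable a F u) (hbdd : ∀ i, CoeffLocBounded (a i) (u i))
    {f : Fin n → Space m k → ℝ} {f' : Fin n → Space m k → Space m k} {R M : ℝ}
    (hfc : ∀ i, Continuous (f i))
    (hf : ∀ i, ∀ X ∈ ySet (u i), ContDiffAt ℝ 1 (f i) X)
    (hf' : ∀ i, ∀ X ∈ ySet (u i), HasGradientAt (f i) (f' i X) X)
    (hc : ∀ i, HasCompactSupport (f i)) (hR : ∀ i, tsupport (f i) ⊆ ball 0 R) (hM0 : 0 ≤ M)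
    (hM : ∀ i X, |f i X| ≤ M * ‖gradY (u i) X‖)
    (hL2 : ∀ i, MemLp ((ySet (u i) ∩ ball 0 R).indicator (f' i)) 2) :
    0 ≤ (∑ i, ∫ X, bil (coeffAt (a i) (u i) X) ((ySet (u i) ∩ ball 0 R).indicator (f' i) X)
        ((ySet (u i) ∩ ball 0 R).indicator (f' i) X)) -
      ∑ i, ∑ j, ∫ X, F2 F i j (xPart X) (fun l => u l X) * (f i X * f j X) := by
  have hT := fun i => contDiff_trunc (hreg i) (hf i)
  have hme : ∀ i r, AEStronglyMeasurable (gradient (trunc (u i) (f i) r)) := fun i r =>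
    (continuous_gradient (hT i r)).aestronglyMeasurable
  have t1 : ∀ i, Tendsto (fun r => ∫ X, bil (coeffAt (a i) (u i) X)
      (gradient (trunc (u i) (f i) r) X) (gradient (trunc (u i) (f i) r) X)) atTop
      (𝓝 (∫ X, bil (coeffAt (a i) (u i) X) ((ySet (u i) ∩ ball 0 R).indicator (f' i) X)
        ((ySet (u i) ∩ ball 0 R).indicator (f' i) X))) := fun i => by
    obtain ⟨G, hG, hGb⟩ := exists_bound_gradient_trunc (hreg i) (hf' i) (hR i) hM0 (hM i) (hL2 i)
    exact (hbdd i).tendsto_integral_bil (isOpen_regSet (hreg i).contDiff) (R := R) (hme i) (hme i)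
      (fun r X hX => gradient_trunc_eq_zero (hreg i) (hR i) r fun h =>
        hX ⟨ySet_subset_regSet _ h.1, h.2⟩) hG hG hGb hGb
      (tendsto_gradient_trunc (hreg i) (hf' i) (hR i))
      (tendsto_gradient_trunc (hreg i) (hf' i) (hR i))
  have t2 : ∀ i l, Tendsto (fun r => ∫ X, F2 F i l (xPart X) (fun l => u l X) *
      (trunc (u i) (f i) r X * trunc (u l) (f l) r X)) atTop
      (𝓝 (∫ X, F2 F i l (xPart X) (fun l => u l X) * (f i X * f l X))) := fun i l => by
    obtain ⟨B, hB⟩ := ((hfc i).mul (hfc l)).bounded_above_of_compact_support (hc i).mul_right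
    refine tendsto_integral_mul_of_integrableOn_ball (hstable.integrableOn_F2 i l R) (M := B)
      (fun r => ((hT i r).continuous.mul (hT l r).continuous).aestronglyMeasurable)
      (fun r X => ?_) (fun r X hX => ?_)
      (fun X => (tendsto_trunc (hM i) X).mul (tendsto_trunc (hM l) X))
    · rw [abs_mul]
      refine (mul_le_mul (abs_trunc_le r X) (abs_trunc_le r X) (abs_nonneg _)
        (abs_nonneg _)).trans ?_
      rw [← abs_mul]; exact hB X
    · rw [trunc, image_eq_zero_of_notMem_tsupport fun h => hX (hR i h), zero_mul, zero_mul]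
  refine ge_of_tendsto' ((tendsto_finsetSum _ fun i _ => t1 i).sub
    (tendsto_finsetSum _ fun i _ => tendsto_finsetSum _ fun l _ => t2 i l)) fun r => ?_
  exact hstable.nonneg_of_contDiff (fun i => (hreg i).contDiff) hbdd (fun i => hT i r)
    (fun i => (hc i).mono' ((subset_closure.trans (tsupport_trunc_subset r))))
    (fun i => (tsupport_trunc_subset_ySet (hreg i) r).trans (ySet_subset_regSet _))

/-- The linearized equation may be tested with functions vanishing on `{∇_y uⁱ = 0}` that are `C¹`
elsewhere. -/
theorem linearized_of_ySet (ha : CoeffAssumptions a) (hF : NonlinAssumptions F)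
    (hreg : ∀ i, SolutionRegularity (u i)) (hweak : IsWeakSolution a F u)
    (hstable : IsStable a F u) (hbdd : ∀ i, CoeffLocBounded (a i) (u i)) (i : Fin n) (j : Fin k)
    {f : Space m k → ℝ} {f' : Space m k → Space m k} {R M : ℝ} (hfc : Continuous f)
    (hf : ∀ X ∈ ySet (u i), ContDiffAt ℝ 1 f X)
    (hf' : ∀ X ∈ ySet (u i), HasGradientAt f (f' X) X)
    (hc : HasCompactSupport f) (hR : tsupport f ⊆ ball 0 R) (hM0 : 0 ≤ M)
    (hM : ∀ X, |f X| ≤ M * ‖gradY (u i) X‖)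
    (hL2 : MemLp ((ySet (u i) ∩ ball 0 R).indicator f') 2) :
    ∫ X, bil (coeffAt (a i) (u i) X) (hessCut (u i) (Sum.inr j) R X)
        ((ySet (u i) ∩ ball 0 R).indicator f' X) =
      ∑ l, ∫ X, F2 F i l (xPart X) (fun l => u l X) * (pd (u l) (Sum.inr j) X * f X) := by
  have hT := contDiff_trunc (hreg i) hf
  have hz : ∀ r, ∀ X ∉ regSet (u i) ∩ ball 0 R, gradient (trunc (u i) f r) X = 0 := fun r X hX =>
    gradient_trunc_eq_zero (hreg i) hR r fun h => hX ⟨ySet_subset_regSet _ h.1, h.2⟩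
  have t1 : Tendsto (fun r => ∫ X, bil (coeffAt (a i) (u i) X) (hessCut (u i) (Sum.inr j) R X)
      (gradient (trunc (u i) f r) X)) atTop
      (𝓝 (∫ X, bil (coeffAt (a i) (u i) X) (hessCut (u i) (Sum.inr j) R X)
        ((ySet (u i) ∩ ball 0 R).indicator f' X))) := by
    obtain ⟨G, hG, hGb⟩ := exists_bound_gradient_trunc (hreg i) hf' hR hM0 hM hL2
    have hmem := (hreg i).memLp_gradient_pd (Sum.inr j) R
    exact (hbdd i).tendsto_integral_bil (isOpen_regSet (hreg i).contDiff) (R := R)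
      (v := fun _ => hessCut (u i) (Sum.inr j) R) (fun _ => hmem.1)
      (fun r => (continuous_gradient (hT r)).aestronglyMeasurable)
      (fun _ X hX => indicator_of_notMem hX _) hmem.norm hG (fun _ _ => le_rfl) hGb
      (fun _ => tendsto_const_nhds) (tendsto_gradient_trunc (hreg i) hf' hR)
  have t2 : ∀ l, Tendsto (fun r => ∫ X, F2 F i l (xPart X) (fun l => u l X) *
      (pd (u l) (Sum.inr j) X * trunc (u i) f r X)) atTop
      (𝓝 (∫ X, F2 F i l (xPart X) (fun l => u l X) * (pd (u l) (Sum.inr j) X * f X))) := fun l => by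
    have hcl := continuous_pd (hreg l).contDiff (Sum.inr j)
    obtain ⟨B, hB⟩ := (hcl.mul hfc).bounded_above_of_compact_support hc.mul_left
    refine tendsto_integral_mul_of_integrableOn_ball (hstable.integrableOn_F2 i l R) (M := B)
      (fun r => (hcl.mul (hT r).continuous).aestronglyMeasurable)
      (fun r X => ?_) (fun r X hX => ?_) (fun X => (tendsto_trunc hM X).const_mul _)
    · rw [abs_mul]
      refine (mul_le_mul_of_nonneg_left (abs_trunc_le r X) (abs_nonneg _)).trans ?_
      rw [← abs_mul]; exact hB X
    · rw [trunc, image_eq_zero_of_notMem_tsupport fun h => hX (hR h), zero_mul, mul_zero]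
  refine tendsto_nhds_unique t1 ((tendsto_finsetSum _ fun l _ => t2 l).congr fun r => ?_)
  rw [← linearized_of_contDiff ha hF hreg hweak hstable hbdd i j (hT r)
    (hc.mono' ((subset_closure.trans (tsupport_trunc_subset r))))
    ((tsupport_trunc_subset_ySet (hreg i) r).trans (ySet_subset_regSet _))]
  exact integral_congr_ae (Eventually.of_forall fun X => (bil_hessCut _ (hz r X)).symm)

end Limits

end TruncatedTests

/-! ### The geometric Poincaré inequality. -/

section Poincare

/-- `∑_j ⟨𝒜∇u_{y_j}, ∇u_{y_j}⟩ - ⟨𝒜∇|∇_y u|, ∇|∇_y u|⟩` on `{∇_y u ≠ 0}`. -/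
def deficit (a : EuclideanSpace ℝ (Fin m) → ℝ → ℝ) (u : Space m k → ℝ) : Space m k → ℝ :=
  (ySet u).indicator fun X =>
    (∑ j, bil (coeffAt a u X) (gradient (pd u (Sum.inr j)) X) (gradient (pd u (Sum.inr j)) X)) -
      bil (coeffAt a u X) (normGrad u X) (normGrad u X)

theorem exists_bound_test {φ : Space m k → ℝ} (hφ : IsTest φ) :
    ∃ M : ℝ, 0 ≤ M ∧ (∀ X, |φ X| ≤ M) ∧ ∀ X, ‖gradient φ X‖ ≤ M := by
  obtain ⟨M₁, h₁⟩ := hφ.1.continuous.bounded_above_of_compact_support hφ.2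
  obtain ⟨M₂, h₂⟩ := (continuous_gradient hφ.contDiff_one).bounded_above_of_compact_support
    (hφ.2.mono' (subset_closure.trans (tsupport_gradient_subset φ)))
  exact ⟨max M₁ M₂, (norm_nonneg (φ 0)).trans ((h₁ 0).trans (le_max_left _ _)),
    fun X => (h₁ X).trans (le_max_left _ _), fun X => (h₂ X).trans (le_max_right _ _)⟩

theorem IsTest.hasGradientAt {φ : Space m k → ℝ} (hφ : IsTest φ) (X : Space m k) :
    HasGradientAt φ (gradient φ X) X :=
  (hφ.1.differentiable (by simp) X).hasGradientAt

/-- The pointwise identity behind the geometric Poincaré inequality. -/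
theorem bil_poincare_identity {a : EuclideanSpace ℝ (Fin m) → ℝ → ℝ} {u : Space m k → ℝ}
    (X v : Space m k) (s c : ℝ) (hs : s ^ 2 = 1) :
    bil (coeffAt a u X) (s • (‖gradY u X‖ • v + c • normGrad u X))
        (s • (‖gradY u X‖ • v + c • normGrad u X)) -
      ∑ j, bil (coeffAt a u X) (gradient (pd u (Sum.inr j)) X)
        (c ^ 2 • gradient (pd u (Sum.inr j)) X + (2 * pd u (Sum.inr j) X * c) • v) =
    ‖gradY u X‖ ^ 2 * bil (coeffAt a u X) v v - c ^ 2 *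
      ((∑ j, bil (coeffAt a u X) (gradient (pd u (Sum.inr j)) X) (gradient (pd u (Sum.inr j)) X)) -
      bil (coeffAt a u X) (normGrad u X) (normGrad u X)) := by
  -- Here `v`, `c` and `s` stand for `∇φ`, `φ` and the sign `σ_i`. The mixed terms of the two
  -- expansions agree because `∑_j u_{y_j} ∇u_{y_j} = |∇_y u| ∇|∇_y u|`, and they cancel.
  have h1 : ∑ j, pd u (Sum.inr j) X * bil (coeffAt a u X) (gradient (pd u (Sum.inr j)) X) v =
      ‖gradY u X‖ * bil (coeffAt a u X) (normGrad u X) v := by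
    rw [← bil_smul_left, norm_smul_normGrad, bil_sum_left]
    exact Finset.sum_congr rfl fun j _ => (bil_smul_left _ _ _ _).symm
  have h2 : ∑ j, bil (coeffAt a u X) (gradient (pd u (Sum.inr j)) X)
        (c ^ 2 • gradient (pd u (Sum.inr j)) X + (2 * pd u (Sum.inr j) X * c) • v) =
      c ^ 2 * (∑ j, bil (coeffAt a u X) (gradient (pd u (Sum.inr j)) X)
        (gradient (pd u (Sum.inr j)) X)) +
      2 * c * (‖gradY u X‖ * bil (coeffAt a u X) (normGrad u X) v) := by
    rw [← h1, Finset.mul_sum, Finset.mul_sum, ← Finset.sum_add_distrib]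
    refine Finset.sum_congr rfl fun j _ => ?_
    rw [bil_add_right, bil_smul_right, bil_smul_right]; ring
  rw [h2]
  simp only [bil_smul_left, bil_smul_right, bil_add_left, bil_add_right]
  rw [bil_comm _ v (normGrad u X) (coeffAt_symm a u X)]
  linear_combination (‖gradY u X‖ ^ 2 * bil (coeffAt a u X) v v +
    2 * ‖gradY u X‖ * c * bil (coeffAt a u X) (normGrad u X) v +
    c ^ 2 * bil (coeffAt a u X) (normGrad u X) (normGrad u X)) * hs

variable {a : Fin n → EuclideanSpace ℝ (Fin m) → ℝ → ℝ}
  {F : EuclideanSpace ℝ (Fin m) → (Fin n → ℝ) → ℝ} {u : Fin n → Space m k → ℝ}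

/-- Geometric Poincaré inequality. The numbers `σ i` are the signs of the functions `θⁱ`. -/
theorem geometric_poincare (ha : CoeffAssumptions a) (hF : NonlinAssumptions F)
    (hreg : ∀ i, SolutionRegularity (u i)) (hweak : IsWeakSolution a F u)
    (hstable : IsStable a F u) (hbdd : ∀ i, CoeffLocBounded (a i) (u i))
    {σ : Fin n → ℝ} (hσ : ∀ i, σ i ^ 2 = 1)
    (hσF : ∀ i j, i ≠ j → ∀ X : Space m k,
      0 ≤ F2 F i j (xPart X) (fun l => u l X) * (σ i * σ j))
    {φ : Space m k → ℝ} (hφ : IsTest φ) :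
    (∀ i, Integrable fun X => φ X ^ 2 * deficit (a i) (u i) X) ∧
    (∀ i, Integrable fun X => ‖gradY (u i) X‖ ^ 2 *
      bil (coeffAt (a i) (u i) X) (gradient φ X) (gradient φ X)) ∧
    ∑ i, ∫ X, φ X ^ 2 * deficit (a i) (u i) X ≤
      ∑ i, ∫ X, ‖gradY (u i) X‖ ^ 2 *
        bil (coeffAt (a i) (u i) X) (gradient φ X) (gradient φ X) := by
  obtain ⟨R, hR⟩ := exists_tsupport_subset_ball hφ.2
  obtain ⟨M, hM0, hM, hM'⟩ := exists_bound_test hφ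
  choose B hB using fun i => (hreg i).bounded_gradient
  have hB0 : ∀ i, 0 ≤ B i := fun i => (norm_nonneg _).trans (hB i 0)
  have hw : ∀ i X, ‖gradY (u i) X‖ ≤ B i := fun i X => (norm_gradY_le _ X).trans (hB i X)
  have hD : ∀ i j X, |pd (u i) (Sum.inr j) X| ≤ B i := fun i j X =>
    (abs_pd_le_norm_gradY _ X j).trans (hw i X)
  have hφ0 : ∀ X, X ∉ ball (0 : Space m k) R → φ X = 0 := fun X hX =>
    image_eq_zero_of_notMem_tsupport fun h => hX (hR h)
  have hgφ0 : ∀ X, X ∉ ball (0 : Space m k) R → gradient φ X = 0 := fun X hX =>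
    gradient_eq_zero_of_notMem_tsupport fun h => hX (hR h)
  have hcg := continuous_gradient hφ.contDiff_one
  have hcw : ∀ i, Continuous fun X => ‖gradY (u i) X‖ := fun i =>
    (continuous_gradY (hreg i).contDiff).norm
  have hcD : ∀ i j, Continuous (pd (u i) (Sum.inr j)) := fun i j =>
    continuous_pd (hreg i).contDiff _
  have hσ1 : ∀ i, |σ i| = 1 := fun i => by
    have := hσ i
    rw [← sq_abs] at this
    exact (pow_eq_one_iff_of_nonneg (abs_nonneg _) two_ne_zero).1 this
  have hφ2 : HasCompactSupport fun X => φ X ^ 2 :=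
    hφ.2.comp_left (g := fun t : ℝ => t ^ 2) (by simp)
  -- the two test functions and their gradients
  let f : Fin n → Space m k → ℝ := fun i X => σ i * (‖gradY (u i) X‖ * φ X)
  let f' : Fin n → Space m k → Space m k := fun i X =>
    σ i • (‖gradY (u i) X‖ • gradient φ X + φ X • normGrad (u i) X)
  let g : Fin n → Fin k → Space m k → ℝ := fun i j X => φ X ^ 2 * pd (u i) (Sum.inr j) X
  let g' : Fin n → Fin k → Space m k → Space m k := fun i j X =>
    φ X ^ 2 • gradient (pd (u i) (Sum.inr j)) X +
      (2 * pd (u i) (Sum.inr j) X * φ X) • gradient φ X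
  have hfL2 : ∀ i, MemLp ((ySet (u i) ∩ ball 0 R).indicator (f' i)) 2 := fun i => by
    refine (hreg i).memLp_indicator (b := B i * M) (c := M) ?_ fun X hX => ?_
    · exact ((hcw i).smul hcg).continuousOn.fun_add
        (hφ.1.continuous.continuousOn.fun_smul (hreg i).continuousOn_normGrad) |>.const_smul (σ i)
    · rw [norm_smul, Real.norm_eq_abs, hσ1, one_mul]
      refine (norm_add_le _ _).trans (add_le_add ?_ ?_)
      · rw [norm_smul, norm_norm]
        exact mul_le_mul (hw i X) (hM' X) (norm_nonneg _) (hB0 i)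
      · rw [norm_smul]
        exact mul_le_mul (hM X) (norm_normGrad_le _ X) (norm_nonneg _) hM0
  have hgL2 : ∀ i j, MemLp ((ySet (u i) ∩ ball 0 R).indicator (g' i j)) 2 := fun i j => by
    refine (hreg i).memLp_indicator (b := 2 * B i * M * M) (c := M ^ 2) ?_ fun X hX => ?_
    · exact ((hφ.1.continuous.pow 2).continuousOn.fun_smul
        ((hreg i).continuousOn_gradient_pd _)).fun_add
        (((continuous_const.mul (hcD i j)).mul hφ.1.continuous).smul hcg).continuousOn
    · rw [add_comm (2 * B i * M * M)]
      refine (norm_add_le _ _).trans (add_le_add ?_ ?_)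
      · rw [norm_smul, norm_pow]
        refine mul_le_mul (pow_le_pow_left₀ (norm_nonneg _) (hM X) 2) ?_ (norm_nonneg _)
          (by positivity)
        exact Finset.single_le_sum (f := fun j => ‖gradient (pd (u i) (Sum.inr j)) X‖)
          (fun _ _ => norm_nonneg _) (Finset.mem_univ j)
      · rw [norm_smul, norm_mul, norm_mul, Real.norm_ofNat]
        have := hB0 i
        gcongr
        · exact hD i j X
        · exact hM X
        · exact hM' X
  have stab := hstable.nonneg_of_ySet hreg hbdd (f := f) (f' := f') (R := R) (M := M)
    (fun i => continuous_const.mul ((hcw i).mul hφ.1.continuous))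
    (fun i X hX => contDiffAt_const.mul
      (((hreg i).contDiffAt_norm hX).mul hφ.contDiff_one.contDiffAt))
    (fun i X hX => by
      simpa [f'] using (hasGradientAt_const X (σ i)).mul_real
        (((hreg i).hasGradientAt_norm hX).mul_real (hφ.hasGradientAt X)))
    (fun i => hφ.2.mul_left.mul_left)
    (fun i => (closure_mono ((Function.support_mul_subset_right _ _).trans
      (Function.support_mul_subset_right _ _))).trans hR) hM0
    (fun i X => by
      rw [abs_mul, hσ1, one_mul, abs_mul, abs_norm, mul_comm]
      exact mul_le_mul_of_nonneg_right (hM X) (norm_nonneg _)) hfL2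
  have lin : ∀ i j, _ := fun i j =>
    linearized_of_ySet ha hF hreg hweak hstable hbdd i j (f := g i j) (f' := g' i j) (R := R)
    (M := M ^ 2) ((hφ.1.continuous.pow 2).mul (hcD i j))
    (fun X hX => (hφ.contDiff_one.contDiffAt.pow 2).mul ((hreg i).contDiffAt_pd hX _))
    (fun X hX => by
      have h1 := HasGradientAt.scomp_real (hasDerivAt_pow 2 (φ X)) (hφ.hasGradientAt X)
      have h2 := h1.mul_real ((hreg i).hasGradientAt_pd hX (Sum.inr j))
      convert! h2 using 1
      change φ X ^ 2 • _ + (2 * pd (u i) (Sum.inr j) X * φ X) • gradient φ X = _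
      rw [smul_smul]
      congr 2
      simp only [Nat.cast_ofNat, Nat.add_one_sub_one, pow_one]
      ring)
    (hφ2.mul_right)
    ((closure_mono ((Function.support_mul_subset_left _ _).trans
      (Function.support_pow φ two_ne_zero).subset)).trans hR) (by positivity)
    (fun X => by
      rw [abs_mul, abs_pow]
      exact mul_le_mul (pow_le_pow_left₀ (abs_nonneg _) (hM X) 2) (abs_pd_le_norm_gradY _ X j)
        (abs_nonneg _) (by positivity)) (hgL2 i j)
  -- The identity holds at every point: on `{∇_y u = 0}` the deficit and the weight `|∇_y u|²` both
  -- vanish, and outside the ball `φ` and `∇φ` do.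
  have id : ∀ i X, bil (coeffAt (a i) (u i) X) ((ySet (u i) ∩ ball 0 R).indicator (f' i) X)
        ((ySet (u i) ∩ ball 0 R).indicator (f' i) X) -
      ∑ j, bil (coeffAt (a i) (u i) X) (hessCut (u i) (Sum.inr j) R X)
        ((ySet (u i) ∩ ball 0 R).indicator (g' i j) X) =
      ‖gradY (u i) X‖ ^ 2 * bil (coeffAt (a i) (u i) X) (gradient φ X) (gradient φ X) -
        φ X ^ 2 * deficit (a i) (u i) X := by
    intro i X
    by_cases hX : X ∈ ySet (u i) ∩ ball 0 R
    · have hX' : X ∈ regSet (u i) ∩ ball 0 R := ⟨ySet_subset_regSet _ hX.1, hX.2⟩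
      simp only [indicator_of_mem hX, indicator_of_mem hX', hessCut, deficit, indicator_of_mem hX.1]
      exact bil_poincare_identity X (gradient φ X) (σ i) (φ X) (hσ i)
    · simp only [indicator_of_notMem hX, bil_zero_right, Finset.sum_const_zero, sub_zero]
      by_cases hXb : X ∈ ball (0 : Space m k) R
      · have hXy : X ∉ ySet (u i) := fun h => hX ⟨h, hXb⟩
        simp [deficit, indicator_of_notMem hXy, norm_gradY_eq_zero_of_notMem_ySet hXy]
      · simp [hφ0 X hXb, hgφ0 X hXb, bil_zero_right]
  have hoff : ∀ i, ∀ X ∉ regSet (u i) ∩ ball 0 R, X ∉ ySet (u i) ∩ ball 0 R := fun i X hX h =>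
    hX ⟨ySet_subset_regSet _ h.1, h.2⟩
  have hU := fun i => isOpen_regSet (hreg i).contDiff
  have i1 : ∀ i, Integrable fun X => bil (coeffAt (a i) (u i) X)
      ((ySet (u i) ∩ ball 0 R).indicator (f' i) X)
      ((ySet (u i) ∩ ball 0 R).indicator (f' i) X) := fun i =>
    (hbdd i).integrable_bil (hU i) (R := R) (hfL2 i) (hfL2 i)
      fun X hX => indicator_of_notMem (hoff i X hX) _
  have i2 : ∀ i j, Integrable fun X => bil (coeffAt (a i) (u i) X)
      (hessCut (u i) (Sum.inr j) R X) ((ySet (u i) ∩ ball 0 R).indicator (g' i j) X) := fun i j =>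
    (hbdd i).integrable_bil (hU i) (R := R) ((hreg i).memLp_gradient_pd (Sum.inr j) R) (hgL2 i j)
      fun X hX => indicator_of_notMem hX _
  have i3 : ∀ i, Integrable fun X => ‖gradY (u i) X‖ ^ 2 *
      bil (coeffAt (a i) (u i) X) (gradient φ X) (gradient φ X) := fun i => by
    have hm : MemLp (fun X => ‖gradY (u i) X‖ • gradient φ X) 2 :=
      ((hcw i).smul hcg).memLp_of_hasCompactSupport
        ((hφ.2.mono' (subset_closure.trans (tsupport_gradient_subset φ))).smul_left)
    refine ((hbdd i).integrable_bil (hU i) (R := R) hm hm fun X hX => ?_).congr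
      (Eventually.of_forall fun X => ?_)
    · by_cases hXb : X ∈ ball (0 : Space m k) R
      · have hXy : X ∉ ySet (u i) := fun h => hoff i X hX ⟨h, hXb⟩
        rw [norm_gradY_eq_zero_of_notMem_ySet hXy, zero_smul]
      · rw [hgφ0 X hXb, smul_zero]
    · simp only [bil_smul_left, bil_smul_right]; ring
  -- Integrability of the deficit term is read off from the pointwise identity, whose other terms
  -- are already known to be integrable.
  have i4 : ∀ i, Integrable fun X => φ X ^ 2 * deficit (a i) (u i) X := fun i => by
    refine ((i3 i).sub ((i1 i).sub (integrable_finsetSum Finset.univ fun j _ => i2 i j))).congr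
      (Eventually.of_forall fun X => ?_)
    have := id i X
    simp only [Pi.sub_apply]
    linarith
  refine ⟨i4, i3, ?_⟩
  have e1 : ∀ i, (∫ X, bil (coeffAt (a i) (u i) X) ((ySet (u i) ∩ ball 0 R).indicator (f' i) X)
        ((ySet (u i) ∩ ball 0 R).indicator (f' i) X)) -
      ∑ j, ∫ X, bil (coeffAt (a i) (u i) X) (hessCut (u i) (Sum.inr j) R X)
        ((ySet (u i) ∩ ball 0 R).indicator (g' i j) X) =
      (∫ X, ‖gradY (u i) X‖ ^ 2 * bil (coeffAt (a i) (u i) X) (gradient φ X) (gradient φ X)) -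
        ∫ X, φ X ^ 2 * deficit (a i) (u i) X := fun i => by
    rw [← integral_finsetSum _ fun j _ => i2 i j, ← integral_sub (i1 i)
      (integrable_finsetSum _ fun j _ => i2 i j), ← integral_sub (i3 i) (i4 i)]
    exact integral_congr_ae (Eventually.of_forall fun X => id i X)
  have iF : ∀ i l (ψ : Space m k → ℝ), Continuous ψ → Integrable fun X =>
      F2 F i l (xPart X) (fun l => u l X) * (φ X ^ 2 * ψ X) := fun i l ψ hψ => by
    have hc : Continuous fun X => φ X ^ 2 * ψ X := (hφ.1.continuous.pow 2).mul hψ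
    obtain ⟨C, hC⟩ := hc.bounded_above_of_compact_support (hφ2.mul_right)
    exact integrable_mul_of_integrableOn_ball (hstable.integrableOn_F2 i l R)
      hc.aestronglyMeasurable hC fun X hX => by simp [hφ0 X hX]
  -- The only place where the system structure enters. The integrands agree for `i = l`; for `i ≠ l`
  -- the difference is `F_{il} σ_i σ_l` times a Cauchy-Schwarz defect times `φ²`.
  have e2 : ∀ i l, ∑ j, ∫ X, F2 F i l (xPart X) (fun l => u l X) *
      (pd (u l) (Sum.inr j) X * g i j X) ≤
      ∫ X, F2 F i l (xPart X) (fun l => u l X) * (f i X * f l X) := fun i l => by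
    have c1 : ∀ j X, F2 F i l (xPart X) (fun l => u l X) * (pd (u l) (Sum.inr j) X * g i j X) =
        F2 F i l (xPart X) (fun l => u l X) *
          (φ X ^ 2 * (pd (u l) (Sum.inr j) X * pd (u i) (Sum.inr j) X)) := fun j X => by
      simp only [g]; ring
    have c2 : ∀ X, F2 F i l (xPart X) (fun l => u l X) * (f i X * f l X) =
        F2 F i l (xPart X) (fun l => u l X) *
          (φ X ^ 2 * (σ i * σ l * (‖gradY (u i) X‖ * ‖gradY (u l) X‖))) := fun X => by
      simp only [f]; ring
    simp only [c1, c2]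
    have ic : ∀ j, Integrable fun X => F2 F i l (xPart X) (fun l => u l X) *
        (φ X ^ 2 * (pd (u l) (Sum.inr j) X * pd (u i) (Sum.inr j) X)) := fun j =>
      iF i l _ ((hcD l j).mul (hcD i j))
    rw [← integral_finsetSum _ fun j _ => ic j]
    refine integral_mono (integrable_finsetSum _ fun j _ => ic j)
      (iF i l _ (continuous_const.mul ((hcw i).mul (hcw l)))) fun X => ?_
    have hin : ∑ j, pd (u l) (Sum.inr j) X * pd (u i) (Sum.inr j) X =
        inner ℝ (gradY (u i) X) (gradY (u l) X) := by
      rw [PiLp.inner_apply]; simp [gradY_apply]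
    beta_reduce
    rw [← Finset.mul_sum, ← Finset.mul_sum, hin]
    by_cases hil : i = l
    · subst hil
      rw [real_inner_self_eq_norm_sq, ← sq, hσ i, one_mul, sq ‖gradY (u i) X‖]
    · have h1 := hσF i l hil X
      have h2 := abs_real_inner_le_norm (gradY (u i) X) (gradY (u l) X)
      have h3 : σ i * σ l * inner ℝ (gradY (u i) X) (gradY (u l) X) ≤
          ‖gradY (u i) X‖ * ‖gradY (u l) X‖ := by
        refine (le_abs_self _).trans ?_
        rw [abs_mul, abs_mul, hσ1, hσ1, one_mul, one_mul]
        exact h2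
      have h4 : (σ i * σ l) ^ 2 = 1 := by rw [mul_pow, hσ, hσ, one_mul]
      have h5 := mul_nonneg (mul_nonneg h1 (sub_nonneg.2 h3)) (sq_nonneg (φ X))
      rw [← sub_nonneg]
      -- Since `(σ_i σ_l)² = 1`, the sign factor inside the defect disappears from the inner product
      -- and stays on the product of norms.
      refine h5.trans_eq ?_
      linear_combination (-(F2 F i l (xPart X) fun l => u l X) *
        inner ℝ (gradY (u i) X) (gradY (u l) X) * φ X ^ 2) * h4
  have e3 : ∑ i, ∑ j, ∫ X, bil (coeffAt (a i) (u i) X) (hessCut (u i) (Sum.inr j) R X)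
        ((ySet (u i) ∩ ball 0 R).indicator (g' i j) X) ≤
      ∑ i, ∑ l, ∫ X, F2 F i l (xPart X) (fun l => u l X) * (f i X * f l X) := by
    refine Finset.sum_le_sum fun i _ => ?_
    rw [Finset.sum_congr rfl fun j _ => lin i j, Finset.sum_comm]
    exact Finset.sum_le_sum fun l _ => e2 i l
  -- Stability bounds the `F`-terms from above by the quadratic terms in `f'`, and `e3` bounds them
  -- from below by the linearized terms. By the summed identity, the difference of these two bounds
  -- is the right side minus the left side of the claim.
  have e4 := Finset.sum_congr (rfl : (Finset.univ : Finset (Fin n)) = Finset.univ)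
    fun i _ => e1 i
  rw [Finset.sum_sub_distrib, Finset.sum_sub_distrib] at e4
  linarith

end Poincare

/-! ### Eigenvalues of `𝒜`, a rank-one perturbation of a multiple of the identity. -/

section Eigenvalues

variable (a : EuclideanSpace ℝ (Fin m) → ℝ → ℝ) (x : EuclideanSpace ℝ (Fin m)) {η : Space m k}

theorem coeffMatrix_mulVec (η : Space m k) (v : Space m k) (p : Fin m ⊕ Fin k) :
    (coeffMatrix a x η).mulVec (fun q => v q) p =
      a x ‖η‖ * v p + deriv (a x) ‖η‖ / ‖η‖ * inner ℝ η v * η p := by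
  simp only [Matrix.mulVec, dotProduct, coeffMatrix, Matrix.of_apply, add_mul,
    Finset.sum_add_distrib]
  congr 1
  · simp
  · rw [PiLp.inner_apply, Finset.mul_sum, Finset.sum_mul]
    refine Finset.sum_congr rfl fun q _ => ?_
    simp only [RCLike.inner_apply, conj_trivial]
    ring

theorem bil_coeffMatrix (η v w : Space m k) :
    bil (coeffMatrix a x η) v w =
      a x ‖η‖ * inner ℝ v w + deriv (a x) ‖η‖ / ‖η‖ * inner ℝ η v * inner ℝ η w := by
  have h : bil (coeffMatrix a x η) v w =
      ∑ p, (coeffMatrix a x η).mulVec (fun q => v q) p * w p := by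
    simp only [bil, Matrix.mulVec, dotProduct, Finset.sum_mul]
  simp only [h, coeffMatrix_mulVec, add_mul, Finset.sum_add_distrib, PiLp.inner_apply (𝕜 := ℝ) v w,
    PiLp.inner_apply (𝕜 := ℝ) η w, Finset.mul_sum, RCLike.inner_apply, conj_trivial]
  congr 1 <;> exact Finset.sum_congr rfl fun p _ => by ring

/-- Each of the two blocks has a coordinate, so `N ≥ 2`, and an orthogonal vector exists in the
plane of one coordinate from each block. -/
theorem exists_orthogonal_ne_zero (hm : 1 ≤ m) (hk : 1 ≤ k) (η : Space m k) :
    ∃ v : Space m k, v ≠ 0 ∧ inner ℝ η v = 0 := by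
  let p : Fin m ⊕ Fin k := Sum.inl ⟨0, hm⟩
  let q : Fin m ⊕ Fin k := Sum.inr ⟨0, hk⟩
  have hpq : p ≠ q := Sum.inl_ne_inr
  by_cases h : η p = 0
  · refine ⟨EuclideanSpace.single p 1, by simp, ?_⟩
    rw [EuclideanSpace.inner_single_right]; simp [h]
  · refine ⟨η q • EuclideanSpace.single p 1 - η p • EuclideanSpace.single q 1, fun h0 => h ?_, ?_⟩
    · have := congrArg (fun z : Space m k => z q) h0
      simpa [hpq.symm] using this
    · rw [inner_sub_right, inner_smul_right, inner_smul_right, EuclideanSpace.inner_single_right,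
        EuclideanSpace.inner_single_right]
      simp; ring

/-- The hyperplane `η^⊥` carries the eigenvalue `a`, and `η` itself the eigenvalue `a + a' |η|`.
Conversely, pairing the eigenvector equation with `η` leaves only these two. -/
theorem hasEigenvalue_coeffMatrix_iff (hm : 1 ≤ m) (hk : 1 ≤ k) (hη : η ≠ 0) (μ : ℝ) :
    Module.End.HasEigenvalue (Matrix.toLin' (coeffMatrix a x η)) μ ↔
      μ = a x ‖η‖ ∨ μ = a x ‖η‖ + deriv (a x) ‖η‖ * ‖η‖ := by
  have hn : ‖η‖ ≠ 0 := norm_ne_zero_iff.2 hη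
  have hvec : ∀ (v : Space m k) (ν : ℝ), v ≠ 0 →
      (∀ p, (coeffMatrix a x η).mulVec (fun q => v q) p = ν * v p) →
      Module.End.HasEigenvalue (Matrix.toLin' (coeffMatrix a x η)) ν := by
    intro v ν hv h
    refine Module.End.hasEigenvalue_of_hasEigenvector (x := fun q => v q)
      (Module.End.hasEigenvector_iff.2 ⟨Module.End.mem_eigenspace_iff.2 ?_, fun h0 => hv ?_⟩)
    · ext p
      rw [Matrix.toLin'_apply, h p]; rfl
    · ext p; exact congrFun h0 p
  constructor
  · intro h
    obtain ⟨v, hv⟩ := h.exists_hasEigenvector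
    obtain ⟨h1, h2⟩ := Module.End.hasEigenvector_iff.1 hv
    rw [Module.End.mem_eigenspace_iff, Matrix.toLin'_apply] at h1
    let w : Space m k := WithLp.toLp 2 v
    have h3 : ∀ p, a x ‖η‖ * w p + deriv (a x) ‖η‖ / ‖η‖ * inner ℝ η w * η p = μ * w p :=
      fun p => by
        rw [← coeffMatrix_mulVec]
        exact congrFun h1 p
    have h4 : (a x ‖η‖ - μ) • w + (deriv (a x) ‖η‖ / ‖η‖ * inner ℝ η w) • η = 0 := by
      ext p
      have := h3 p
      simp only [PiLp.add_apply, PiLp.smul_apply, smul_eq_mul, PiLp.zero_apply]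
      linarith
    have h5 := congrArg (fun z => inner ℝ η z) h4
    simp only [inner_add_right, inner_smul_right, inner_zero_right,
      real_inner_self_eq_norm_sq] at h5
    have h6 : (a x ‖η‖ + deriv (a x) ‖η‖ * ‖η‖ - μ) * inner ℝ η w = 0 := by
      rw [← h5]; field_simp; ring
    rcases mul_eq_zero.1 h6 with h7 | h7
    · right; linarith
    · left
      rw [h7, mul_zero, zero_smul, add_zero] at h4
      rcases smul_eq_zero.1 h4 with h8 | h8
      · linarith
      · exact absurd (congrArg (fun z : Space m k => fun p => z p) h8) h2
  · rintro (rfl | rfl)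
    · obtain ⟨v, hv, hv'⟩ := exists_orthogonal_ne_zero hm hk η
      exact hvec v _ hv fun p => by rw [coeffMatrix_mulVec, hv']; ring
    · refine hvec η _ hη fun p => ?_
      rw [coeffMatrix_mulVec, real_inner_self_eq_norm_sq]
      field_simp

theorem maxEigenvalue_coeffMatrix (hm : 1 ≤ m) (hk : 1 ≤ k) (hη : η ≠ 0) :
    maxEigenvalue (coeffMatrix a x η) =
      max (a x ‖η‖) (a x ‖η‖ + deriv (a x) ‖η‖ * ‖η‖) := by
  have : {μ : ℝ | Module.End.HasEigenvalue (Matrix.toLin' (coeffMatrix a x η)) μ} =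
      {a x ‖η‖, a x ‖η‖ + deriv (a x) ‖η‖ * ‖η‖} := by
    ext μ
    exact hasEigenvalue_coeffMatrix_iff a x hm hk hη μ
  rw [maxEigenvalue, this, csSup_pair]

/-- For `∂_t a ≤ 0` the rank-one term is dropped, otherwise it is estimated by Cauchy-Schwarz; the
two cases give the two explicit eigenvalues. -/
theorem bil_le_maxEigenvalue (hm : 1 ≤ m) (hk : 1 ≤ k) (hη : η ≠ 0) (v : Space m k) :
    bil (coeffMatrix a x η) v v ≤ maxEigenvalue (coeffMatrix a x η) * ‖v‖ ^ 2 := by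
  have hn : 0 < ‖η‖ := norm_pos_iff.2 hη
  rw [maxEigenvalue_coeffMatrix a x hm hk hη, bil_coeffMatrix, real_inner_self_eq_norm_sq]
  have hcs : inner ℝ η v * inner ℝ η v ≤ (‖η‖ * ‖v‖) ^ 2 := by
    rw [← sq, ← sq_abs]
    exact pow_le_pow_left₀ (abs_nonneg _) (abs_real_inner_le_norm η v) 2
  rcases le_or_gt (deriv (a x) ‖η‖) 0 with h | h
  · refine le_trans ?_ (mul_le_mul_of_nonneg_right (le_max_left _ _) (sq_nonneg _))
    have : deriv (a x) ‖η‖ / ‖η‖ * (inner ℝ η v * inner ℝ η v) ≤ 0 :=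
      mul_nonpos_of_nonpos_of_nonneg (div_nonpos_of_nonpos_of_nonneg h hn.le) (mul_self_nonneg _)
    linarith
  · refine le_trans ?_ (mul_le_mul_of_nonneg_right (le_max_right _ _) (sq_nonneg _))
    have : deriv (a x) ‖η‖ / ‖η‖ * (inner ℝ η v * inner ℝ η v) ≤
        deriv (a x) ‖η‖ / ‖η‖ * (‖η‖ * ‖v‖) ^ 2 :=
      mul_le_mul_of_nonneg_left hcs (by positivity)
    have e : deriv (a x) ‖η‖ / ‖η‖ * (‖η‖ * ‖v‖) ^ 2 = deriv (a x) ‖η‖ * ‖η‖ * ‖v‖ ^ 2 := by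
      field_simp
    linarith

theorem bil_pos_of_posDef {A : Matrix (Fin m ⊕ Fin k) (Fin m ⊕ Fin k) ℝ} (hA : A.PosDef)
    {v : Space m k} (hv : v ≠ 0) : 0 < bil A v v := by
  have h := hA.dotProduct_mulVec_pos (x := fun p => v p) fun h0 => hv (by
    ext p; exact congrFun h0 p)
  have e : bil A v v = star (fun p => v p) ⬝ᵥ A.mulVec (fun p => v p) := by
    simp only [bil, dotProduct, Matrix.mulVec, Finset.mul_sum, star_trivial]
    exact Finset.sum_congr rfl fun p _ => Finset.sum_congr rfl fun q _ => by ring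
  rwa [e]

theorem bil_nonneg_of_posDef {A : Matrix (Fin m ⊕ Fin k) (Fin m ⊕ Fin k) ℝ} (hA : A.PosDef)
    (v : Space m k) : 0 ≤ bil A v v := by
  by_cases hv : v = 0
  · rw [hv, bil_zero_left]
  · exact (bil_pos_of_posDef hA hv).le

end Eigenvalues

/-! ### The energy density: integrability and domination of the Poincaré weight. -/

section Energy

variable {a : EuclideanSpace ℝ (Fin m) → ℝ → ℝ} {u : Space m k → ℝ}

/-- The energy density `𝒜̄ |∇u|²`. -/
def energy (a : EuclideanSpace ℝ (Fin m) → ℝ → ℝ) (u : Space m k → ℝ) (X : Space m k) : ℝ :=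
  maxEigenvalue (coeffAt a u X) * ‖gradient u X‖ ^ 2

theorem bil_single_single (A : Matrix (Fin m ⊕ Fin k) (Fin m ⊕ Fin k) ℝ) (p : Fin m ⊕ Fin k) :
    bil A (EuclideanSpace.single p 1) (EuclideanSpace.single p 1) = A p p := by
  simp [bil]

/-- This makes the energy visibly measurable and locally integrable. With `η = ∇u`, the form at `η`
is `(a + a' |η|) |η|²`, while `|η|² tr 𝒜` exceeds it by `(N - 1) a |η|²`; the vector fields involved
vanish where `∇u` does. -/
theorem energy_eq_max (hm : 1 ≤ m) (hk : 1 ≤ k) (a : EuclideanSpace ℝ (Fin m) → ℝ → ℝ)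
    (u : Space m k → ℝ) (X : Space m k) :
    energy a u X = max
      (((∑ p, bil (coeffAt a u X) (‖gradient u X‖ • EuclideanSpace.single p 1)
        (‖gradient u X‖ • EuclideanSpace.single p 1)) -
        bil (coeffAt a u X) (gradient u X) (gradient u X)) / (m + k - 1))
      (bil (coeffAt a u X) (gradient u X) (gradient u X)) := by
  by_cases hX : gradient u X = 0
  · simp [energy, hX, bil_zero_left]
  have hn : ‖gradient u X‖ ≠ 0 := norm_ne_zero_iff.2 hX
  set η := gradient u X with hη
  have hmk : ((m : ℝ) + k - 1) ≠ 0 := by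
    have h1 : (1 : ℝ) ≤ m := by exact_mod_cast hm
    have h2 : (1 : ℝ) ≤ k := by exact_mod_cast hk
    have : (0 : ℝ) < m + k - 1 := by linarith
    exact this.ne'
  have hq : bil (coeffAt a u X) η η =
      (a (xPart X) ‖η‖ + deriv (a (xPart X)) ‖η‖ * ‖η‖) * ‖η‖ ^ 2 := by
    rw [coeffAt, ← hη, bil_coeffMatrix, real_inner_self_eq_norm_sq]
    field_simp
  have ht : ∑ p, bil (coeffAt a u X) (‖η‖ • EuclideanSpace.single p 1)
      (‖η‖ • EuclideanSpace.single p 1) =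
      ((m + k) * a (xPart X) ‖η‖ + deriv (a (xPart X)) ‖η‖ * ‖η‖) * ‖η‖ ^ 2 := by
    have e : ∀ p, bil (coeffAt a u X) (‖η‖ • EuclideanSpace.single p 1)
        (‖η‖ • EuclideanSpace.single p 1) =
        a (xPart X) ‖η‖ * ‖η‖ ^ 2 + deriv (a (xPart X)) ‖η‖ * ‖η‖ * η p ^ 2 := fun p => by
      rw [bil_smul_left, bil_smul_right, bil_single_single, coeffAt, ← hη, coeffMatrix,
        Matrix.of_apply, if_pos rfl]
      field_simp
    simp only [e, Finset.sum_add_distrib, ← Finset.mul_sum]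
    have hs : ∑ p, η p ^ 2 = ‖η‖ ^ 2 := by
      rw [EuclideanSpace.norm_sq_eq]; simp
    rw [hs]
    simp
    ring
  rw [energy, coeffAt, ← hη, maxEigenvalue_coeffMatrix a _ hm hk hX]
  rw [coeffAt, ← hη] at hq ht
  rw [ht, hq, max_mul_of_nonneg _ _ (sq_nonneg _)]
  congr 1
  field_simp
  ring

theorem integrableOn_energy (hm : 1 ≤ m) (hk : 1 ≤ k) (hu : SolutionRegularity u)
    (hbdd : CoeffLocBounded a u) (R : ℝ) : IntegrableOn (energy a u) (ball 0 R) := by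
  obtain ⟨B, hB⟩ := hu.bounded_gradient
  have hU := isOpen_regSet hu.contDiff
  have hL2 : ∀ {v : Space m k → Space m k}, Continuous v → (∀ X, ‖v X‖ ≤ B) →
      MemLp ((regSet u ∩ ball 0 R).indicator v) 2 := fun {v} hv hvB => by
    refine (memLp_indicator_ball R B 2).mono' (aestronglyMeasurable_indicator_of_continuousOn
      (hU.inter isOpen_ball) hv.continuousOn) (Eventually.of_forall fun X => ?_)
    by_cases hX : X ∈ regSet u ∩ ball 0 R
    · rw [indicator_of_mem hX, indicator_of_mem hX.2]; exact hvB X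
    · rw [indicator_of_notMem hX, norm_zero]
      exact indicator_nonneg (fun _ _ => (norm_nonneg _).trans (hB 0)) X
  have hint : ∀ {v : Space m k → Space m k}, Continuous v → (∀ X, ‖v X‖ ≤ B) →
      (∀ X ∉ regSet u, v X = 0) →
      IntegrableOn (fun X => bil (coeffAt a u X) (v X) (v X)) (ball 0 R) := fun {v} hv hvB h0 => by
    have h1 := (hbdd.integrable_bil hU (R := R) (hL2 hv hvB) (hL2 hv hvB)
      fun X hX => indicator_of_notMem hX _).integrableOn (s := ball 0 R)
    refine h1.congr_fun (fun X hX => ?_) measurableSet_ball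
    by_cases hXU : X ∈ regSet u
    · simp only [indicator_of_mem (show X ∈ regSet u ∩ ball 0 R from ⟨hXU, hX⟩)]
    · simp only [indicator_of_notMem (show X ∉ regSet u ∩ ball 0 R from fun h => hXU h.1),
        h0 X hXU]
  have hcg := continuous_gradient hu.contDiff
  have i1 := hint hcg hB fun X hX => not_not.1 hX
  have i2 : ∀ p : Fin m ⊕ Fin k, _ := fun p =>
    hint (v := fun X => ‖gradient u X‖ • EuclideanSpace.single p 1) (hcg.norm.smul continuous_const)
      (fun X => by rw [norm_smul]; simpa using hB X) fun X hX => by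
        rw [not_not.1 hX, norm_zero, zero_smul]
  have i3 := ((integrable_finsetSum Finset.univ fun p _ => i2 p).sub i1).div_const
    ((m : ℝ) + k - 1)
  refine (i3.sup i1).congr (Eventually.of_forall fun X => ?_)
  rw [energy_eq_max hm hk]
  simp

/-- Positive definiteness is used to replace `|∇_y u|²` by the larger `|∇u|²`. Where `∇u = 0` both
sides vanish, whatever the value `a(x, 0)`. -/
theorem ae_energy_nonneg (hm : 1 ≤ m) (hk : 1 ≤ k)
    (hpos : ∀ᵐ X : Space m k, gradient u X ≠ 0 → (coeffAt a u X).PosDef) :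
    ∀ᵐ X : Space m k, 0 ≤ energy a u X ∧ ∀ v : Space m k,
      ‖gradY u X‖ ^ 2 * bil (coeffAt a u X) v v ≤ energy a u X * ‖v‖ ^ 2 := by
  filter_upwards [hpos] with X hX
  by_cases h0 : gradient u X = 0
  · have h1 : ‖gradY u X‖ = 0 := le_antisymm ((norm_gradY_le u X).trans (by simp [h0]))
      (norm_nonneg _)
    simp [energy, h0, h1]
  · have hA := hX h0
    have hle := fun v => bil_le_maxEigenvalue a (xPart X) hm hk h0 v
    have h1 : 0 ≤ energy a u X :=
      (bil_nonneg_of_posDef hA (gradient u X)).trans (hle _)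
    refine ⟨h1, fun v => ?_⟩
    have hs : ‖gradY u X‖ ^ 2 ≤ ‖gradient u X‖ ^ 2 :=
      pow_le_pow_left₀ (norm_nonneg _) (norm_gradY_le u X) 2
    calc ‖gradY u X‖ ^ 2 * bil (coeffAt a u X) v v
        ≤ ‖gradient u X‖ ^ 2 * bil (coeffAt a u X) v v :=
          mul_le_mul_of_nonneg_right hs (bil_nonneg_of_posDef hA v)
      _ ≤ ‖gradient u X‖ ^ 2 * (maxEigenvalue (coeffAt a u X) * ‖v‖ ^ 2) :=
          mul_le_mul_of_nonneg_left (hle v) (sq_nonneg _)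
      _ = energy a u X * ‖v‖ ^ 2 := by rw [energy]; ring

end Energy

/-! ### Logarithmic cutoffs. -/

section LogCutoff

theorem hasGradientAt_comp_smul {f : Space m k → ℝ} (hf : Differentiable ℝ f) (c : ℝ)
    (X : Space m k) : HasGradientAt (fun Y => f (c • Y)) (c • gradient f (c • X)) X := by
  rw [hasGradientAt_iff_hasFDerivAt]
  have h1 : HasFDerivAt (fun Y : Space m k => c • Y) (c • ContinuousLinearMap.id ℝ (Space m k)) X :=
    (hasFDerivAt_id X).const_smul c
  have h2 := (hf (c • X)).hasFDerivAt.comp X h1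
  have e : InnerProductSpace.toDual ℝ (Space m k) (c • gradient f (c • X)) =
      (fderiv ℝ f (c • X)).comp (c • ContinuousLinearMap.id ℝ (Space m k)) := by
    ext v
    simp
  rw [e]
  exact h2

/-- Averages of dilated bumps: the discrete analogue of the logarithmic cutoff. -/
theorem exists_log_cutoff : ∃ L : ℝ, 0 ≤ L ∧ ∀ j₀ J : ℕ, 0 < J → ∃ φ : Space m k → ℝ, IsTest φ ∧
    (∀ X ∈ ball 0 (2 ^ j₀), φ X = 1) ∧ ∀ X, ‖gradient φ X‖ ^ 2 ≤
      ∑ j ∈ Finset.range J, (ball (0 : Space m k) (2 ^ (j₀ + j + 1))).indicator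
        (fun _ => L / (J ^ 2 * 4 ^ (j₀ + j))) X := by
  -- An outer radius below `2` keeps the gradients of the dyadic dilates on disjoint annuli, so at
  -- each point at most one of the `J` averaged gradients is nonzero. This is what gives the factor
  -- `1 / J²`.
  let b : ContDiffBump (0 : Space m k) :=
    { rIn := 1, rOut := 3 / 2, rIn_pos := one_pos, rIn_lt_rOut := by norm_num }
  have hb : IsTest (b : Space m k → ℝ) := ⟨b.contDiff, b.hasCompactSupport⟩
  obtain ⟨M, hM0, -, hM⟩ := exists_bound_test hb
  have hann : ∀ Y : Space m k, gradient b Y ≠ 0 → 1 ≤ ‖Y‖ ∧ ‖Y‖ ≤ 3 / 2 := by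
    intro Y hY
    constructor
    · by_contra! h
      have : (b : Space m k → ℝ) =ᶠ[𝓝 Y] fun _ => 1 := by
        filter_upwards [isOpen_ball.mem_nhds (show Y ∈ ball (0 : Space m k) 1 by simpa using h)]
          with Z hZ
        exact b.one_of_mem_closedBall (ball_subset_closedBall hZ)
      exact hY (by rw [this.gradient_eq, gradient_fun_const])
    · by_contra! h
      refine hY (gradient_eq_zero_of_notMem_tsupport fun hmem => ?_)
      rw [b.tsupport_eq] at hmem
      have : dist Y 0 ≤ 3 / 2 := hmem
      rw [dist_zero_right] at this
      linarith
  refine ⟨M ^ 2, sq_nonneg _, fun j₀ J hJ => ?_⟩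
  have hJ' : (0 : ℝ) < J := by exact_mod_cast hJ
  let c : ℕ → ℝ := fun j => (2 ^ (j₀ + j))⁻¹
  have hc : ∀ j, 0 < c j := fun j => by positivity
  let ψ : ℕ → Space m k → ℝ := fun j X => b (c j • X)
  let g : ℕ → Space m k → Space m k := fun j X => c j • gradient b (c j • X)
  have hψ : ∀ j, ContDiff ℝ ∞ (ψ j) := fun j => hb.1.comp (contDiff_const_smul (c j))
  have hψ2 : ∀ j, HasCompactSupport (ψ j) := fun j => hb.2.comp_smul (hc j).ne'
  have hψg : ∀ j X, HasGradientAt (ψ j) (g j X) X := fun j X =>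
    hasGradientAt_comp_smul (hb.1.differentiable (by simp)) (c j) X
  let φ : Space m k → ℝ := fun X => (J : ℝ)⁻¹ * ∑ j ∈ Finset.range J, ψ j X
  have hφg : ∀ X, gradient φ X = (J : ℝ)⁻¹ • ∑ j ∈ Finset.range J, g j X := fun X => by
    have := (hasGradientAt_const X (J : ℝ)⁻¹).mul_real
      (HasGradientAt.sum_real (s := Finset.range J) fun j _ => hψg j X)
    simpa using this.gradient
  have hg : ∀ j X, g j X ≠ 0 → 2 ^ (j₀ + j) ≤ ‖X‖ ∧ ‖X‖ ≤ 3 / 2 * 2 ^ (j₀ + j) := by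
    intro j X h
    have h1 := hann (c j • X) fun h0 => h (by simp only [g, h0, smul_zero])
    have hp : (0 : ℝ) < 2 ^ (j₀ + j) := by positivity
    rw [norm_smul, Real.norm_of_nonneg (hc j).le, ← div_eq_inv_mul, le_div_iff₀ hp,
      div_le_iff₀ hp, one_mul] at h1
    exact h1
  have huniq : ∀ i j X, g i X ≠ 0 → g j X ≠ 0 → ¬ i < j := by
    intro i j X hi hj hij
    have h1 := (hg i X hi).2
    have h2 := (hg j X hj).1
    have h3 : (2 : ℝ) ^ (j₀ + i + 1) ≤ 2 ^ (j₀ + j) :=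
      pow_le_pow_right₀ one_le_two (by omega)
    rw [pow_succ] at h3
    have hp : (0 : ℝ) < 2 ^ (j₀ + i) := by positivity
    linarith
  refine ⟨φ, ⟨?_, ?_⟩, fun X hX => ?_, fun X => ?_⟩
  · exact contDiff_const.mul (ContDiff.sum fun j _ => hψ j)
  · refine HasCompactSupport.mul_left ?_
    have hK : IsCompact (⋃ j ∈ Finset.range J, tsupport (ψ j)) :=
      (Finset.range J).isCompact_biUnion fun j _ => hψ2 j
    refine HasCompactSupport.intro hK fun X hX => Finset.sum_eq_zero fun j hj => ?_
    exact image_eq_zero_of_notMem_tsupport fun h => hX (mem_biUnion (Finset.mem_coe.2 hj) h)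
  · have h1 : ∀ j ∈ Finset.range J, ψ j X = 1 := fun j _ => by
      refine b.one_of_mem_closedBall ?_
      have hX' : ‖X‖ < 2 ^ j₀ := by simpa using hX
      have h2 : (2 : ℝ) ^ j₀ ≤ 2 ^ (j₀ + j) := pow_le_pow_right₀ one_le_two (by omega)
      rw [mem_closedBall, dist_zero_right, norm_smul, Real.norm_of_nonneg (hc j).le,
        ← div_eq_inv_mul]
      exact (div_le_one (by positivity)).2 (hX'.le.trans h2)
    simp only [φ]
    rw [Finset.sum_congr rfl h1]
    simp [hJ'.ne']
  · rw [hφg]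
    have hnn : ∀ j ∈ Finset.range J, 0 ≤ (ball (0 : Space m k) (2 ^ (j₀ + j + 1))).indicator
        (fun _ => M ^ 2 / (J ^ 2 * 4 ^ (j₀ + j))) X := fun j _ =>
      indicator_nonneg (fun _ _ => by positivity) X
    by_cases h : ∃ j ∈ Finset.range J, g j X ≠ 0
    · obtain ⟨j, hj, hgj⟩ := h
      have hsum : ∑ i ∈ Finset.range J, g i X = g j X :=
        Finset.sum_eq_single_of_mem j hj fun i _ hij => by
          by_contra hgi
          rcases lt_or_gt_of_ne hij with h1 | h1
          · exact huniq i j X hgi hgj h1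
          · exact huniq j i X hgj hgi h1
      refine le_trans ?_ (Finset.single_le_sum hnn hj)
      have hXb : X ∈ ball (0 : Space m k) (2 ^ (j₀ + j + 1)) := by
        rw [mem_ball, dist_zero_right, pow_succ]
        have hp : (0 : ℝ) < 2 ^ (j₀ + j) := by positivity
        linarith [(hg j X hgj).2]
      rw [indicator_of_mem hXb, hsum, norm_smul, norm_smul, mul_pow, mul_pow,
        Real.norm_of_nonneg (hc j).le, norm_inv, Real.norm_of_nonneg hJ'.le]
      have h4 : (c j) ^ 2 = (4 ^ (j₀ + j))⁻¹ := by
        simp only [c]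
        rw [inv_pow, ← pow_mul, mul_comm, pow_mul]; norm_num
      rw [h4]
      calc ((J : ℝ)⁻¹) ^ 2 * ((4 ^ (j₀ + j))⁻¹ * ‖gradient b (c j • X)‖ ^ 2)
          ≤ ((J : ℝ)⁻¹) ^ 2 * ((4 ^ (j₀ + j))⁻¹ * M ^ 2) := by
            gcongr; exact hM _
        _ = M ^ 2 / (J ^ 2 * 4 ^ (j₀ + j)) := by field_simp
    · push Not at h
      rw [Finset.sum_eq_zero h, smul_zero, norm_zero, zero_pow two_ne_zero]
      exact Finset.sum_nonneg hnn

end LogCutoff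

/-! ### Vanishing of the deficit. -/

section Rigidity

/-- With `ν = ∇_y u / |∇_y u|`, expanding the square uses only `|ν| = 1`, `∑_j ν_j ∇u_{y_j} = ∇|∇_y
u|` and the symmetry of `𝒜`. -/
theorem sum_bil_sub_eq (a : EuclideanSpace ℝ (Fin m) → ℝ → ℝ) (u : Space m k → ℝ)
    {X : Space m k} (hX : X ∈ ySet u) :
    ∑ j, bil (coeffAt a u X)
      (gradient (pd u (Sum.inr j)) X - (pd u (Sum.inr j) X / ‖gradY u X‖) • normGrad u X)
      (gradient (pd u (Sum.inr j)) X - (pd u (Sum.inr j) X / ‖gradY u X‖) • normGrad u X) =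
    deficit a u X := by
  rw [deficit, indicator_of_mem hX]
  have hn : ‖gradY u X‖ ≠ 0 := norm_ne_zero_iff.2 hX
  set ν : Fin k → ℝ := fun j => pd u (Sum.inr j) X / ‖gradY u X‖ with hν
  have h1 : ∑ j, ν j ^ 2 = 1 := by
    simp only [hν, div_pow, ← Finset.sum_div, ← norm_gradY_sq]
    exact div_self (pow_ne_zero 2 hn)
  have h2 : ∑ j, ν j * bil (coeffAt a u X) (gradient (pd u (Sum.inr j)) X) (normGrad u X) =
      bil (coeffAt a u X) (normGrad u X) (normGrad u X) := by
    conv_rhs => rw [normGrad, bil_sum_left]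
    exact Finset.sum_congr rfl fun j _ => (bil_smul_left _ _ _ _).symm
  have h3 : ∀ j, bil (coeffAt a u X) (gradient (pd u (Sum.inr j)) X - ν j • normGrad u X)
      (gradient (pd u (Sum.inr j)) X - ν j • normGrad u X) =
      bil (coeffAt a u X) (gradient (pd u (Sum.inr j)) X) (gradient (pd u (Sum.inr j)) X) -
      2 * (ν j * bil (coeffAt a u X) (gradient (pd u (Sum.inr j)) X) (normGrad u X)) +
      ν j ^ 2 * bil (coeffAt a u X) (normGrad u X) (normGrad u X) := fun j => by
    simp only [sub_eq_add_neg, ← neg_smul, bil_add_left, bil_add_right, bil_smul_left,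
      bil_smul_right]
    rw [bil_comm _ (normGrad u X) (gradient (pd u (Sum.inr j)) X) (coeffAt_symm a u X)]
    ring
  rw [Finset.sum_congr rfl fun j _ => h3 j, Finset.sum_add_distrib, Finset.sum_sub_distrib,
    ← Finset.mul_sum, h2, ← Finset.sum_mul, h1]
  ring

theorem ae_deficit_nonneg {a : EuclideanSpace ℝ (Fin m) → ℝ → ℝ} {u : Space m k → ℝ}
    (hpos : ∀ᵐ X : Space m k, gradient u X ≠ 0 → (coeffAt a u X).PosDef) :
    ∀ᵐ X : Space m k, 0 ≤ deficit a u X := by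
  filter_upwards [hpos] with X hX
  by_cases h : X ∈ ySet u
  · rw [← sum_bil_sub_eq a u h]
    exact Finset.sum_nonneg fun j _ => bil_nonneg_of_posDef (hX (ySet_subset_regSet u h)) _
  · rw [deficit, indicator_of_notMem h]

variable {a : Fin n → EuclideanSpace ℝ (Fin m) → ℝ → ℝ}
  {F : EuclideanSpace ℝ (Fin m) → (Fin n → ℝ) → ℝ} {u : Fin n → Space m k → ℝ}

/-- The `j`-th scale contributes at most `L / (J² 4^{j₀+j})` times an energy of at most `C · 4 ·
4^{j₀+j}`, that is `4 L C / J²`; there are `J` scales. -/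
theorem integral_cutoff_energy_le (hm : 1 ≤ m) (hk : 1 ≤ k)
    {a : EuclideanSpace ℝ (Fin m) → ℝ → ℝ} {u : Space m k → ℝ} (hu : SolutionRegularity u)
    (hbdd : CoeffLocBounded a u)
    (hpos : ∀ᵐ X : Space m k, gradient u X ≠ 0 → (coeffAt a u X).PosDef) {C L : ℝ} {j₀ J : ℕ}
    (hL : 0 ≤ L) (hJ : 0 < J)
    (hC : ∀ j : ℕ, ∫ X in ball (0 : Space m k) (2 ^ (j₀ + j + 1)), energy a u X ≤
      C * (2 ^ (j₀ + j + 1)) ^ 2) {φ : Space m k → ℝ}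
    (hi : Integrable fun X => ‖gradY u X‖ ^ 2 *
      bil (coeffAt a u X) (gradient φ X) (gradient φ X))
    (hφ : ∀ X, ‖gradient φ X‖ ^ 2 ≤
      ∑ j ∈ Finset.range J, (ball (0 : Space m k) (2 ^ (j₀ + j + 1))).indicator
        (fun _ => L / (J ^ 2 * 4 ^ (j₀ + j))) X) :
    ∫ X, ‖gradY u X‖ ^ 2 * bil (coeffAt a u X) (gradient φ X) (gradient φ X) ≤
      4 * L * C / J := by
  have hJ' : (0 : ℝ) < J := by exact_mod_cast hJ
  have ib : ∀ j, Integrable fun X => (ball (0 : Space m k) (2 ^ (j₀ + j + 1))).indicator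
      (fun X => L / (J ^ 2 * 4 ^ (j₀ + j)) * energy a u X) X := fun j =>
    (integrable_indicator_iff measurableSet_ball).2
      ((integrableOn_energy hm hk hu hbdd _).const_mul _)
  calc ∫ X, ‖gradY u X‖ ^ 2 * bil (coeffAt a u X) (gradient φ X) (gradient φ X)
      ≤ ∫ X, ∑ j ∈ Finset.range J, (ball (0 : Space m k) (2 ^ (j₀ + j + 1))).indicator
          (fun X => L / (J ^ 2 * 4 ^ (j₀ + j)) * energy a u X) X := by
        refine integral_mono_ae hi (integrable_finsetSum _ fun j _ => ib j) ?_
        filter_upwards [ae_energy_nonneg hm hk hpos] with X hX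
        refine (hX.2 (gradient φ X)).trans ((mul_le_mul_of_nonneg_left (hφ X) hX.1).trans_eq ?_)
        rw [Finset.mul_sum]
        refine Finset.sum_congr rfl fun j _ => ?_
        by_cases hXj : X ∈ ball (0 : Space m k) (2 ^ (j₀ + j + 1))
        · rw [indicator_of_mem hXj, indicator_of_mem hXj, mul_comm]
        · rw [indicator_of_notMem hXj, indicator_of_notMem hXj, mul_zero]
    _ = ∑ j ∈ Finset.range J, L / (J ^ 2 * 4 ^ (j₀ + j)) *
          ∫ X in ball (0 : Space m k) (2 ^ (j₀ + j + 1)), energy a u X := by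
        rw [integral_finsetSum _ fun j _ => ib j]
        refine Finset.sum_congr rfl fun j _ => ?_
        rw [integral_indicator measurableSet_ball, integral_const_mul]
    _ ≤ ∑ j ∈ Finset.range J, 4 * L * C / J ^ 2 := by
        refine Finset.sum_le_sum fun j _ => ?_
        refine (mul_le_mul_of_nonneg_left (hC j) (by positivity)).trans_eq ?_
        have : ((2 : ℝ) ^ (j₀ + j + 1)) ^ 2 = 4 * 4 ^ (j₀ + j) := by
          rw [← pow_mul, mul_comm, pow_mul, pow_succ]; norm_num; ring
        rw [this]
        field_simp
    _ = 4 * L * C / J := by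
        rw [Finset.sum_const, Finset.card_range, nsmul_eq_mul]
        field_simp

/-- On a fixed ball where the cutoffs equal `1`, the Poincaré inequality bounds the integral of a
nonnegative deficit by a constant over `J`, and `J` is arbitrary. -/
theorem ae_deficit_eq_zero (hm : 1 ≤ m) (hk : 1 ≤ k) (ha : CoeffAssumptions a)
    (hF : NonlinAssumptions F)
    (hreg : ∀ i, SolutionRegularity (u i)) (hweak : IsWeakSolution a F u)
    (hstable : IsStable a F u) (hbdd : ∀ i, CoeffLocBounded (a i) (u i))
    {σ : Fin n → ℝ} (hσ : ∀ i, σ i ^ 2 = 1)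
    (hσF : ∀ i j, i ≠ j → ∀ X : Space m k,
      0 ≤ F2 F i j (xPart X) (fun l => u l X) * (σ i * σ j))
    (hpos : ∀ i, ∀ᵐ X : Space m k, gradient (u i) X ≠ 0 → (coeffAt (a i) (u i) X).PosDef)
    {C : Fin n → ℝ}
    (hC : ∀ R : ℝ, (∀ j, C j ≤ R) → ∀ i,
      ∫ X in ball (0 : Space m k) R, energy (a i) (u i) X ≤ C i * R ^ 2) (i : Fin n) :
    ∀ᵐ X : Space m k, deficit (a i) (u i) X = 0 := by
  obtain ⟨L, hL, hcut⟩ := exists_log_cutoff (m := m) (k := k)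
  -- From `2 ^ jC` on, every dyadic radius is admissible in the energy bound of all components
  -- simultaneously.
  obtain ⟨jC, hjC⟩ : ∃ jC : ℕ, ∀ l, C l ≤ 2 ^ jC := by
    obtain ⟨b, hb⟩ := (Set.finite_range C).bddAbove
    obtain ⟨jC, h⟩ := pow_unbounded_of_one_lt b (one_lt_two (α := ℝ))
    exact ⟨jC, fun l => (hb ⟨l, rfl⟩).trans h.le⟩
  have hnn := fun l => ae_deficit_nonneg (hpos l)
  have key : ∀ r : ℕ, ∀ᵐ X : Space m k, X ∈ ball (0 : Space m k) (2 ^ (jC + r)) →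
      deficit (a i) (u i) X = 0 := by
    intro r
    have hC' : ∀ l (j : ℕ), ∫ X in ball (0 : Space m k) (2 ^ (jC + r + j + 1)),
        energy (a l) (u l) X ≤ C l * (2 ^ (jC + r + j + 1)) ^ 2 := fun l j =>
      hC _ (fun l' => (hjC l').trans (pow_le_pow_right₀ one_le_two (by omega))) l
    -- Any cutoff equal to `1` on the ball will do here, hence `J = 1`.
    have hio : IntegrableOn (deficit (a i) (u i)) (ball 0 (2 ^ (jC + r))) := by
      obtain ⟨φ, hφ, h1, -⟩ := hcut (jC + r) 1 one_pos
      have := ((geometric_poincare ha hF hreg hweak hstable hbdd hσ hσF hφ).1 i).integrableOn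
        (s := ball 0 (2 ^ (jC + r)))
      refine this.congr_fun (fun X hX => ?_) measurableSet_ball
      simp [h1 X hX]
    have hbound : ∀ J : ℕ, 0 < J →
        ∫ X in ball (0 : Space m k) (2 ^ (jC + r)), deficit (a i) (u i) X ≤
          (∑ l, 4 * L * C l) / J := by
      intro J hJ
      obtain ⟨φ, hφ, h1, h2⟩ := hcut (jC + r) J hJ
      obtain ⟨p1, p2, p3⟩ := geometric_poincare ha hF hreg hweak hstable hbdd hσ hσF hφ
      have hnn' : ∀ l, 0 ≤ᵐ[volume] fun X => φ X ^ 2 * deficit (a l) (u l) X := fun l => by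
        filter_upwards [hnn l] with X hX
        exact mul_nonneg (sq_nonneg _) hX
      calc ∫ X in ball (0 : Space m k) (2 ^ (jC + r)), deficit (a i) (u i) X
          = ∫ X in ball (0 : Space m k) (2 ^ (jC + r)), φ X ^ 2 * deficit (a i) (u i) X :=
            setIntegral_congr_fun measurableSet_ball fun X hX => by simp [h1 X hX]
        _ ≤ ∫ X, φ X ^ 2 * deficit (a i) (u i) X :=
            setIntegral_le_integral (p1 i) (hnn' i)
        _ ≤ ∑ l, ∫ X, φ X ^ 2 * deficit (a l) (u l) X :=
            Finset.single_le_sum (f := fun l => ∫ X, φ X ^ 2 * deficit (a l) (u l) X)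
              (fun l _ => integral_nonneg_of_ae (hnn' l)) (Finset.mem_univ i)
        _ ≤ ∑ l, 4 * L * C l / J := p3.trans (Finset.sum_le_sum fun l _ =>
            integral_cutoff_energy_le hm hk (hreg l) (hbdd l) (hpos l) hL hJ (hC' l) (p2 l) h2)
        _ = (∑ l, 4 * L * C l) / J := by rw [Finset.sum_div]
    have hle : ∫ X in ball (0 : Space m k) (2 ^ (jC + r)), deficit (a i) (u i) X ≤ 0 := by
      refine ge_of_tendsto (tendsto_const_div_atTop_nhds_zero_nat (∑ l, 4 * L * C l)) ?_
      filter_upwards [eventually_gt_atTop 0] with J hJ using hbound J hJ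
    have hnr : 0 ≤ᵐ[volume.restrict (ball (0 : Space m k) (2 ^ (jC + r)))] deficit (a i) (u i) :=
      ae_restrict_of_ae (hnn i)
    have h0 := (setIntegral_eq_zero_iff_of_nonneg_ae hnr hio).1
      (le_antisymm hle (integral_nonneg_of_ae hnr))
    exact (ae_restrict_iff' measurableSet_ball).1 h0
  filter_upwards [ae_all_iff.2 key] with X hX
  obtain ⟨r, hr⟩ := pow_unbounded_of_one_lt ‖X‖ (one_lt_two (α := ℝ))
  refine hX r ?_
  rw [mem_ball, dist_zero_right]
  exact hr.trans_le (pow_le_pow_right₀ one_le_two (by omega))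

/-- Vanishing of the deficit makes `∇u_{y_j}` parallel to `∇|∇_y u|`. -/
theorem gradient_pd_eq_of_deficit {a : EuclideanSpace ℝ (Fin m) → ℝ → ℝ} {u : Space m k → ℝ}
    (hu : SolutionRegularity u)
    (hpos : ∀ᵐ X : Space m k, gradient u X ≠ 0 → (coeffAt a u X).PosDef)
    (h0 : ∀ᵐ X : Space m k, deficit a u X = 0) {X : Space m k} (hX : X ∈ ySet u) (j : Fin k) :
    gradient (pd u (Sum.inr j)) X = (pd u (Sum.inr j) X / ‖gradY u X‖) • normGrad u X := by
  refine Measure.eqOn_open_of_ae_eq (μ := volume) (U := ySet u)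
    (f := gradient (pd u (Sum.inr j)))
    (g := fun X => (pd u (Sum.inr j) X / ‖gradY u X‖) • normGrad u X) ?_
    (isOpen_ySet hu.contDiff) (hu.continuousOn_gradient_pd _) ?_ hX
  · rw [Filter.EventuallyEq, ae_restrict_iff' (isOpen_ySet hu.contDiff).measurableSet]
    filter_upwards [hpos, h0] with X hp h0X hXy
    have hA := hp (ySet_subset_regSet u hXy)
    rw [← sum_bil_sub_eq a u hXy,
      Finset.sum_eq_zero_iff_of_nonneg fun j _ => bil_nonneg_of_posDef hA _] at h0X
    by_contra hne
    exact (bil_pos_of_posDef hA (sub_ne_zero.2 hne)).ne' (h0X j (Finset.mem_univ j))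
  · refine ContinuousOn.fun_smul ?_ hu.continuousOn_normGrad
    exact (continuous_pd hu.contDiff _).continuousOn.div
      (continuous_gradY hu.contDiff).norm.continuousOn fun X hX => norm_ne_zero_iff.2 hX

end Rigidity

/-! ### From parallel Hessian rows to one-dimensional fibres. -/

section Geometry

/-- The point `(x, y)`. -/
def pair (x : EuclideanSpace ℝ (Fin m)) (y : EuclideanSpace ℝ (Fin k)) : Space m k :=
  WithLp.toLp 2 (Sum.elim (fun j => x j) fun j => y j)

theorem pair_xPart_yPart (X : Space m k) : pair (xPart X) (yPart X) = X := by
  ext p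
  cases p <;> rfl

theorem xPart_pair (x : EuclideanSpace ℝ (Fin m)) (y : EuclideanSpace ℝ (Fin k)) :
    xPart (pair x y) = x := rfl

theorem pair_add_smul (x : EuclideanSpace ℝ (Fin m)) (y e : EuclideanSpace ℝ (Fin k)) (t : ℝ) :
    pair x y + t • pair 0 e = pair x (y + t • e) := by
  ext p
  cases p <;> simp [pair]

theorem fderiv_pair (f : Space m k → ℝ) (X : Space m k) (e : EuclideanSpace ℝ (Fin k)) :
    fderiv ℝ f X (pair 0 e) = ∑ l, gradient f X (Sum.inr l) * e l := by
  rw [fderiv_eq_sum, Fintype.sum_sum_type]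
  simp [pair]

theorem fderiv_pair_eq_inner (u : Space m k → ℝ) (X : Space m k) (e : EuclideanSpace ℝ (Fin k)) :
    fderiv ℝ u X (pair 0 e) = inner ℝ (gradY u X) e := by
  rw [fderiv_pair, PiLp.inner_apply]
  simp [gradY_apply, mul_comm]

theorem hasDerivAt_along {f : Space m k → ℝ} {X v : Space m k} {t : ℝ}
    (hf : DifferentiableAt ℝ f (X + t • v)) :
    HasDerivAt (fun s : ℝ => f (X + s • v)) (fderiv ℝ f (X + t • v) v) t := by
  have h1 : HasDerivAt (fun s : ℝ => X + s • v) v t := by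
    simpa using ((hasDerivAt_id t).smul_const v).const_add X
  exact hf.hasFDerivAt.comp_hasDerivAt t h1

variable {u : Space m k → ℝ}

/-- Each `∇u_{y_j}` is parallel to `∇|∇_y u|`, with the factor `u_{y_j} / |∇_y u|`. -/
def ParallelHessian (u : Space m k → ℝ) : Prop :=
  ∀ X ∈ ySet u, ∀ j, gradient (pd u (Sum.inr j)) X =
    (pd u (Sum.inr j) X / ‖gradY u X‖) • normGrad u X

/-- The direction of `∇_y u` is constant on connected subsets of `{∇_y u ≠ 0}`. -/
theorem direction_const (hu : SolutionRegularity u) (hpar : ParallelHessian u)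
    {s : Set (Space m k)} (hs : IsOpen s) (hs' : IsPreconnected s)
    (hsy : s ⊆ ySet u) {X Y : Space m k} (hX : X ∈ s) (hY : Y ∈ s) :
    gradY u Y = (‖gradY u Y‖ / ‖gradY u X‖) • gradY u X := by
  -- The gradient of `u_{y_j} / |∇_y u|` is `(∇u_{y_j} - (u_{y_j} / |∇_y u|) ∇|∇_y u|) / |∇_y u|`.
  -- It vanishes in all `N` directions, including those of `x`.
  have hder : ∀ j, ∀ Z ∈ s, HasGradientAt (fun Z => pd u (Sum.inr j) Z * (‖gradY u Z‖)⁻¹) 0 Z := by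
    intro j Z hZ
    have hn : ‖gradY u Z‖ ≠ 0 := norm_ne_zero_iff.2 (hsy hZ)
    have h1 := (hu.hasGradientAt_pd (hsy hZ) (Sum.inr j)).mul_real
      (HasGradientAt.scomp_real (hasDerivAt_inv hn) (hu.hasGradientAt_norm (hsy hZ)))
    convert! h1 using 1
    rw [hpar Z (hsy hZ) j, smul_smul, smul_smul, ← add_smul]
    rw [show pd u (Sum.inr j) Z * -(‖gradY u Z‖ ^ 2)⁻¹ +
      ‖gradY u Z‖⁻¹ * (pd u (Sum.inr j) Z / ‖gradY u Z‖) = 0 by field_simp; ring, zero_smul]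
  have hconst : ∀ j, pd u (Sum.inr j) Y * (‖gradY u Y‖)⁻¹ =
      pd u (Sum.inr j) X * (‖gradY u X‖)⁻¹ := fun j =>
    hs.is_const_of_fderiv_eq_zero (𝕜 := ℝ) hs'
      (f := fun Z => pd u (Sum.inr j) Z * (‖gradY u Z‖)⁻¹)
      (fun Z hZ => (hder j Z hZ).differentiableAt.differentiableWithinAt)
      (fun Z hZ => by
        have := (hasGradientAt_iff_hasFDerivAt.1 (hder j Z hZ)).fderiv
        rw [this]; simp) hY hX
  have hnY : ‖gradY u Y‖ ≠ 0 := norm_ne_zero_iff.2 (hsy hY)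
  have hnX : ‖gradY u X‖ ≠ 0 := norm_ne_zero_iff.2 (hsy hX)
  ext j
  have h := hconst j
  simp only [PiLp.smul_apply, gradY_apply, smul_eq_mul]
  field_simp at h ⊢
  linarith

/-- By symmetry of the Hessian, the derivative of `u_{y_j}` along `e` is `∑_l e_l ∂_{y_j} u_{y_l}`;
the parallelism turns it into a multiple of `⟨∇_y u, e⟩`. -/
theorem fderiv_pd_eq_zero (hu : SolutionRegularity u) (hpar : ParallelHessian u)
    {X : Space m k} (hX : X ∈ ySet u) {e : EuclideanSpace ℝ (Fin k)}
    (he : inner ℝ (gradY u X) e = 0) (j : Fin k) :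
    fderiv ℝ (pd u (Sum.inr j)) X (pair 0 e) = 0 := by
  have h1 : ∀ l, gradient (pd u (Sum.inr j)) X (Sum.inr l) * e l =
      normGrad u X (Sum.inr j) / ‖gradY u X‖ * (pd u (Sum.inr l) X * e l) := fun l => by
    rw [gradient_pd_symm (hu.contDiffAt (ySet_subset_regSet u hX)), hpar X hX l,
      PiLp.smul_apply, smul_eq_mul]
    ring
  have h2 : ∑ l, pd u (Sum.inr l) X * e l = inner ℝ (gradY u X) e := by
    rw [PiLp.inner_apply]; simp [gradY_apply, mul_comm]
  rw [fderiv_pair, Finset.sum_congr rfl fun l _ => h1 l, ← Finset.mul_sum, h2, he, mul_zero]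

/-- `∇_y u` is constant along the hyperplane through `X` orthogonal to it. -/
theorem gradY_const_along (hu : SolutionRegularity u) (hpar : ParallelHessian u)
    {X : Space m k} (hX : X ∈ ySet u) {e : EuclideanSpace ℝ (Fin k)}
    (he : inner ℝ (gradY u X) e = 0) (t : ℝ) : gradY u (X + t • pair 0 e) = gradY u X := by
  have hcl : Continuous fun t : ℝ => X + t • (pair 0 e : Space m k) := by fun_prop
  have hclosed : IsClosed {t : ℝ | gradY u (X + t • pair 0 e) = gradY u X} :=
    isClosed_eq ((continuous_gradY hu.contDiff).comp hcl) continuous_const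
  -- The line is not known in advance to stay in `{∇_y u ≠ 0}`, hence a connectedness argument. Near
  -- a parameter where the value is still `∇_y u(X)`, the direction is locally constant, so `e`
  -- remains orthogonal to `∇_y u` and the derivatives along the line vanish.
  have hopen : IsOpen {t : ℝ | gradY u (X + t • pair 0 e) = gradY u X} := by
    rw [Metric.isOpen_iff]
    intro t₀ (ht₀ : gradY u (X + t₀ • pair 0 e) = gradY u X)
    have hY : X + t₀ • pair 0 e ∈ ySet u := by
      change gradY u _ ≠ 0
      rw [ht₀]; exact hX
    obtain ⟨r, hr, hrb⟩ := Metric.isOpen_iff.1 (isOpen_ySet hu.contDiff) _ hY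
    obtain ⟨δ, hδ, hδb⟩ := Metric.isOpen_iff.1 (isOpen_ball.preimage hcl) t₀
      (show t₀ ∈ (fun t : ℝ => X + t • (pair 0 e : Space m k)) ⁻¹' ball (X + t₀ • pair 0 e) r from
        mem_ball_self hr)
    have hzero : ∀ s ∈ ball t₀ δ, ∀ j, HasDerivAt
        (fun s : ℝ => pd u (Sum.inr j) (X + s • pair 0 e)) 0 s := by
      intro s hs j
      have hZ := hδb hs
      have hdir := direction_const hu hpar isOpen_ball (convex_ball _ r).isPreconnected hrb
        (mem_ball_self hr) hZ
      have he' : inner ℝ (gradY u (X + s • pair 0 e)) e = 0 := by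
        rw [hdir, ht₀, inner_smul_left, he, mul_zero]
      have h1 := hasDerivAt_along (f := pd u (Sum.inr j)) (X := X) (v := pair 0 e) (t := s)
        ((hu.contDiffAt_pd (hrb hZ) _).differentiableAt one_ne_zero)
      rwa [fderiv_pd_eq_zero hu hpar (hrb hZ) he' j] at h1
    refine ⟨δ, hδ, fun s hs => ?_⟩
    change gradY u (X + s • pair 0 e) = gradY u X
    rw [← ht₀]
    ext j
    exact isOpen_ball.is_const_of_deriv_eq_zero (convex_ball t₀ δ).isPreconnected
      (f := fun s : ℝ => pd u (Sum.inr j) (X + s • pair 0 e))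
      (fun z hz => (hzero z hz j).differentiableAt.differentiableWithinAt)
      (fun z hz => (hzero z hz j).deriv) hs (mem_ball_self hδ)
  have huniv := IsClopen.eq_univ ⟨hclosed, hopen⟩ ⟨0, by simp⟩
  exact (huniv.symm ▸ mem_univ t : t ∈ {t : ℝ | gradY u (X + t • pair 0 e) = gradY u X})

/-- On a fibre `{x} × ℝ^k` all nonzero values of `∇_y u` are parallel. -/
theorem gradY_parallel (hu : SolutionRegularity u) (hpar : ParallelHessian u)
    {X Y : Space m k} (hX : X ∈ ySet u) (hY : Y ∈ ySet u)
    (hxy : xPart X = xPart Y) : ∃ c : ℝ, gradY u Y = c • gradY u X := by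
  set p := gradY u X with hp
  set q := gradY u Y with hq
  set c := inner ℝ p q / ‖p‖ ^ 2 with hc
  -- The part of `q` orthogonal to `p`. If `r ≠ 0`, the hyperplanes through `X` and `Y` with normals
  -- `p` and `q` meet.
  set r := q - c • p with hr
  by_cases hr0 : r = 0
  · exact ⟨c, sub_eq_zero.1 hr0⟩
  have hpn : ‖p‖ ≠ 0 := norm_ne_zero_iff.2 hX
  have hpr : inner ℝ p r = 0 := by
    rw [hr, inner_sub_right, inner_smul_right, real_inner_self_eq_norm_sq, hc]
    field_simp
    ring
  have hqr : inner ℝ q r = ‖r‖ ^ 2 := by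
    have : q = r + c • p := by rw [hr]; abel
    conv_lhs => rw [this]
    rw [inner_add_left, inner_smul_left, hpr, mul_zero, add_zero, real_inner_self_eq_norm_sq]
  have hrn : ‖r‖ ≠ 0 := norm_ne_zero_iff.2 hr0
  set d := yPart Y - yPart X with hd
  -- The multiple of `r` for which `X + (0, e₁)` also lies on the hyperplane through `Y`. At this
  -- common point `∇_y u` equals both `p` and `q`.
  set e₁ := (inner ℝ q d / ‖r‖ ^ 2) • r with he₁
  have h1 : inner ℝ p e₁ = 0 := by rw [he₁, inner_smul_right, hpr, mul_zero]
  have h2 : inner ℝ q (e₁ - d) = 0 := by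
    rw [inner_sub_right, he₁, inner_smul_right, hqr]
    field_simp
    ring
  have h3 := gradY_const_along hu hpar hX h1 1
  have h4 := gradY_const_along hu hpar hY h2 1
  have h5 : X + (1 : ℝ) • pair 0 e₁ = Y + (1 : ℝ) • pair 0 (e₁ - d) := by
    rw [← pair_xPart_yPart X, ← pair_xPart_yPart Y, pair_add_smul, pair_add_smul, hxy, one_smul,
      one_smul, hd]
    congr 1
    abel
  exact ⟨1, by rw [one_smul, hq, hp, ← h3, h5, h4]⟩

/-- A function whose `y`-gradient has locally constant direction is one-dimensional in `y` on each
fibre, and the direction can be chosen constant along the components of `{∇_y u ≠ 0}`. -/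
theorem exists_profile (hu : SolutionRegularity u) (hpar : ParallelHessian u)
    (hk : 1 ≤ k) :
    ∃ (ubar : EuclideanSpace ℝ (Fin m) → ℝ → ℝ)
      (dir : EuclideanSpace ℝ (Fin m) → sphere (0 : EuclideanSpace ℝ (Fin k)) 1),
      (∀ X : Space m k, u X =
        ubar (xPart X) (inner ℝ (dir (xPart X) : EuclideanSpace ℝ (Fin k)) (yPart X))) ∧
      ∀ X X' : Space m k, gradY u X ≠ 0 →
        X' ∈ connectedComponentIn {Z | gradY u Z ≠ 0} X → dir (xPart X') = dir (xPart X) := by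
  classical
  -- `S x` consists of the unit vectors spanning the line of some nonzero `∇_y u` on the fibre, so
  -- an opposite pair is possible. As `dir x` is chosen from the set `S x` alone, equal sets give
  -- equal directions without any matching of signs. The vector `σ₀` serves the fibres where `∇_y u`
  -- vanishes identically.
  let S : EuclideanSpace ℝ (Fin m) → Set (sphere (0 : EuclideanSpace ℝ (Fin k)) 1) := fun x =>
    {σ | ∃ X, xPart X = x ∧ X ∈ ySet u ∧ ∃ c : ℝ, gradY u X = c • (σ : EuclideanSpace ℝ (Fin k))}
  let σ₀ : sphere (0 : EuclideanSpace ℝ (Fin k)) 1 :=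
    ⟨EuclideanSpace.single ⟨0, hk⟩ 1, by simp⟩
  let dir : EuclideanSpace ℝ (Fin m) → sphere (0 : EuclideanSpace ℝ (Fin k)) 1 := fun x =>
    if h : (S x).Nonempty then h.some else σ₀
  -- By `gradY_parallel`, one point of the fibre with `∇_y u ≠ 0` decides membership.
  have hmem : ∀ X ∈ ySet u, ∀ σ, σ ∈ S (xPart X) ↔
      ∃ c : ℝ, gradY u X = c • (σ : EuclideanSpace ℝ (Fin k)) := by
    intro X hX σ
    constructor
    · rintro ⟨Y, hY, hYy, c, hc⟩
      obtain ⟨c', hc'⟩ := gradY_parallel hu hpar hYy hX hY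
      exact ⟨c' * c, by rw [hc', hc, smul_smul]⟩
    · rintro ⟨c, hc⟩
      exact ⟨X, rfl, hX, c, hc⟩
  have hne : ∀ X ∈ ySet u, (S (xPart X)).Nonempty := by
    intro X hX
    have hn : ‖gradY u X‖ ≠ 0 := norm_ne_zero_iff.2 hX
    refine ⟨⟨‖gradY u X‖⁻¹ • gradY u X, ?_⟩, (hmem X hX _).2 ⟨‖gradY u X‖, ?_⟩⟩
    · rw [mem_sphere_zero_iff_norm, norm_smul, norm_inv, norm_norm, inv_mul_cancel₀ hn]
    · rw [smul_smul, mul_inv_cancel₀ hn, one_smul]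
  have hdir : ∀ X ∈ ySet u, ∃ c : ℝ,
      gradY u X = c • (dir (xPart X) : EuclideanSpace ℝ (Fin k)) := by
    intro X hX
    have : dir (xPart X) ∈ S (xPart X) := by
      simp only [dir, dif_pos (hne X hX)]
      exact (hne X hX).some_mem
    exact (hmem X hX _).1 this
  refine ⟨fun x s => u (pair x (s • (dir x : EuclideanSpace ℝ (Fin k)))), dir, fun X => ?_,
    fun X X' hX hX' => ?_⟩
  · set x := xPart X with hx
    set o : EuclideanSpace ℝ (Fin k) := (dir x).1 with ho
    have hon : ‖o‖ = 1 := mem_sphere_zero_iff_norm.1 (dir x).2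
    set s := inner ℝ o (yPart X) with hs
    set e := yPart X - s • o with he
    have hoe : inner ℝ o e = 0 := by
      rw [he, inner_sub_right, inner_smul_right, real_inner_self_eq_norm_sq, hon, ← hs]; ring
    -- On this line from `(x, s o)` to `X`, the vector `∇_y u` is either zero or a multiple of `o`,
    -- which is orthogonal to the direction `e`. So `u` is constant even if the line crosses `{∇_y u
    -- = 0}`.
    have hd : ∀ t : ℝ, HasDerivAt (fun t : ℝ => u (pair x (s • o) + t • pair 0 e)) 0 t := by
      intro t
      have h1 := hasDerivAt_along (f := u) (X := pair x (s • o)) (v := pair 0 e) (t := t)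
        (hu.contDiff.differentiable one_ne_zero _)
      convert! h1 using 1
      rw [fderiv_pair_eq_inner]
      by_cases hZ : pair x (s • o) + t • pair 0 e ∈ ySet u
      · obtain ⟨c, hc⟩ := hdir _ hZ
        have hxZ : xPart (pair x (s • o) + t • pair 0 e) = x := by
          rw [pair_add_smul, xPart_pair]
        rw [hxZ] at hc
        rw [hc, inner_smul_left, hoe, mul_zero]
      · rw [not_not.1 hZ, inner_zero_left]
    have hconst := is_const_of_deriv_eq_zero (fun t => (hd t).differentiableAt)
      (fun t => (hd t).deriv) 1 0
    beta_reduce at hconst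
    rw [pair_add_smul, pair_add_smul, one_smul, zero_smul, add_zero, he, add_sub_cancel, hx,
      pair_xPart_yPart] at hconst
    exact hconst
  · have hXm : X ∈ connectedComponentIn (ySet u) X := mem_connectedComponentIn hX
    have hsub := connectedComponentIn_subset (ySet u) X
    have hopen := (isOpen_ySet hu.contDiff).connectedComponentIn (x := X)
    have hpre : IsPreconnected (connectedComponentIn (ySet u) X) :=
      isPreconnected_connectedComponentIn
    have h1 := direction_const hu hpar hopen hpre hsub hXm hX'
    have h2 := direction_const hu hpar hopen hpre hsub hX' hXm
    have hS : S (xPart X') = S (xPart X) := by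
      ext σ
      rw [hmem X' (hsub hX'), hmem X hX]
      constructor
      · rintro ⟨c, hc⟩
        exact ⟨‖gradY u X‖ / ‖gradY u X'‖ * c, by rw [mul_smul, ← hc]; exact h2⟩
      · rintro ⟨c, hc⟩
        exact ⟨‖gradY u X'‖ / ‖gradY u X‖ * c, by rw [mul_smul, ← hc]; exact h1⟩
    simp only [dir, hS]

end Geometry

/-- Each `θ^i` has one sign on all of space, and dividing by the positive numbers `|θ^i| |θ^j|`
leaves constants. Symmetry of `F_{ij}` extends the condition from `i < j` to `i ≠ j`. -/
theorem exists_signs {F : EuclideanSpace ℝ (Fin m) → (Fin n → ℝ) → ℝ} (hF : NonlinAssumptions F)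
    {u θ : Fin n → Space m k → ℝ} (hθ : ∀ i, (∀ X, 0 < θ i X) ∨ ∀ X, θ i X < 0)
    (hFθ : ∀ i j, i < j → ∀ X, 0 ≤ F2 F i j (xPart X) (fun l => u l X) * θ i X * θ j X) :
    ∃ σ : Fin n → ℝ, (∀ i, σ i ^ 2 = 1) ∧ ∀ i j, i ≠ j → ∀ X : Space m k,
      0 ≤ F2 F i j (xPart X) (fun l => u l X) * (σ i * σ j) := by
  have hs : ∀ i, ∃ s : ℝ, s ^ 2 = 1 ∧ ∀ X, 0 < s * θ i X := fun i => by
    rcases hθ i with h | h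
    · exact ⟨1, by norm_num, fun X => by simpa using h X⟩
    · exact ⟨-1, by norm_num, fun X => by simpa using h X⟩
  choose σ hσ hσθ using hs
  have hlt : ∀ i j, i < j → ∀ X : Space m k,
      0 ≤ F2 F i j (xPart X) (fun l => u l X) * (σ i * σ j) := by
    intro i j hij X
    have h1 := hFθ i j hij X
    have h2 := mul_pos (hσθ i X) (hσθ j X)
    have h3 : F2 F i j (xPart X) (fun l => u l X) * θ i X * θ j X =
        F2 F i j (xPart X) (fun l => u l X) * (σ i * σ j) * ((σ i * θ i X) * (σ j * θ j X)) := by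
      have : F2 F i j (xPart X) (fun l => u l X) * (σ i * σ j) * ((σ i * θ i X) * (σ j * θ j X)) =
          F2 F i j (xPart X) (fun l => u l X) * θ i X * θ j X * (σ i ^ 2 * σ j ^ 2) := by ring
      rw [this, hσ, hσ]; ring
    rw [h3] at h1
    exact nonneg_of_mul_nonneg_left h1 h2
  refine ⟨σ, hσ, fun i j hij X => ?_⟩
  rcases lt_or_gt_of_ne hij with h | h
  · exact hlt i j h X
  · rw [hF.F2_symm i j, mul_comm (σ i)]
    exact hlt j i h X

end Fibered

end

theorem mainTheorem2 {m k n : ℕ} (hm : 1 ≤ m) (hk : 1 ≤ k)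
    (a : Fin n → EuclideanSpace ℝ (Fin m) → ℝ → ℝ)
    (F : EuclideanSpace ℝ (Fin m) → (Fin n → ℝ) → ℝ)
    (u : Fin n → Fibered.Space m k → ℝ)
    (ha : Fibered.CoeffAssumptions a)
    (hF : Fibered.NonlinAssumptions F)
    (hreg : ∀ i, Fibered.SolutionRegularity (u i))
    (hweak : Fibered.IsWeakSolution a F u)
    (hstable : Fibered.IsStable a F u)
    (hθ : ∃ θ : Fin n → Fibered.Space m k → ℝ,
      (∀ i, ContDiff ℝ 1 (θ i)) ∧
      (∀ i, (∀ X, 0 < θ i X) ∨ (∀ X, θ i X < 0)) ∧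
      ∀ i j, i < j → ∀ X,
        0 ≤ Fibered.F2 F i j (Fibered.xPart X) (fun l => u l X) * θ i X * θ j X)
    (hbdd : ∀ i, Fibered.CoeffLocBounded (a i) (u i))
    (hpos : ∀ i, ∀ᵐ X : Fibered.Space m k ∂MeasureTheory.volume,
      gradient (u i) X ≠ 0 → (Fibered.coeffAt (a i) (u i) X).PosDef)
    (henergy : ∃ C : Fin n → ℝ, (∀ i, 1 ≤ C i) ∧
      ∀ R : ℝ, (∀ j, C j ≤ R) → ∀ i,
        (∫ X in Metric.ball (0 : Fibered.Space m k) R,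
          Fibered.maxEigenvalue (Fibered.coeffAt (a i) (u i) X) * ‖gradient (u i) X‖ ^ 2)
            ≤ C i * R ^ 2) :
    ∀ i, ∃ (ubar : EuclideanSpace ℝ (Fin m) → ℝ → ℝ)
        (ω : EuclideanSpace ℝ (Fin m) → Metric.sphere (0 : EuclideanSpace ℝ (Fin k)) 1),
      (∀ X : Fibered.Space m k, u i X =
        ubar (Fibered.xPart X)
          (inner ℝ (ω (Fibered.xPart X) : EuclideanSpace ℝ (Fin k)) (Fibered.yPart X))) ∧
      ∀ X X' : Fibered.Space m k, Fibered.gradY (u i) X ≠ 0 →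
        X' ∈ connectedComponentIn {Z | Fibered.gradY (u i) Z ≠ 0} X →
        ω (Fibered.xPart X') = ω (Fibered.xPart X) := by
  obtain ⟨θ, -, hθ, hFθ⟩ := hθ
  obtain ⟨C, -, hC⟩ := henergy
  obtain ⟨σ, hσ, hσF⟩ := Fibered.exists_signs hF hθ hFθ
  intro i
  have h0 := Fibered.ae_deficit_eq_zero hm hk ha hF hreg hweak hstable hbdd hσ hσF hpos hC i
  exact Fibered.exists_profile (hreg i)
    (fun X hX j => Fibered.gradient_pd_eq_of_deficit (hreg i) (hpos i) h0 hX j) hk
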